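/- Let $\mathfrak d$ be a real vector space of dimension $n$ and let $\Delta\subset\mathfrak d^*$ be an $n$-dimensional convex polytope, written as $\Delta=\bigcap_{j=1}^d\{\mu\in\mathfrak d^*\mid\langle\mu,X_j\rangle\ge\lambda_j\}$ with nonzero $X_1,\dots,X_d\in\mathfrak d$ and $\lambda_1,\dots,\lambda_d\in\mathbb R$. Let $Q$ be a quasilattice in $\mathfrak d$ (the $\mathbb Z$-span of a finite set that spans $\mathfrak d$ over $\mathbb R$) containing all $X_j$. Let $\pi:\mathbb R^d\to\mathfrak d$ be the linear map with $\pi(e_j)=X_j$, let $N\subset T^d=\mathbb R^d/\mathbb Z^d$ be the kernel of the induced homomorphism $T^d\to\mathfrak d/Q$, $\mathfrak n=\ker\pi$ its Lie algebra and $\iota:\mathfrak n\to\mathbb R^d$ the inclusion. Let $T^d$, and hence $N$, act on $\mathbb C^d$ in the standard way, put $J(z)=\sum_{j=1}^d(|z_j|^2+\lambda_j)e_j^*$ and $\Psi=\iota^*\circ J:\mathbb C^d\to\mathfrak n^*$, let $M=\Psi^{-1}(0)/N$ with the quotient topology, and let $\Phi:M\to\mathfrak d^*$ be the map induced by $(\pi^*)^{-1}\circ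 J$, i.e. $\langle\Phi([z]),X_j\rangle=|z_j|^2+\lambda_j$ for all $j$. The open faces of $\Delta$ are the nonempty sets $F=\{\mu\in\Delta\mid\langle\mu,X_j\rangle=\lambda_j\text{ iff }j\in I_F\}$ with $I_F\subset\{1,\dots,d\}$, ordered by $F\le F'$ iff $F\subseteq\overline{F'}$. A $p$-dimensional face $F$ is singular if $\operatorname{card}(I_F)>n-p$. For a singular face $F$ put $\mathcal T_F=\Phi^{-1}(F)$, and let $\mathcal T_\Delta$ be the union of the sets $\Phi^{-1}(F)$ over all nonsingular faces $F$. A $k$-dimensional quasifold is a topological space covered by open sets homeomorphic to models $\tilde U/\Gamma$, where $\tilde U\subset\mathbb R^k$ is open, connected and simply connected and $\Gamma$ is a countable discrete group acting smoothly on $\tilde U$, freely on a connected dense set of points, and such that each change of charts with nonempty domain is a diffeomorphism of models, i.e. it lifts to a diffeomorphism between the universal covers of the preimages in the two $\tilde U$'s of the common domain (these preimages being connected, and the points of the universal covers lying above points where the group acts freely forming connected sets). Then: 1. For each $p$-dimensional singular face $F$ of $\Delta$, $\mathcal T_F$ is a $2p$-dimensional quasifold. 2. $\mathcal T_\Delta$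 is a $2n$-dimensional quasifold. In both cases the quasifold structure is induced by the smooth structure of the preimage of the piece in $\Psi^{-1}(0)$: it is given by an atlas whose chart maps $\tilde U\to\tilde U/\Gamma\to M$ lift to smooth maps $\tilde U\to\mathbb C^d$ with values in $\Psi^{-1}(0)$ that are immersions transverse to the $N$-orbits (no nonzero tangent vector is mapped to a vector tangent to an $N$-orbit). 3. These subsets give a decomposition of $M$ by quasifolds. That is, label the pieces by the finite set $\mathcal F$ consisting of the singular faces and of the open face $\operatorname{Int}(\Delta)$, the latter labelling $\mathcal T_\Delta$, with the partial order of faces. Then $M$ is compact; the pieces are pairwise disjoint, locally closed, connected quasifolds of dimension $2\dim F$ with union $M$; for all $F,F'\in\mathcal F$ one has $\mathcal T_F\cap\overline{\mathcal T_{F'}}\ne\emptyset$ iff $\mathcal T_F\subseteq\overline{\mathcal T_{F'}}$ iff $F\le F'$ (with $\mathcal T_{\operatorname{Int}(\Delta)}=\mathcal T_\Delta$); and $\mathcal F$ has a greatest element, whose piece is open and dense in $M$ and has dimension $2n$. -/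

import Mathlib

open scoped ContDiff Topology

noncomputable section

/-! ## Quasifolds -/

/-- The set of points at which an action is free (trivial stabilizer). -/
def freePoints (G : Type*) [Group G] (U : Type*) [MulAction G U] : Set U :=
  {x | ∀ g : G, g • x = x → g = 1}

/-- A `k`-dimensional quasifold chart on a topological space `T`: an open, connected and simply
connected subset `U` of `ℝᵏ`, a countable (discrete) group `Γ` acting smoothly on `U` such that the
set of points where the action is free is connected and dense, and a homeomorphism `φ` of the orbit
space `U / Γ`, with the quotient topology, onto an open subset of `T`. -/
structure QuasifoldChart (k : ℕ) (T : Type*) [TopologicalSpace T] where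
  U : TopologicalSpace.Opens (EuclideanSpace ℝ (Fin k))
  simplyConnected : SimplyConnectedSpace U
  Γ : Type
  [group : Group Γ]
  [action : MulAction Γ U]
  countable : Countable Γ
  smooth : ∀ g : Γ, ∃ f : EuclideanSpace ℝ (Fin k) → EuclideanSpace ℝ (Fin k),
    ContDiffOn ℝ ∞ f U ∧ ∀ x : U, f x = ((g • x : U) : EuclideanSpace ℝ (Fin k))
  free_connected : IsConnected (freePoints Γ U)
  free_dense : Dense (freePoints Γ U)
  φ : Quotient (MulAction.orbitRel Γ U) → T
  isOpenEmbedding : Topology.IsOpenEmbedding φ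

attribute [instance] QuasifoldChart.group QuasifoldChart.action

namespace QuasifoldChart

variable {k : ℕ} {T : Type*} [TopologicalSpace T]

/-- The composite `U → U / Γ → T` of the orbit projection with the chart map. -/
def toSpace (c : QuasifoldChart k T) (x : c.U) : T := c.φ (Quotient.mk _ x)

/-- The open subset of `T` that is covered by the chart. -/
def source (c : QuasifoldChart k T) : Set T := Set.range c.φ

/-- The part of `U` that lies over the open subset covered by another chart `c'`. -/
def overlap (c c' : QuasifoldChart k T) : Set c.U := {x | c.toSpace x ∈ c'.source}

/-- Compatibility of charts. If the open sets covered by `c` and `c'` meet, the change of charts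
`c'.φ⁻¹ ∘ c.φ` has to be a diffeomorphism of the models over the intersection, that is, it has to
lift to a diffeomorphism between the universal covers of the two preimages `c.overlap c'` and
`c'.overlap c` of the intersection. The diffeomorphism identifies the two universal covers
with one simply connected space `Z` that covers both preimages, by `a` and by `b`; it is a lift of
the change of charts when `a z` and `b z` always represent the same point of `T`; and it is a
diffeomorphism when, near every point of `Z`, `b` is a smooth function of `a` and `a` is a smooth
function of `b` (the smooth structure of a universal cover is the one pulled back by the covering
map). The points of a universal cover at which the group of all lifts of elements of `Γ` acts
freely are those above `freePoints Γ U`; in a model they form a connected set. -/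
def Compatible (c c' : QuasifoldChart k T) : Prop :=
  (c.source ∩ c'.source).Nonempty →
    ∃ (Z : Type) (_ : TopologicalSpace Z) (a : Z → c.overlap c') (b : Z → c'.overlap c),
      SimplyConnectedSpace Z ∧
      IsCoveringMap a ∧ Function.Surjective a ∧
      IsCoveringMap b ∧ Function.Surjective b ∧
      IsConnected {z : Z | (a z : c.U) ∈ freePoints c.Γ c.U} ∧
      IsConnected {z : Z | (b z : c'.U) ∈ freePoints c'.Γ c'.U} ∧
      (∀ z, c.toSpace (a z) = c'.toSpace (b z)) ∧
      ∀ z, ∃ f g : EuclideanSpace ℝ (Fin k) → EuclideanSpace ℝ (Fin k),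
        ContDiffAt ℝ ∞ f ((a z : c.U) : EuclideanSpace ℝ (Fin k)) ∧
        ContDiffAt ℝ ∞ g ((b z : c'.U) : EuclideanSpace ℝ (Fin k)) ∧
        ∀ᶠ w in 𝓝 z,
          f ((a w : c.U) : EuclideanSpace ℝ (Fin k)) = ((b w : c'.U) : EuclideanSpace ℝ (Fin k)) ∧
          g ((b w : c'.U) : EuclideanSpace ℝ (Fin k)) = ((a w : c.U) : EuclideanSpace ℝ (Fin k))

end QuasifoldChart

/-- A `k`-dimensional quasifold atlas on `T`: pairwise compatible charts that cover `T`.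
As for manifolds, an atlas is not required to be maximal
(by Zorn's lemma it is contained in a maximal one). -/
structure QuasifoldAtlas (k : ℕ) (T : Type*) [TopologicalSpace T] where
  charts : Set (QuasifoldChart k T)
  compatible : ∀ c ∈ charts, ∀ c' ∈ charts, c.Compatible c'
  cover : ∀ t : T, ∃ c ∈ charts, t ∈ c.source

/-- `IsDecompositionByQuasifolds M piece dim m`: the subsets `piece F`, `F ∈ 𝓕`, form a
decomposition of the compact space `M` by quasifolds, `piece F` having dimension `dim F`, and the
regular piece, which is open and dense and belongs to the greatest element of `𝓕`,
has dimension `m`. -/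
structure IsDecompositionByQuasifolds (M : Type*) [TopologicalSpace M] {𝓕 : Type*}
    [PartialOrder 𝓕] (piece : 𝓕 → Set M) (dim : 𝓕 → ℕ) (m : ℕ) : Prop where
  compact : CompactSpace M
  finite : Finite 𝓕
  quasifold : ∀ F, Nonempty (QuasifoldAtlas (dim F) (piece F))
  disjoint : Pairwise fun F F' => Disjoint (piece F) (piece F')
  locallyClosed : ∀ F, IsLocallyClosed (piece F)
  connected : ∀ F, IsConnected (piece F)
  cover : ⋃ F, piece F = Set.univ
  meets_iff_subset : ∀ F F',
    (piece F ∩ closure (piece F')).Nonempty ↔ piece F ⊆ closure (piece F')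
  subset_iff_le : ∀ F F', piece F ⊆ closure (piece F') ↔ F ≤ F'
  regular : ∃ F, (∀ F', F' ≤ F) ∧ IsOpen (piece F) ∧ Dense (piece F) ∧ dim F = m

/-! ## Polytopes and their faces -/

/-- A quasilattice: a finitely generated additive subgroup that spans the vector space. -/
def IsQuasilattice {V : Type*} [AddCommGroup V] [Module ℝ V] (Q : AddSubgroup V) : Prop :=
  Q.FG ∧ Submodule.span ℝ (Q : Set V) = ⊤

/-- A convex polytope: the convex hull of a nonempty finite set of points. -/
def IsConvexPolytope {E : Type*} [AddCommGroup E] [Module ℝ E] (Δ : Set E) : Prop :=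
  ∃ s : Set E, s.Finite ∧ s.Nonempty ∧ Δ = convexHull ℝ s

/-- The dimension of a subset of a vector space, i.e. of its affine hull. -/
def affineDim {E : Type*} [AddCommGroup E] [Module ℝ E] (A : Set E) : ℕ :=
  Module.finrank ℝ (vectorSpan ℝ A)

section Construction

variable {V : Type*} [NormedAddCommGroup V] [NormedSpace ℝ V] {d : ℕ}

/-- The intersection of the half-spaces `⟨μ, X j⟩ ≥ lam j` in the dual space. -/
def halfSpaceInter (X : Fin d → V) (lam : Fin d → ℝ) : Set (StrongDual ℝ V) :=
  ⋂ j, {μ | lam j ≤ μ (X j)}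

/-- The set of points of the polytope at which exactly the inequalities in `I` are equalities. -/
def openFace (X : Fin d → V) (lam : Fin d → ℝ) (I : Finset (Fin d)) : Set (StrongDual ℝ V) :=
  {μ | μ ∈ halfSpaceInter X lam ∧ ∀ j, μ (X j) = lam j ↔ j ∈ I}

/-- The (nonempty) open faces of the polytope. A face `F` is
given by its index set `I_F`, which it determines. -/
structure Face (X : Fin d → V) (lam : Fin d → ℝ) where
  I : Finset (Fin d)
  nonempty : (openFace X lam I).Nonempty

namespace Face

variable {X : Fin d → V} {lam : Fin d → ℝ}

/-- The face as a subset of the dual space. -/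
def carrier (F : Face X lam) : Set (StrongDual ℝ V) := openFace X lam F.I

/-- The dimension of the face. -/
def dim (F : Face X lam) : ℕ := affineDim F.carrier

/-- A `p`-dimensional face is singular if `r_F > n - p`, with `r_F` the number of elements
of `I_F`. -/
def IsSingular (F : Face X lam) : Prop := Module.finrank ℝ V < F.I.card + F.dim

@[ext] theorem ext {F G : Face X lam} (h : F.I = G.I) : F = G := by
  cases F; cases G; cases h; rfl

theorem index_subset {F G : Face X lam} (h : F.carrier ⊆ closure G.carrier) : G.I ⊆ F.I := by
  intro j hj
  obtain ⟨μ, hμ⟩ := F.nonempty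
  refine (hμ.2 j).1 ?_
  have hc : IsClosed {ν : StrongDual ℝ V | ν (X j) = lam j} :=
    isClosed_eq (ContinuousLinearMap.apply ℝ ℝ (X j)).continuous continuous_const
  exact closure_minimal (fun ν hν => (hν.2 j).2 hj) hc (h hμ)

/-- `F ≤ F'` if `F` is contained in the closure of `F'`. -/
instance : PartialOrder (Face X lam) where
  le F G := F.carrier ⊆ closure G.carrier
  le_refl _ := subset_closure
  le_trans _ _ _ h h' := h.trans (closure_minimal h' isClosed_closure)
  le_antisymm _ _ h h' := Face.ext ((index_subset h').antisymm (index_subset h))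

end Face

/-! ## The construction of `M` -/

/-- The linear map `π : ℝᵈ → V` with `π (e j) = X j`. -/
def piMap (X : Fin d → V) : (Fin d → ℝ) →ₗ[ℝ] V := Fintype.linearCombination ℝ X

/-- The group `N`, kernel of the homomorphism `ℝᵈ / ℤᵈ → V / Q` induced by `π`. The torus
`ℝᵈ / ℤᵈ` is written as the group of `d`-tuples of complex numbers of modulus one, the class of `x`
being `(exp (2 π i x j))`. -/
def groupN (X : Fin d → V) (Q : AddSubgroup V) : Subgroup (Fin d → Circle) where
  carrier := {t | ∃ x : Fin d → ℝ, piMap X x ∈ Q ∧ ∀ j, t j = Circle.exp (2 * Real.pi * x j)}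
  one_mem' := ⟨0, by simp, by simp⟩
  mul_mem' := by
    rintro s t ⟨x, hx, hs⟩ ⟨y, hy, ht⟩
    refine ⟨x + y, by simpa using Q.add_mem hx hy, fun j => ?_⟩
    rw [Pi.mul_apply, hs, ht, ← Circle.exp_add, Pi.add_apply, mul_add]
  inv_mem' := by
    rintro s ⟨x, hx, hs⟩
    refine ⟨-x, by simpa using Q.neg_mem hx, fun j => ?_⟩
    rw [Pi.inv_apply, hs, ← Circle.exp_neg, Pi.neg_apply, mul_neg]

/-- The Lie algebra of `N`. -/
def lieN (X : Fin d → V) : Submodule ℝ (Fin d → ℝ) := LinearMap.ker (piMap X)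

/-- The moment map `J z = ∑ j, (|z j|² + lam j) e_j^*` of the torus action on `ℂᵈ`. -/
def momentJ (lam : Fin d → ℝ) (z : Fin d → ℂ) : Module.Dual ℝ (Fin d → ℝ) :=
  ∑ j, (‖z j‖ ^ 2 + lam j) • LinearMap.proj j

/-- The moment map `Ψ = ι^* ∘ J` of the action of `N` on `ℂᵈ`. -/
def momentPsi (X : Fin d → V) (lam : Fin d → ℝ) (z : Fin d → ℂ) : Module.Dual ℝ (lieN X) :=
  (lieN X).subtype.dualMap (momentJ lam z)

/-- The level set `Ψ⁻¹(0)`. -/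
abbrev zeroLevel (X : Fin d → V) (lam : Fin d → ℝ) : Set (Fin d → ℂ) :=
  {z | momentPsi X lam z = 0}

/-- Two points of `Ψ⁻¹(0)` are equivalent if they lie in one orbit of `N`
(acting by multiplication of coordinates). -/
abbrev orbitSetoid (X : Fin d → V) (lam : Fin d → ℝ) (Q : AddSubgroup V) :
    Setoid (zeroLevel X lam) :=
  (MulAction.orbitRel (groupN X Q) (Fin d → ℂ)).comap Subtype.val

/-- The space `M = Ψ⁻¹(0) / N` with the quotient topology. -/
abbrev spaceM (X : Fin d → V) (lam : Fin d → ℝ) (Q : AddSubgroup V) : Type :=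
  Quotient (orbitSetoid X lam Q)

/-- The map `π^* : V^* → (ℝᵈ)^*`. -/
def piStar (X : Fin d → V) (μ : StrongDual ℝ V) : Module.Dual ℝ (Fin d → ℝ) :=
  (piMap X).dualMap (μ : V →ₗ[ℝ] ℝ)

/-- The map `Φ : M → V^*` induced by `(π^*)⁻¹ ∘ J`; on `Ψ⁻¹(0)` the values
of `J` are in the range of `π^*`, which is injective if the `X j` span `V`. -/
def momentPhi (X : Fin d → V) (lam : Fin d → ℝ) (Q : AddSubgroup V) :
    spaceM X lam Q → StrongDual ℝ V :=
  Quotient.lift (fun z => Function.invFun (piStar X) (momentJ lam z.1)) (by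
    rintro z w ⟨t, ht⟩
    have h : momentJ lam z.1 = momentJ lam w.1 := by
      have hz : ∀ j, ‖z.1 j‖ = ‖w.1 j‖ := by
        intro j
        have hj : z.1 j = (t.1 j : ℂ) * w.1 j := (congrFun ht j).symm
        rw [hj, norm_mul, Circle.norm_coe, one_mul]
      simp only [momentJ, hz]
    simp only [h])

/-- The piece `T_F = Φ⁻¹(F)`. -/
def facePiece (X : Fin d → V) (lam : Fin d → ℝ) (Q : AddSubgroup V) (F : Face X lam) :
    Set (spaceM X lam Q) :=
  momentPhi X lam Q ⁻¹' F.carrier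

/-- The regular piece `T_Δ`, the union of the sets `Φ⁻¹(F)` over all nonsingular faces `F`. -/
def regularPiece (X : Fin d → V) (lam : Fin d → ℝ) (Q : AddSubgroup V) :
    Set (spaceM X lam Q) :=
  ⋃ (F : Face X lam) (_ : ¬ F.IsSingular), facePiece X lam Q F

/-- The labels of the pieces: the singular faces, and the interior of the polytope
for the regular piece. -/
abbrev PieceIndex (X : Fin d → V) (lam : Fin d → ℝ) : Type :=
  {F : Face X lam // F.IsSingular ∨ F.carrier = interior (halfSpaceInter X lam)}

open Classical in
/-- The piece of `M` with a given label. -/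
def piece (X : Fin d → V) (lam : Fin d → ℝ) (Q : AddSubgroup V) (F : PieceIndex X lam) :
    Set (spaceM X lam Q) :=
  if F.1.IsSingular then facePiece X lam Q F.1 else regularPiece X lam Q

/-- The quasifold structure on a piece `T` of `M` is induced by the smooth structure of the part of
`Ψ⁻¹(0)` above `T`: the chart maps `U → T` lift to smooth maps `σ` from `U` to `Ψ⁻¹(0) ⊆ ℂᵈ` that are
immersions transverse to the `N`-orbits, i.e. no nonzero tangent vector of `U` is mapped by `dσ` to
a tangent vector `(i y j z j)`, `y` in the Lie algebra of `N`, of the orbit through `z = σ x`. -/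
def QuasifoldAtlas.IsInduced {X : Fin d → V} {lam : Fin d → ℝ} {Q : AddSubgroup V} {k : ℕ}
    {T : Set (spaceM X lam Q)} (A : QuasifoldAtlas k T) : Prop :=
  ∀ c ∈ A.charts, ∃ σ : EuclideanSpace ℝ (Fin k) → (Fin d → ℂ),
    ContDiffOn ℝ ∞ σ c.U ∧
    ∀ x : c.U,
      (∃ h : σ x ∈ zeroLevel X lam,
        (Quotient.mk (orbitSetoid X lam Q) ⟨σ x, h⟩) = (c.toSpace x : spaceM X lam Q)) ∧
      ∀ v : EuclideanSpace ℝ (Fin k),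
        (∃ y ∈ lieN X, ∀ j, fderiv ℝ σ x v j = Complex.I * (y j : ℂ) * σ x j) → v = 0

end Construction

end

/-! A point z of the zero level has radii prescribed by the functional μ in Δ with μ(X j) = |z j|² +
lam j, and N acts on its phases alone. Let K be a set of coordinates that must vanish, and I a set
of coordinates that may vanish, with the X i, i ∈ I, independent modulo the span of the X k, k ∈ K.
Complete I to a set A for which the X a, a ∈ A, are a basis of V modulo that span (`exists_frame`).
The squared radii over A determine μ, hence all radii, and N can rotate every phase outside A to 1.
What remains is an open set in ℂ^A: a coordinate in I is kept as it is, while a coordinate in A \ I,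
which never vanishes, is unrolled to |z a|² + iθ with θ its angle in full turns. The remaining
identifications form a countable group, the image of Q under the coordinate map κ; it rotates the
coordinates in I and translates the others (`mk_lift_eq_iff`).

The model domain is cut out by inequalities that are affine in the squared radii. Hence it is
contractible (`contractibleSpace_domain`), and even convex when I is empty. The points whose
coordinates in I are all nonzero are dense, the group acts freely on them, and they are connected,
being the image under polar coordinates of the convex domain for the empty set.

The piece of a singular face needs one chart, with K = I_F and I empty. The regular piece has K
empty and charts for the independent index sets I. On the overlap of the charts for I and I' only
coordinates in I ∩ I' can vanish. Unrolling the others yields the model for I ∩ I', which is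
contractible and covers both overlaps, so it is their common universal cover
(`isSmoothCovering_polar_changeFrame`, `IsAdapted.compatible`).

For the decomposition, faces are ordered by reverse inclusion of index sets (`Face.le_iff`), and the
closure of a stratum is found by moving radii along segments in Δ (`mem_closure_stratum`). A face is
nonsingular exactly when its X i are independent (`Face.not_isSingular_iff`). Independence passes to
subsets, so the regular piece is open and misses the closures of the singular ones. -/

noncomputable section

/-! ### Charts and compatibility in arbitrary normed spaces -/

/-- Data of a quasifold chart modelled on an open subset of an arbitrary normed space `E`. -/
structure OrbitModel (E : Type) [NormedAddCommGroup E] [NormedSpace ℝ E]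
    (T : Type*) [TopologicalSpace T] where
  U : Set E
  isOpen : IsOpen U
  contractible : ContractibleSpace U
  H : Subgroup (Equiv.Perm U)
  countable : Countable H
  smooth : ∀ h ∈ H, ∃ f : E → E, ContDiffOn ℝ ∞ f U ∧ ∀ x : U, f x = h x
  D : Set U
  isConnected : IsConnected D
  dense : Dense D
  free : ∀ x ∈ D, ∀ h ∈ H, h x = x → h = 1
  F : U → T
  continuous : Continuous F
  isOpenMap : IsOpenMap F
  fiber : ∀ x y, F x = F y ↔ ∃ h ∈ H, h x = y

namespace OrbitModel

variable {E : Type} [NormedAddCommGroup E] [NormedSpace ℝ E]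
  {T : Type*} [TopologicalSpace T] {k : ℕ}

/-- The transport of the model domain along a linear equivalence. -/
def domainHomeo (U : Set E) (e : E ≃L[ℝ] EuclideanSpace ℝ (Fin k)) :
    (e.symm ⁻¹' U : Set (EuclideanSpace ℝ (Fin k))) ≃ₜ U where
  toFun x := ⟨e.symm x, x.2⟩
  invFun x := ⟨e x, by simp⟩
  left_inv x := by simp
  right_inv x := by simp
  continuous_toFun := by fun_prop
  continuous_invFun := by fun_prop

/-- The quasifold chart given by an orbit model. -/
def toChart (m : OrbitModel E T) (e : E ≃L[ℝ] EuclideanSpace ℝ (Fin k)) :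
    QuasifoldChart k T :=
  letI act : MulAction m.H (e.symm ⁻¹' m.U : Set (EuclideanSpace ℝ (Fin k))) :=
    { smul := fun g x => (domainHomeo m.U e).symm (g.1 (domainHomeo m.U e x))
      one_smul := fun x => (domainHomeo m.U e).symm_apply_apply x
      mul_smul := fun g h x => by
        change (domainHomeo m.U e).symm _ = (domainHomeo m.U e).symm (g.1 (domainHomeo m.U e
          ((domainHomeo m.U e).symm _)))
        rw [Homeomorph.apply_symm_apply]
        rfl }
  have orbit : ∀ x y : (e.symm ⁻¹' m.U : Set (EuclideanSpace ℝ (Fin k))),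
      m.F (domainHomeo m.U e x) = m.F (domainHomeo m.U e y) ↔
        (MulAction.orbitRel m.H _) x y := by
    intro x y
    rw [eq_comm, m.fiber]
    constructor
    · rintro ⟨h, hh, hxy⟩
      refine ⟨⟨h, hh⟩, ?_⟩
      change (domainHomeo m.U e).symm (h (domainHomeo m.U e y)) = x
      rw [hxy, Homeomorph.symm_apply_apply]
    · rintro ⟨h, hxy⟩
      refine ⟨h.1, h.2, ?_⟩
      rw [← hxy]
      exact ((domainHomeo m.U e).apply_symm_apply _).symm
  have dense_free : (domainHomeo m.U e ⁻¹' m.D) ⊆ freePoints m.H _ := by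
    intro x hx g hg
    have : g.1 (domainHomeo m.U e x) = domainHomeo m.U e x := by
      conv_rhs => rw [← hg]
      exact ((domainHomeo m.U e).apply_symm_apply _).symm
    exact Subtype.ext (m.free _ hx _ g.2 this)
  have hdense : Dense (domainHomeo m.U e ⁻¹' m.D) :=
    m.dense.preimage (domainHomeo m.U e).isOpenMap
  { U := ⟨e.symm ⁻¹' m.U, m.isOpen.preimage e.symm.continuous⟩
    simplyConnected := by
      have := m.contractible
      have := (domainHomeo m.U e).contractibleSpace
      exact SimplyConnectedSpace.ofContractible _
    Γ := m.H
    group := inferInstance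
    action := act
    countable := m.countable
    smooth := by
      intro g
      obtain ⟨f, hf, hfg⟩ := m.smooth g.1 g.2
      refine ⟨fun x => e (f (e.symm x)), ?_, fun x => ?_⟩
      · exact e.contDiff.comp_contDiffOn (hf.comp e.symm.contDiff.contDiffOn fun x hx => hx)
      · exact congrArg e (hfg (domainHomeo m.U e x))
    -- The free points lie between the connected set `D` and its closure, which is everything.
    free_connected := by
      refine IsConnected.subset_closure (s := domainHomeo m.U e ⁻¹' m.D) ?_ dense_free ?_
      · have := m.isConnected.image _ (domainHomeo m.U e).symm.continuous.continuousOn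
        rwa [Homeomorph.image_symm] at this
      · rw [hdense.closure_eq]
        exact Set.subset_univ _
    free_dense := hdense.mono dense_free
    φ := Quotient.lift (fun x => m.F (domainHomeo m.U e x)) fun x y h => (orbit x y).2 h
    isOpenEmbedding := by
      refine .of_continuous_injective_isOpenMap ?_ ?_ ?_
      · exact (m.continuous.comp (domainHomeo m.U e).continuous).quotient_lift _
      · rintro ⟨x⟩ ⟨y⟩ h
        exact Quotient.sound ((orbit x y).1 h)
      · intro W hW
        have h1 : IsOpen ((fun x => m.F (domainHomeo m.U e x)) '' (Quotient.mk _ ⁻¹' W)) :=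
          (m.isOpenMap.comp (domainHomeo m.U e).isOpenMap) _ (hW.preimage continuous_quotient_mk')
        convert h1 using 1
        ext t
        constructor
        · rintro ⟨⟨x⟩, hx, rfl⟩
          exact ⟨x, hx, rfl⟩
        · rintro ⟨x, hx, rfl⟩
          exact ⟨Quotient.mk _ x, hx, rfl⟩ }

theorem toChart_toSpace (m : OrbitModel E T) (e : E ≃L[ℝ] EuclideanSpace ℝ (Fin k))
    (x : (m.toChart e).U) : (m.toChart e).toSpace x = m.F (domainHomeo m.U e x) := rfl

theorem toChart_source (m : OrbitModel E T) (e : E ≃L[ℝ] EuclideanSpace ℝ (Fin k)) :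
    (m.toChart e).source = Set.range m.F := by
  ext t
  constructor
  · rintro ⟨⟨x⟩, rfl⟩
    exact ⟨domainHomeo m.U e x, rfl⟩
  · rintro ⟨x, rfl⟩
    exact ⟨Quotient.mk _ ((domainHomeo m.U e).symm x),
      congrArg m.F ((domainHomeo m.U e).apply_symm_apply x)⟩

theorem preimage_subset_freePoints (m : OrbitModel E T)
    (e : E ≃L[ℝ] EuclideanSpace ℝ (Fin k)) (x : (m.toChart e).U)
    (hx : domainHomeo m.U e x ∈ m.D) : x ∈ freePoints (m.toChart e).Γ (m.toChart e).U := by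
  intro g hg
  have : g.1 (domainHomeo m.U e x) = domainHomeo m.U e x := by
    conv_rhs => rw [← hg]
    exact ((domainHomeo m.U e).apply_symm_apply _).symm
  exact Subtype.ext (m.free _ hx _ g.2 this)

end OrbitModel

/-- A smooth covering of a set `Y` by a set `Z`, both lying in normed spaces. -/
structure IsSmoothCovering {E E' : Type*} [NormedAddCommGroup E] [NormedSpace ℝ E]
    [NormedAddCommGroup E'] [NormedSpace ℝ E'] (Z : Set E) (Y : Set E') (p : E → E') : Prop where
  mapsTo : Set.MapsTo p Z Y
  surjOn : Set.SurjOn p Z Y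
  isCoveringMap : IsCoveringMap (mapsTo.restrict p Z Y)
  contDiffAt : ∀ z ∈ Z, ContDiffAt ℝ ∞ p z
  -- The local inverse lives on the ambient space, so its smoothness needs no structure on `Y`. It
  -- supplies the transition functions `f` and `g` of `Compatible`.
  exists_section : ∀ z ∈ Z, ∃ s : E' → E, ContDiffAt ℝ ∞ s (p z) ∧ s (p z) = z ∧
    ∀ᶠ w in 𝓝[Z] z, s (p w) = w

namespace IsSmoothCovering

variable {E E' E'' : Type*} [NormedAddCommGroup E] [NormedSpace ℝ E]
    [NormedAddCommGroup E'] [NormedSpace ℝ E'] [NormedAddCommGroup E''] [NormedSpace ℝ E'']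
    {Z : Set E} {Y : Set E'} {p : E → E'}

theorem comp_diffeo (hp : IsSmoothCovering Z Y p) {Z' : Set E''} {h : E'' → E} {h' : E → E''}
    (hm : Set.MapsTo h Z' Z) (hm' : Set.MapsTo h' Z Z') (hl : ∀ x ∈ Z', h' (h x) = x)
    (hr : ∀ x ∈ Z, h (h' x) = x) (hs : ∀ x ∈ Z', ContDiffAt ℝ ∞ h x)
    (hs' : ∀ x ∈ Z, ContDiffAt ℝ ∞ h' x) : IsSmoothCovering Z' Y (p ∘ h) where
  mapsTo := hp.mapsTo.comp hm
  surjOn := by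
    intro y hy
    obtain ⟨z, hz, rfl⟩ := hp.surjOn hy
    exact ⟨h' z, hm' hz, by simp [hr z hz]⟩
  isCoveringMap := by
    let g : Z' ≃ₜ Z :=
      { toFun := hm.restrict h Z' Z
        invFun := hm'.restrict h' Z Z'
        left_inv := fun x => Subtype.ext (hl x x.2)
        right_inv := fun x => Subtype.ext (hr x x.2)
        continuous_toFun := ContinuousOn.mapsToRestrict
          (fun x hx => (hs x hx).continuousAt.continuousWithinAt) hm
        continuous_invFun := ContinuousOn.mapsToRestrict
          (fun x hx => (hs' x hx).continuousAt.continuousWithinAt) hm' }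
    exact hp.isCoveringMap.comp_homeomorph g
  contDiffAt := fun z hz => (hp.contDiffAt _ (hm hz)).comp z (hs z hz)
  exists_section := by
    intro z hz
    obtain ⟨s, hs1, hs2, hs3⟩ := hp.exists_section _ (hm hz)
    refine ⟨h' ∘ s, ?_, ?_, ?_⟩
    · refine ContDiffAt.comp _ ?_ hs1
      rw [Function.comp_apply, hs2]
      exact hs' _ (hm hz)
    · simp [hs2, hl z hz]
    · have : Filter.Tendsto h (𝓝[Z'] z) (𝓝[Z] (h z)) :=
        (hs z hz).continuousAt.continuousWithinAt.tendsto_nhdsWithin hm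
      filter_upwards [this.eventually hs3, self_mem_nhdsWithin] with w hw hwZ
      simp only [Function.comp_apply] at hw ⊢
      rw [hw, hl w hwZ]

end IsSmoothCovering

namespace OrbitModel

variable {E E' E'' : Type} [NormedAddCommGroup E] [NormedSpace ℝ E]
  [NormedAddCommGroup E'] [NormedSpace ℝ E'] [NormedAddCommGroup E''] [NormedSpace ℝ E'']
  {T : Type*} [TopologicalSpace T] {k : ℕ}

/-- The part of the domain of a model that lies over a subset. -/
def partOver (m : OrbitModel E T) (S : Set T) : Set E := {x | ∃ h : x ∈ m.U, m.F ⟨x, h⟩ ∈ S}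

/-- The part of a model over the source of another one is the overlap of the charts. -/
def overHomeo (m : OrbitModel E T) (m' : OrbitModel E' T)
    (e : E ≃L[ℝ] EuclideanSpace ℝ (Fin k)) (e' : E' ≃L[ℝ] EuclideanSpace ℝ (Fin k)) :
    m.partOver (Set.range m'.F) ≃ₜ (m.toChart e).overlap (m'.toChart e') where
  toFun x := ⟨⟨e x, by
      obtain ⟨x, h, -⟩ := x
      change e.symm (e x) ∈ m.U
      simpa using h⟩, by
      obtain ⟨x, h, hx⟩ := x
      change (m.toChart e).toSpace _ ∈ (m'.toChart e').source
      rw [toChart_source, toChart_toSpace]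
      convert hx
      simp [domainHomeo]⟩
  invFun x := ⟨e.symm x.1, by
      obtain ⟨⟨x, h⟩, hx⟩ := x
      change (m.toChart e).toSpace _ ∈ (m'.toChart e').source at hx
      rw [toChart_source, toChart_toSpace] at hx
      exact ⟨h, hx⟩⟩
  left_inv x := Subtype.ext (e.symm_apply_apply _)
  right_inv x := Subtype.ext (Subtype.ext (e.apply_symm_apply _))
  continuous_toFun := by
    refine Continuous.subtype_mk (Continuous.subtype_mk ?_ _) _
    exact e.continuous.comp continuous_subtype_val
  continuous_invFun := by
    refine Continuous.subtype_mk ?_ _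
    exact e.symm.continuous.comp (continuous_subtype_val.comp continuous_subtype_val)

/-- The transition function is `b` composed with a local inverse of `a`. -/
theorem exists_transition {Z : Set E''} {Y : Set E} {Y' : Set E'} {a : E'' → E} {b : E'' → E'}
    (ha : IsSmoothCovering Z Y a) (hb : IsSmoothCovering Z Y' b)
    (e : E ≃L[ℝ] EuclideanSpace ℝ (Fin k)) (e' : E' ≃L[ℝ] EuclideanSpace ℝ (Fin k)) (z : Z) :
    ∃ f : EuclideanSpace ℝ (Fin k) → EuclideanSpace ℝ (Fin k),
      ContDiffAt ℝ ∞ f (e (a z)) ∧ ∀ᶠ w : Z in 𝓝 z, f (e (a w)) = e' (b w) := by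
  obtain ⟨s, hs1, hs2, hs3⟩ := ha.exists_section z z.2
  refine ⟨fun x => e' (b (s (e.symm x))), ?_, ?_⟩
  · have h0 : ContDiffAt ℝ ∞ (fun x => e.symm x) (e (a z)) := e.symm.contDiff.contDiffAt
    have h1 : ContDiffAt ℝ ∞ (fun x => s (e.symm x)) (e (a z)) :=
      ContDiffAt.comp (e (a z)) (g := s) (by simpa using hs1) h0
    have h2 : ContDiffAt ℝ ∞ (fun x => b (s (e.symm x))) (e (a z)) := by
      refine ContDiffAt.comp (e (a z)) (g := b) ?_ h1
      simpa [hs2] using hb.contDiffAt z z.2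
    exact e'.contDiff.contDiffAt.comp (e (a z)) h2
  · rw [nhdsWithin_eq_map_subtype_coe z.2, Filter.eventually_map] at hs3
    filter_upwards [hs3] with w hw
    simp [hw]

/-- The set `Z` is the common universal cover of the two overlaps. Keeping it inside a normed space
makes lifting the change of charts a matter of two smooth coverings with the same composite to `T`.
-/
theorem compatible_of_coverings (m : OrbitModel E T) (m' : OrbitModel E' T)
    (e : E ≃L[ℝ] EuclideanSpace ℝ (Fin k)) (e' : E' ≃L[ℝ] EuclideanSpace ℝ (Fin k))
    {Z : Set E''} (hZ : SimplyConnectedSpace Z) {a : E'' → E} {b : E'' → E'}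
    (ha : IsSmoothCovering Z (m.partOver (Set.range m'.F)) a)
    (hb : IsSmoothCovering Z (m'.partOver (Set.range m.F)) b)
    {D : Set Z} (hD : IsConnected D) (hD' : Dense D)
    (haD : ∀ z ∈ D, ∃ h, (⟨a z, h⟩ : m.U) ∈ m.D)
    (hbD : ∀ z ∈ D, ∃ h, (⟨b z, h⟩ : m'.U) ∈ m'.D)
    (hab : ∀ z ∈ Z, ∀ h h', m.F ⟨a z, h⟩ = m'.F ⟨b z, h'⟩) :
    (m.toChart e).Compatible (m'.toChart e') := by
  intro _
  let qa := m.overHomeo m' e e'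
  let qb := m'.overHomeo m e' e
  have key : ∀ {S : Set Z}, D ⊆ S → IsConnected S := fun h =>
    hD.subset_closure h (by rw [hD'.closure_eq]; exact Set.subset_univ _)
  refine ⟨Z, inferInstance, qa ∘ ha.mapsTo.restrict a _ _, qb ∘ hb.mapsTo.restrict b _ _, hZ,
    ha.isCoveringMap.homeomorph_comp _, ?_, hb.isCoveringMap.homeomorph_comp _, ?_, ?_, ?_, ?_, ?_⟩
  · exact qa.surjective.comp (ha.mapsTo.restrict_surjective_iff.2 ha.surjOn)
  · exact qb.surjective.comp (hb.mapsTo.restrict_surjective_iff.2 hb.surjOn)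
  · refine key fun z hz => m.preimage_subset_freePoints e _ ?_
    obtain ⟨h, hz⟩ := haD z hz
    convert hz using 1
    exact Subtype.ext (e.symm_apply_apply _)
  · refine key fun z hz => m'.preimage_subset_freePoints e' _ ?_
    obtain ⟨h, hz⟩ := hbD z hz
    convert hz using 1
    exact Subtype.ext (e'.symm_apply_apply _)
  · intro z
    obtain ⟨h, -⟩ := ha.mapsTo z.2
    obtain ⟨h', -⟩ := hb.mapsTo z.2
    rw [toChart_toSpace, toChart_toSpace]
    convert hab z z.2 h h' using 2
    · exact Subtype.ext (e.symm_apply_apply _)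
    · exact Subtype.ext (e'.symm_apply_apply _)
  · intro z
    obtain ⟨f, hf, hf'⟩ := exists_transition ha hb e e' z
    obtain ⟨g, hg, hg'⟩ := exists_transition hb ha e' e z
    refine ⟨f, g, hf, hg, ?_⟩
    filter_upwards [hf', hg'] with w h1 h2 using ⟨h1, h2⟩

end OrbitModel

/-! ## Phases -/

/-- The complex number `exp (2 π i t)`. -/
def phase (t : ℝ) : ℂ := Circle.exp (2 * Real.pi * t)

theorem phase_def (t : ℝ) : phase t = Complex.exp (2 * Real.pi * t * Complex.I) := by
  rw [phase, Circle.coe_exp]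
  push_cast
  rfl

@[simp] theorem norm_phase (t : ℝ) : ‖phase t‖ = 1 := Circle.norm_coe _

@[simp] theorem phase_zero : phase 0 = 1 := by simp [phase]

theorem phase_add (s t : ℝ) : phase (s + t) = phase s * phase t := by
  simp [phase, mul_add, Circle.exp_add]

theorem phase_ne_zero (t : ℝ) : phase t ≠ 0 := norm_ne_zero_iff.1 (by simp)

theorem phase_eq_one_iff (t : ℝ) : phase t = 1 ↔ ∃ n : ℤ, t = n := by
  rw [phase_def, Complex.exp_eq_one_iff]
  have h : (2 * Real.pi * Complex.I : ℂ) ≠ 0 := Complex.two_pi_I_ne_zero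
  refine exists_congr fun n => ?_
  rw [show (2 * Real.pi * t * Complex.I : ℂ) = t * (2 * Real.pi * Complex.I) by ring,
    mul_left_inj' h]
  norm_cast

theorem phase_intCast (n : ℤ) : phase n = 1 := (phase_eq_one_iff _).2 ⟨n, rfl⟩

theorem phase_eq_iff (s t : ℝ) : phase s = phase t ↔ ∃ n : ℤ, s - t = n := by
  rw [← phase_eq_one_iff, sub_eq_add_neg, phase_add]
  have h : phase t * phase (-t) = 1 := by rw [← phase_add]; simp
  constructor
  · rintro h'
    rw [h', h]
  · intro h'
    have := congrArg (· * phase t) h'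
    simpa [mul_assoc, mul_comm (phase (-t)), h] using this

theorem contDiff_phase : ContDiff ℝ ∞ phase := by
  have : phase = fun t : ℝ => Complex.exp (2 * Real.pi * (t : ℂ) * Complex.I) :=
    funext phase_def
  rw [this]
  have h : ContDiff ℝ ∞ fun t : ℝ => (t : ℂ) := Complex.ofRealCLM.contDiff
  fun_prop

theorem hasDerivAt_phase (t : ℝ) :
    HasDerivAt phase (2 * Real.pi * Complex.I * phase t) t := by
  have h1 : HasDerivAt (fun t : ℝ => (2 * Real.pi * t * Complex.I : ℂ))
      (2 * Real.pi * 1 * Complex.I) t :=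
    ((Complex.ofRealCLM.hasDerivAt (x := t)).const_mul (2 * Real.pi : ℂ)).mul_const Complex.I
  have h2 := h1.cexp
  have : phase = fun t : ℝ => Complex.exp (2 * Real.pi * t * Complex.I) := funext phase_def
  rw [this]
  convert h2 using 1
  ring

theorem norm_mul_phase_arg (z : ℂ) : (‖z‖ : ℂ) * phase (Complex.arg z / (2 * Real.pi)) = z := by
  rw [phase_def]
  have : (2 * Real.pi * ((Complex.arg z / (2 * Real.pi) : ℝ) : ℂ) * Complex.I : ℂ)
      = Complex.arg z * Complex.I := by
    have : (Real.pi : ℂ) ≠ 0 := by exact_mod_cast Real.pi_ne_zero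
    push_cast
    field_simp
  rw [this, Complex.norm_mul_exp_arg_mul_I]

/-! ## The topology of the quotient -/

section Quotient

variable {V : Type*} [NormedAddCommGroup V] [NormedSpace ℝ V] {d : ℕ}
  {X : Fin d → V} {lam : Fin d → ℝ} {Q : AddSubgroup V}

theorem piMap_apply (x : Fin d → ℝ) : piMap X x = ∑ j, x j • X j := by
  simp [piMap, Fintype.linearCombination_apply]

theorem mk_eq_mk_iff (z w : zeroLevel X lam) :
    Quotient.mk (orbitSetoid X lam Q) z = Quotient.mk (orbitSetoid X lam Q) w ↔
      ∃ x, piMap X x ∈ Q ∧ ∀ j, phase (x j) * z.1 j = w.1 j := by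
  rw [eq_comm, Quotient.eq]
  constructor
  · rintro ⟨⟨t, x, hx, ht⟩, h⟩
    refine ⟨x, hx, fun j => ?_⟩
    rw [phase, ← ht j]
    exact congrFun h j
  · rintro ⟨x, hx, h⟩
    exact ⟨⟨fun j => Circle.exp (2 * Real.pi * x j), x, hx, fun _ => rfl⟩, funext h⟩

/-- The annihilator of ker π is the range of π^*, so Ψ(z) = 0 means that J(z) is pulled back from a
functional on V. -/
theorem mem_zeroLevel_iff [FiniteDimensional ℝ V] (z : Fin d → ℂ) :
    z ∈ zeroLevel X lam ↔ ∃ μ : StrongDual ℝ V, ∀ j, μ (X j) = ‖z j‖ ^ 2 + lam j := by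
  have h1 : z ∈ zeroLevel X lam ↔ momentJ lam z ∈ (lieN X).dualAnnihilator := by
    rw [Submodule.mem_dualAnnihilator]
    change momentPsi X lam z = 0 ↔ _
    rw [LinearMap.ext_iff]
    exact ⟨fun h y hy => h ⟨y, hy⟩, fun h y => h y.1 y.2⟩
  have h2 : ∀ j, momentJ lam z (Pi.single j 1) = ‖z j‖ ^ 2 + lam j := by
    intro j
    simp [momentJ, Pi.single_apply]
  rw [h1, lieN, ← LinearMap.range_dualMap_eq_dualAnnihilator_ker]
  constructor
  · rintro ⟨μ, hμ⟩
    refine ⟨LinearMap.toContinuousLinearMap μ, fun j => ?_⟩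
    rw [← h2, ← hμ]
    simp [piMap]
  · rintro ⟨μ, hμ⟩
    refine ⟨(μ : V →ₗ[ℝ] ℝ), ?_⟩
    refine (Pi.basisFun ℝ (Fin d)).ext fun j => ?_
    rw [Pi.basisFun_apply, h2, ← hμ]
    simp [piMap]

theorem strongDual_ext_of_span (hX : Submodule.span ℝ (Set.range X) = ⊤)
    {μ ν : StrongDual ℝ V} (h : ∀ j, μ (X j) = ν (X j)) : μ = ν := by
  have : (μ : V →ₗ[ℝ] ℝ) = ν := LinearMap.ext_on_range hX h
  exact ContinuousLinearMap.coe_injective this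

/-- π^* is injective because the X j span V, so `Function.invFun` returns the true preimage and not
its default value. -/
theorem momentPhi_mk [FiniteDimensional ℝ V] (hX : Submodule.span ℝ (Set.range X) = ⊤)
    (z : zeroLevel X lam) {μ : StrongDual ℝ V} (hμ : ∀ j, μ (X j) = ‖z.1 j‖ ^ 2 + lam j) :
    momentPhi X lam Q (Quotient.mk _ z) = μ := by
  have hinj : Function.Injective (piStar X) := by
    intro α β h
    refine strongDual_ext_of_span hX fun j => ?_
    have := congrArg (fun f : Module.Dual ℝ (Fin d → ℝ) => f (Pi.single j 1)) h
    simpa [piStar, piMap] using this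
  have hJ : momentJ lam z.1 = piStar X μ := by
    refine (Pi.basisFun ℝ (Fin d)).ext fun j => ?_
    simp [piStar, piMap, hμ, momentJ, Pi.single_apply]
  change Function.invFun (piStar X) (momentJ lam z.1) = μ
  rw [hJ]
  exact Function.leftInverse_invFun hinj μ

variable (X lam Q) in
/-- The function on `M` that is induced by `z ↦ ‖z j‖`. -/
def orbitNorm (j : Fin d) : spaceM X lam Q → ℝ :=
  Quotient.lift (fun z => ‖z.1 j‖) (by
    intro z w h
    obtain ⟨x, -, hx⟩ := (mk_eq_mk_iff z w).1 (Quotient.sound h)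
    simp [← hx])

@[simp] theorem orbitNorm_mk (j : Fin d) (z : zeroLevel X lam) :
    orbitNorm X lam Q j (Quotient.mk _ z) = ‖z.1 j‖ := rfl

theorem continuous_orbitNorm (j : Fin d) : Continuous (orbitNorm X lam Q j) := by
  exact Continuous.quotient_lift ((continuous_apply j).comp continuous_subtype_val).norm _

/-- The saturation of an open set is a union of its preimages under the rotations in N, which
preserve the zero level. -/
theorem isOpenMap_mk : IsOpenMap (Quotient.mk (orbitSetoid X lam Q)) := by
  intro W hW
  rw [← isQuotientMap_quotient_mk'.isOpen_preimage]
  have : Quotient.mk (orbitSetoid X lam Q) ⁻¹' (Quotient.mk (orbitSetoid X lam Q) '' W) =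
      {z | ∃ x, piMap X x ∈ Q ∧ ∃ w ∈ W, ∀ j, phase (x j) * z.1 j = w.1 j} := by
    ext z
    simp only [Set.mem_preimage, Set.mem_image, Set.mem_ofPred_eq]
    constructor
    · rintro ⟨w, hw, h⟩
      obtain ⟨x, hx, hj⟩ := (mk_eq_mk_iff z w).1 h.symm
      exact ⟨x, hx, w, hw, hj⟩
    · rintro ⟨x, hx, w, hw, hj⟩
      exact ⟨w, hw, ((mk_eq_mk_iff z w).2 ⟨x, hx, hj⟩).symm⟩
  change IsOpen (Quotient.mk (orbitSetoid X lam Q) ⁻¹' _)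
  rw [this]
  obtain ⟨O, hO, rfl⟩ := isOpen_induced_iff.1 hW
  have : {z : zeroLevel X lam | ∃ x, piMap X x ∈ Q ∧ ∃ w ∈ Subtype.val ⁻¹' O,
      ∀ j, phase (x j) * z.1 j = (w : zeroLevel X lam).1 j} =
      ⋃ (x : Fin d → ℝ) (_ : piMap X x ∈ Q),
        (fun z : zeroLevel X lam => fun j => phase (x j) * z.1 j) ⁻¹' O := by
    ext z
    simp only [Set.mem_ofPred_eq, Set.mem_iUnion, Set.mem_preimage, exists_prop]
    refine exists_congr fun x => and_congr_right fun hx => ?_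
    constructor
    · rintro ⟨w, hw, h⟩
      rwa [funext h]
    · intro h
      refine ⟨⟨fun j => phase (x j) * z.1 j, ?_⟩, h, fun _ => rfl⟩
      have hz := z.2
      simp only [Set.mem_ofPred_eq, momentPsi, momentJ] at hz ⊢
      simpa using hz
  rw [this]
  refine isOpen_iUnion fun x => isOpen_iUnion fun _ => hO.preimage ?_
  exact continuous_pi fun j =>
    continuous_const.mul ((continuous_apply j).comp continuous_subtype_val)

variable (X lam Q) in
/-- The points of `M` whose coordinates with index in `I`, and only these, vanish. -/
def stratum (I : Finset (Fin d)) : Set (spaceM X lam Q) :=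
  {m | ∀ j, orbitNorm X lam Q j m = 0 ↔ j ∈ I}

theorem exists_mu [FiniteDimensional ℝ V] (z : zeroLevel X lam) :
    ∃ μ ∈ halfSpaceInter X lam, ∀ j, μ (X j) = ‖z.1 j‖ ^ 2 + lam j := by
  obtain ⟨μ, hμ⟩ := (mem_zeroLevel_iff z.1).1 z.2
  refine ⟨μ, Set.mem_iInter.2 fun j => ?_, hμ⟩
  rw [Set.mem_ofPred_eq, hμ]
  nlinarith [sq_nonneg ‖z.1 j‖]

theorem mem_openFace_iff_of_norm {z : Fin d → ℂ} {μ : StrongDual ℝ V}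
    (h : ∀ j, μ (X j) = ‖z j‖ ^ 2 + lam j) (I : Finset (Fin d)) :
    μ ∈ openFace X lam I ↔ ∀ j, ‖z j‖ = 0 ↔ j ∈ I := by
  have h1 : μ ∈ halfSpaceInter X lam := Set.mem_iInter.2 fun j => by
    rw [Set.mem_ofPred_eq, h]
    nlinarith [sq_nonneg ‖z j‖]
  have h2 : ∀ j, μ (X j) = lam j ↔ ‖z j‖ = 0 := fun j => by
    rw [h, add_eq_right, sq_eq_zero_iff]
  simp [openFace, h1, h2]

/-- The j-th inequality of the polytope is an equality at Φ(m) exactly when the coordinate z j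
vanishes. -/
theorem facePiece_eq_stratum [FiniteDimensional ℝ V]
    (hX : Submodule.span ℝ (Set.range X) = ⊤) (F : Face X lam) :
    facePiece X lam Q F = stratum X lam Q F.I := by
  ext m
  induction m using Quotient.inductionOn with | h z =>
  obtain ⟨μ, -, hμ⟩ := exists_mu z
  change momentPhi X lam Q _ ∈ openFace X lam F.I ↔ _
  rw [momentPhi_mk hX z hμ, mem_openFace_iff_of_norm hμ]
  rfl

theorem openFace_nonempty_of_mem_stratum [FiniteDimensional ℝ V] {I : Finset (Fin d)}
    {m : spaceM X lam Q} (h : m ∈ stratum X lam Q I) : (openFace X lam I).Nonempty := by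
  induction m using Quotient.inductionOn with | h z =>
  obtain ⟨μ, -, hμ⟩ := exists_mu z
  exact ⟨μ, (mem_openFace_iff_of_norm hμ I).2 h⟩

/-- Every point of `M` lies in the stratum of its own index set. -/
theorem exists_mem_stratum (m : spaceM X lam Q) : ∃ I, m ∈ stratum X lam Q I := by
  classical
  exact ⟨Finset.univ.filter fun j => orbitNorm X lam Q j m = 0, fun j => by simp⟩

/-- At fixed phases, the squared radii follow the segment from the functional of `m` to a point of
the open face for `I`. At every positive time exactly the coordinates in `I` vanish. -/
theorem mem_closure_stratum [FiniteDimensional ℝ V] {I : Finset (Fin d)}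
    (hI : (openFace X lam I).Nonempty) {m : spaceM X lam Q}
    (hm : ∀ j ∈ I, orbitNorm X lam Q j m = 0) : m ∈ closure (stratum X lam Q I) := by
  induction m using Quotient.inductionOn with | h z =>
  obtain ⟨μ, -, hμ⟩ := exists_mu z
  obtain ⟨μ', hμ'⟩ := hI
  let r : ℝ → Fin d → ℝ := fun t j => (1 - t) * ‖z.1 j‖ ^ 2 + t * (μ' (X j) - lam j)
  let u : Fin d → ℂ := fun j => phase (Complex.arg (z.1 j) / (2 * Real.pi))
  let p : ℝ → Fin d → ℂ := fun t j => (Real.sqrt (r t j) : ℂ) * u j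
  have hslack : ∀ j, 0 ≤ μ' (X j) - lam j := fun j =>
    sub_nonneg.2 (Set.mem_iInter.1 hμ'.1 j)
  have hnorm : ∀ t ∈ Set.Icc (0 : ℝ) 1, ∀ j, ‖p t j‖ ^ 2 = r t j := by
    intro t ht j
    have : 0 ≤ r t j := add_nonneg (mul_nonneg (by linarith [ht.2]) (sq_nonneg _))
      (mul_nonneg ht.1 (hslack j))
    simp [p, u, Real.sq_sqrt this, abs_of_nonneg (Real.sqrt_nonneg _)]
  have hp : ∀ t ∈ Set.Icc (0 : ℝ) 1, p t ∈ zeroLevel X lam := by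
    intro t ht
    refine (mem_zeroLevel_iff _).2 ⟨(1 - t) • μ + t • μ', fun j => ?_⟩
    rw [hnorm t ht]
    simp only [add_apply, smul_apply, hμ j, smul_eq_mul, r]
    ring
  have hp0 : p 0 = z.1 := by
    funext j
    simp only [p, r, u, sub_zero, one_mul, zero_mul, add_zero, Real.sqrt_sq (norm_nonneg _)]
    exact norm_mul_phase_arg _
  let g : Set.Icc (0 : ℝ) 1 → spaceM X lam Q := fun t => Quotient.mk _ ⟨p t, hp t t.2⟩
  have hg : Continuous g := by
    refine continuous_quotient_mk'.comp (Continuous.subtype_mk ?_ _)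
    refine continuous_pi fun j => ?_
    simp only [p, r]
    fun_prop
  have hg0 : g ⟨0, by simp⟩ = Quotient.mk _ z := by
    simp only [g]
    congr 1
    exact Subtype.ext hp0
  have hdense : (⟨0, by simp⟩ : Set.Icc (0 : ℝ) 1) ∈ closure {t : Set.Icc (0 : ℝ) 1 | 0 < t.1} := by
    rw [closure_subtype, mem_closure_iff_seq_limit]
    refine ⟨fun n => 1 / ((n : ℝ) + 1), fun n => ⟨⟨_, by positivity, ?_⟩, ?_, rfl⟩,
      tendsto_one_div_add_atTop_nhds_zero_nat⟩
    · rw [div_le_one (by positivity)]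
      linarith [(Nat.cast_nonneg n : (0 : ℝ) ≤ n)]
    · simp only [Set.mem_ofPred_eq]
      positivity
  rw [← hg0]
  refine map_mem_closure hg hdense fun t ht j => ?_
  simp only [g, orbitNorm_mk]
  rw [← sq_eq_zero_iff, hnorm t t.2]
  have ht0 : 0 < t.1 := ht
  constructor
  · intro h
    have h1 : 0 ≤ (1 - t.1) * ‖z.1 j‖ ^ 2 := mul_nonneg (by linarith [t.2.2]) (sq_nonneg _)
    have h2 : t.1 * (μ' (X j) - lam j) = 0 :=
      le_antisymm (by simp only [r] at h; linarith) (mul_nonneg ht0.le (hslack j))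
    refine (hμ'.2 j).1 ?_
    rcases mul_eq_zero.1 h2 with h3 | h3
    · exact absurd h3 ht0.ne'
    · linarith
  · intro hj
    have h1 := hm j hj
    rw [orbitNorm_mk] at h1
    simp [r, h1, (hμ'.2 j).2 hj]

theorem stratum_nonempty [FiniteDimensional ℝ V] {I : Finset (Fin d)}
    (hI : (openFace X lam I).Nonempty) : (stratum X lam Q I).Nonempty := by
  obtain ⟨μ, hμ⟩ := hI
  let z : Fin d → ℂ := fun j => (Real.sqrt (μ (X j) - lam j) : ℂ)
  have hz : ∀ j, μ (X j) = ‖z j‖ ^ 2 + lam j := fun j => by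
    have : 0 ≤ μ (X j) - lam j := sub_nonneg.2 (Set.mem_iInter.1 hμ.1 j)
    simp [z, abs_of_nonneg (Real.sqrt_nonneg _), Real.sq_sqrt this]
  exact ⟨Quotient.mk _ ⟨z, (mem_zeroLevel_iff z).2 ⟨μ, hz⟩⟩, (mem_openFace_iff_of_norm hz I).1 hμ⟩

theorem orbitNorm_eq_zero_of_mem_closure {I : Finset (Fin d)} {m : spaceM X lam Q}
    (hm : m ∈ closure (stratum X lam Q I)) {j : Fin d} (hj : j ∈ I) :
    orbitNorm X lam Q j m = 0 :=
  closure_minimal (s := stratum X lam Q I) (t := {m | orbitNorm X lam Q j m = 0})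
    (fun _ h => (h j).2 hj) (isClosed_eq (continuous_orbitNorm j) continuous_const) hm

theorem isLocallyClosed_stratum (I : Finset (Fin d)) : IsLocallyClosed (stratum X lam Q I) := by
  refine ⟨⋂ j ∈ Iᶜ, {m | orbitNorm X lam Q j m ≠ 0}, ⋂ j ∈ I, {m | orbitNorm X lam Q j m = 0},
    ?_, ?_, ?_⟩
  · exact isOpen_biInter_finset fun j _ => isOpen_ne_fun (continuous_orbitNorm j) continuous_const
  · exact isClosed_biInter fun j _ => isClosed_eq (continuous_orbitNorm j) continuous_const
  · ext m
    simp only [stratum, Set.mem_ofPred_eq, Set.mem_inter_iff, Set.mem_iInter, Finset.mem_compl]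
    exact ⟨fun h => ⟨fun j hj => fun h0 => hj ((h j).1 h0), fun j hj => (h j).2 hj⟩,
      fun h j => ⟨fun h0 => by_contra fun hj => h.1 j hj h0, h.2 j⟩⟩

theorem compactSpace_spaceM [FiniteDimensional ℝ V]
    (hb : Bornology.IsBounded (halfSpaceInter X lam)) : CompactSpace (spaceM X lam Q) := by
  have hcl : IsClosed (zeroLevel X lam) := by
    have : zeroLevel X lam = ⋂ y : lieN X, {z | momentPsi X lam z y = 0} := by
      ext z
      simp [LinearMap.ext_iff]
    rw [this]
    refine isClosed_iInter fun y => isClosed_eq ?_ continuous_const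
    simp only [momentPsi, LinearMap.dualMap_apply, momentJ, LinearMap.sum_apply,
      LinearMap.smul_apply]
    fun_prop
  have hbd : Bornology.IsBounded (zeroLevel X lam) := by
    obtain ⟨C, hC⟩ := hb.exists_norm_le
    refine (isBounded_iff_forall_norm_le).2 ⟨∑ j, (C * ‖X j‖ + |lam j| + 1), fun z hz => ?_⟩
    obtain ⟨μ, hμ, hz'⟩ := exists_mu ⟨z, hz⟩
    have hC0 : 0 ≤ C := (norm_nonneg _).trans (hC μ hμ)
    have hnn : ∀ j, 0 ≤ C * ‖X j‖ + |lam j| + 1 := fun j => by positivity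
    refine (pi_norm_le_iff_of_nonneg (Finset.sum_nonneg fun j _ => hnn j)).2 fun j => ?_
    refine le_trans ?_ (Finset.single_le_sum (fun j _ => hnn j) (Finset.mem_univ j))
    have h1 : μ (X j) ≤ C * ‖X j‖ := (le_abs_self _).trans
      ((μ.le_opNorm (X j)).trans (mul_le_mul_of_nonneg_right (hC μ hμ) (norm_nonneg _)))
    have h2 := hz' j
    have h3 := neg_abs_le (lam j)
    simp only at h2
    -- The radius is bounded through its square: ‖z j‖ ≤ (‖z j‖² + 1) / 2.
    nlinarith [sq_nonneg (‖z j‖ - 1)]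
  have : CompactSpace (zeroLevel X lam) :=
    isCompact_iff_compactSpace.1 (Metric.isCompact_of_isClosed_isBounded hcl hbd)
  exact Quotient.compactSpace

end Quotient

/-! ### Frames and the models in ℂ^A -/

/-- Extension by zero of a family indexed by a finite set. -/
def zeroExtend {d : ℕ} {A : Finset (Fin d)} (w : A → ℂ) (j : Fin d) : ℂ :=
  if h : j ∈ A then w ⟨j, h⟩ else 0

section ZeroExtend

variable {d : ℕ} {A : Finset (Fin d)}

theorem zeroExtend_of_mem (w : A → ℂ) {j : Fin d} (h : j ∈ A) : zeroExtend w j = w ⟨j, h⟩ :=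
  dif_pos h

@[simp] theorem zeroExtend_coe (w : A → ℂ) (a : A) : zeroExtend w a = w a := dif_pos a.2

theorem zeroExtend_of_notMem (w : A → ℂ) {j : Fin d} (h : j ∉ A) : zeroExtend w j = 0 :=
  dif_neg h

theorem contDiff_zeroExtend (j : Fin d) : ContDiff ℝ ∞ fun w : A → ℂ => zeroExtend w j := by
  by_cases h : j ∈ A
  · simp only [zeroExtend_of_mem _ h]
    fun_prop
  · simp only [zeroExtend_of_notMem _ h]
    fun_prop

end ZeroExtend

/-- A frame modulo the span of the `X k`, `k ∈ K`: the `X a`, `a ∈ A`, are a basis modulo this span,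
and `κ` is the coordinate map. -/
structure Frame {V : Type*} [NormedAddCommGroup V] [NormedSpace ℝ V] {d : ℕ} (X : Fin d → V)
    (K : Finset (Fin d)) where
  A : Finset (Fin d)
  κ : V →ₗ[ℝ] (Fin d → ℝ)
  κ_of_mem : ∀ a ∈ A, κ (X a) = Pi.single a 1
  κ_of_mem_K : ∀ k ∈ K, κ (X k) = 0
  κ_of_notMem : ∀ v, ∀ j ∉ A, κ v j = 0
  -- This is the spanning half of being a basis modulo the span; `κ_of_mem` contains the
  -- independence.
  κ_lift : ∀ v, v - piMap X (κ v) ∈ Submodule.span ℝ (X '' (K : Set (Fin d)))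

namespace Frame

variable {V : Type*} [NormedAddCommGroup V] [NormedSpace ℝ V] {d : ℕ} {X : Fin d → V}
  {K : Finset (Fin d)}

section Linear

variable (φ φ' : Frame X K)

theorem notMem_K {a : Fin d} (ha : a ∈ φ.A) : a ∉ K := by
  intro h
  have := congrFun ((φ.κ_of_mem a ha).symm.trans (φ.κ_of_mem_K a h)) a
  simp at this

theorem κ_of_mem_span {v : V} (hv : v ∈ Submodule.span ℝ (X '' (K : Set (Fin d)))) :
    φ.κ v = 0 := by
  have : Submodule.span ℝ (X '' (K : Set (Fin d))) ≤ LinearMap.ker φ.κ := by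
    rw [Submodule.span_le]
    rintro _ ⟨k, hk, rfl⟩
    exact φ.κ_of_mem_K k hk
  exact this hv

theorem κ_piMap_κ (v : V) : φ.κ (piMap X (φ'.κ v)) = φ.κ v := by
  have := φ.κ_of_mem_span (φ'.κ_lift v)
  rw [map_sub, sub_eq_zero] at this
  exact this.symm

/-- The X k, k ∈ K, are invisible to κ, so a vector supported on A ∪ K can be read off on A. -/
theorem κ_piMap_of_support {y : Fin d → ℝ} (hy : ∀ j ∉ φ.A, j ∉ K → y j = 0) {a : Fin d}
    (ha : a ∈ φ.A) : φ.κ (piMap X y) a = y a := by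
  rw [piMap_apply, map_sum, Finset.sum_apply, Finset.sum_eq_single a]
  · simp [φ.κ_of_mem a ha]
  · intro j _ hj
    rw [map_smul, Pi.smul_apply, smul_eq_mul]
    by_cases h1 : j ∈ φ.A
    · simp [φ.κ_of_mem j h1, hj.symm]
    · by_cases h2 : j ∈ K
      · simp [φ.κ_of_mem_K j h2]
      · simp [hy j h1 h2]
  · simp

end Linear

section Domain

variable (φ : Frame X K) (I : Finset (Fin d)) (ν : StrongDual ℝ V) (lam : Fin d → ℝ)

/-- The squared radii of the points of the model. -/
def radial (w : φ.A → ℂ) (j : Fin d) : ℝ :=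
  if j ∈ I then ‖zeroExtend w j‖ ^ 2 else (zeroExtend w j).re

/-- The angles of the points of the model. -/
def angle (w : φ.A → ℂ) (j : Fin d) : ℝ := if j ∈ I then 0 else (zeroExtend w j).im

/-- The point of the dual space that belongs to a point of the model. -/
def mu [FiniteDimensional ℝ V] (w : φ.A → ℂ) : StrongDual ℝ V :=
  -- Since κ vanishes off A, only j ∈ A contribute. The correction gives X a the value `radial +
  -- lam` for a ∈ A and leaves the values of ν on the X k unchanged.
  ν + ∑ j, (φ.radial I w j + lam j - ν (X j)) •
    LinearMap.toContinuousLinearMap (LinearMap.proj j ∘ₗ φ.κ)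

/-- The slack of the inequalities of the polytope. -/
def slack [FiniteDimensional ℝ V] (w : φ.A → ℂ) (j : Fin d) : ℝ :=
  φ.mu I ν lam w (X j) - lam j

/-- The domain of the model. -/
def domain [FiniteDimensional ℝ V] : Set (φ.A → ℂ) :=
  {w | ∀ j ∉ I, j ∉ K → 0 < φ.slack I ν lam w j}

/-- The lift of the chart map to `ℂᵈ`. -/
def lift [FiniteDimensional ℝ V] (w : φ.A → ℂ) (j : Fin d) : ℂ :=
  if j ∈ I then zeroExtend w j else Real.sqrt (φ.slack I ν lam w j) * phase (φ.angle I w j)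

/-- Coordinates in the model of a point of `ℂᵈ` whose coordinates have the arguments `2 π α`. -/
def coords (α : Fin d → ℝ) (z : Fin d → ℂ) (a : φ.A) : ℂ :=
  -- Rotating z by the phases of κ(πα) - α, a vector that κ ∘ π annihilates, turns the phases
  -- outside A into 1. These are the coordinates of the rotated point.
  if (a : Fin d) ∈ I then phase (φ.κ (piMap X α) a - α a) * z a
  else (‖z a‖ ^ 2 : ℝ) + (φ.κ (piMap X α) a : ℝ) * Complex.I

/-- The action of `ℝᵈ` on the model, by rotations and translations. -/
def rot (x : Fin d → ℝ) (w : φ.A → ℂ) (a : φ.A) : ℂ :=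
  if (a : Fin d) ∈ I then phase (x a) * w a else w a + (x a : ℝ) * Complex.I

variable {φ I ν lam} {Q : AddSubgroup V}

theorem eq_of_eq_on_frame {μ ρ : StrongDual ℝ V} (hA : ∀ a ∈ φ.A, μ (X a) = ρ (X a))
    (hK : ∀ k ∈ K, μ (X k) = ρ (X k)) : μ = ρ := by
  have h1 : ∀ v ∈ Submodule.span ℝ (X '' (K : Set (Fin d))), μ v = ρ v := by
    intro v hv
    have : Submodule.span ℝ (X '' (K : Set (Fin d))) ≤
        LinearMap.eqLocus (μ : V →ₗ[ℝ] ℝ) (ρ : V →ₗ[ℝ] ℝ) := by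
      rw [Submodule.span_le]
      rintro _ ⟨k, hk, rfl⟩
      exact hK k hk
    exact this hv
  ext v
  have h2 := h1 _ (φ.κ_lift v)
  have h3 : μ (piMap X (φ.κ v)) = ρ (piMap X (φ.κ v)) := by
    rw [piMap_apply, map_sum, map_sum]
    refine Finset.sum_congr rfl fun j _ => ?_
    by_cases hj : j ∈ φ.A
    · simp [hA j hj]
    · simp [φ.κ_of_notMem v j hj]
  simp only [map_sub] at h2
  linarith

theorem radial_coords (α : Fin d → ℝ) (z : Fin d → ℂ) {a : Fin d}
    (ha : a ∈ φ.A) : φ.radial I (φ.coords I α z) a = ‖z a‖ ^ 2 := by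
  rw [radial, zeroExtend_of_mem _ ha, coords]
  split_ifs with h
  · simp
  · simp [-Complex.ofReal_pow]

theorem angle_coords {j : Fin d} (hj : j ∉ I) (α : Fin d → ℝ) (z : Fin d → ℂ) :
    φ.angle I (φ.coords I α z) j = φ.κ (piMap X α) j := by
  rw [angle, if_neg hj]
  by_cases hA : j ∈ φ.A
  · rw [zeroExtend_of_mem _ hA, coords, if_neg hj]
    simp [-Complex.ofReal_pow]
  · rw [zeroExtend_of_notMem _ hA, φ.κ_of_notMem _ j hA]
    simp

theorem zeroExtend_rot {x : Fin d → ℝ} (hx : ∀ j ∉ φ.A, x j = 0) (w : φ.A → ℂ) (j : Fin d) :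
    zeroExtend (φ.rot I x w) j =
      if j ∈ I then phase (x j) * zeroExtend w j else zeroExtend w j + (x j : ℝ) * Complex.I := by
  by_cases h : j ∈ φ.A
  · rw [zeroExtend_of_mem _ h, zeroExtend_of_mem _ h, rot]
  · simp [zeroExtend_of_notMem _ h, hx j h]

theorem radial_rot (x : Fin d → ℝ) (w : φ.A → ℂ) : φ.radial I (φ.rot I x w) = φ.radial I w := by
  funext j
  by_cases h : j ∈ φ.A
  · rw [radial, radial, zeroExtend_of_mem _ h, zeroExtend_of_mem _ h, rot]
    split_ifs <;> simp
  · rw [radial, radial, zeroExtend_of_notMem _ h, zeroExtend_of_notMem _ h]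

theorem rot_zero (w : φ.A → ℂ) : φ.rot I 0 w = w := by
  funext a
  simp [rot]

theorem rot_add (x y : Fin d → ℝ) (w : φ.A → ℂ) :
    φ.rot I (x + y) w = φ.rot I x (φ.rot I y w) := by
  funext a
  simp only [rot, Pi.add_apply, phase_add]
  split_ifs
  · ring
  · push_cast
    ring

theorem angle_rot {x : Fin d → ℝ} (hx : ∀ j ∉ φ.A, x j = 0) (w : φ.A → ℂ) {j : Fin d}
    (hj : j ∉ I) : φ.angle I (φ.rot I x w) j = φ.angle I w j + x j := by
  rw [angle, angle, if_neg hj, if_neg hj, zeroExtend_rot hx, if_neg hj]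
  simp

/-- Phases at the coordinates in K do not matter, since these coordinates vanish. As κ loses only
the span of the X k, `x` can be changed on K until its image under π lies in Q itself. -/
theorem mk_eq_mk_of_phase {z z' : zeroLevel X lam} (hK : ∀ k ∈ K, z.1 k = 0)
    (hK' : ∀ k ∈ K, z'.1 k = 0) {x : Fin d → ℝ}
    (hx : φ.κ (piMap X x) ∈ Q.map (φ.κ : V →+ (Fin d → ℝ)))
    (h : ∀ j ∉ K, phase (x j) * z.1 j = z'.1 j) :
    Quotient.mk (orbitSetoid X lam Q) z = Quotient.mk (orbitSetoid X lam Q) z' := by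
  obtain ⟨v, hv, hvx⟩ := hx
  have h1 : piMap X x - v ∈ Submodule.span ℝ (X '' (K : Set (Fin d))) := by
    have h2 := φ.κ_lift (piMap X x)
    have h3 := φ.κ_lift v
    have h4 : φ.κ v = φ.κ (piMap X x) := hvx
    rw [← h4] at h2
    have := Submodule.sub_mem _ h2 h3
    simpa using this
  obtain ⟨c, hc⟩ := Submodule.mem_span_image_finset_iff_exists_fun' ℝ |>.1 h1
  refine (mk_eq_mk_iff z z').2 ⟨fun j => if j ∈ K then x j - c j else x j, ?_, fun j => ?_⟩
  · have h5 : piMap X (fun j => if j ∈ K then x j - c j else x j) = v := by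
      have h6 : piMap X (fun j => if j ∈ K then x j - c j else x j) =
          piMap X x - ∑ j ∈ K, c j • X j := by
        rw [piMap_apply, piMap_apply, ← Finset.univ_inter K, ← Finset.sum_ite_mem,
          ← Finset.sum_sub_distrib]
        refine Finset.sum_congr rfl fun j _ => ?_
        simp only [Finset.mem_inter, Finset.mem_univ, true_and]
        split_ifs <;> simp [sub_smul]
      rw [h6, hc, sub_sub_cancel]
    rwa [h5]
  · by_cases hj : j ∈ K
    · rw [hK j hj, hK' j hj, mul_zero]
    · simpa only [if_neg hj] using h j hj

variable [FiniteDimensional ℝ V]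

theorem mu_apply (w : φ.A → ℂ) (v : V) :
    φ.mu I ν lam w v = ν v + ∑ j, (φ.radial I w j + lam j - ν (X j)) * φ.κ v j := by
  simp [mu]

theorem slack_of_mem {w : φ.A → ℂ} {a : Fin d} (ha : a ∈ φ.A) :
    φ.slack I ν lam w a = φ.radial I w a := by
  rw [slack, mu_apply, φ.κ_of_mem a ha]
  simp [Pi.single_apply]

theorem slack_of_mem_K (hν : ∀ k ∈ K, ν (X k) = lam k) {w : φ.A → ℂ} {k : Fin d} (hk : k ∈ K) :
    φ.slack I ν lam w k = 0 := by
  rw [slack, mu_apply, φ.κ_of_mem_K k hk]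
  simp [hν k hk]

theorem mu_eq (hν : ∀ k ∈ K, ν (X k) = lam k) {w : φ.A → ℂ} {μ : StrongDual ℝ V}
    (hA : ∀ a ∈ φ.A, φ.radial I w a = μ (X a) - lam a) (hK : ∀ k ∈ K, μ (X k) = lam k) :
    φ.mu I ν lam w = μ := by
  refine φ.eq_of_eq_on_frame (fun a ha => ?_) fun k hk => ?_
  · have := slack_of_mem (I := I) (ν := ν) (lam := lam) (w := w) ha
    rw [slack, hA a ha] at this
    linarith
  · have := slack_of_mem_K (φ := φ) (I := I) hν (w := w) hk
    rw [slack] at this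
    rw [hK k hk]
    linarith

theorem slack_nonneg (hI : I ⊆ φ.A) (hν : ∀ k ∈ K, ν (X k) = lam k) {w : φ.A → ℂ}
    (hw : w ∈ φ.domain I ν lam) (j : Fin d) : 0 ≤ φ.slack I ν lam w j := by
  by_cases h1 : j ∈ I
  · rw [slack_of_mem (hI h1), radial, if_pos h1]
    positivity
  · by_cases h2 : j ∈ K
    · rw [slack_of_mem_K hν h2]
    · exact (hw j h1 h2).le

theorem norm_lift_sq (hI : I ⊆ φ.A) (hν : ∀ k ∈ K, ν (X k) = lam k) {w : φ.A → ℂ}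
    (hw : w ∈ φ.domain I ν lam) (j : Fin d) :
    ‖φ.lift I ν lam w j‖ ^ 2 = φ.slack I ν lam w j := by
  by_cases h1 : j ∈ I
  · rw [slack_of_mem (hI h1), radial, if_pos h1, lift, if_pos h1]
  · rw [lift, if_neg h1, norm_mul, norm_phase, mul_one, Complex.norm_real, Real.norm_eq_abs,
      sq_abs, Real.sq_sqrt (slack_nonneg hI hν hw j)]

theorem mu_X_eq (hI : I ⊆ φ.A) (hν : ∀ k ∈ K, ν (X k) = lam k) {w : φ.A → ℂ}
    (hw : w ∈ φ.domain I ν lam) (j : Fin d) :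
    φ.mu I ν lam w (X j) = ‖φ.lift I ν lam w j‖ ^ 2 + lam j := by
  rw [norm_lift_sq hI hν hw, slack]
  ring

theorem lift_mem_zeroLevel (hI : I ⊆ φ.A) (hν : ∀ k ∈ K, ν (X k) = lam k) {w : φ.A → ℂ}
    (hw : w ∈ φ.domain I ν lam) : φ.lift I ν lam w ∈ zeroLevel X lam :=
  (mem_zeroLevel_iff _).2 ⟨_, mu_X_eq hI hν hw⟩

theorem lift_of_mem_K (hI : I ⊆ φ.A) (hν : ∀ k ∈ K, ν (X k) = lam k) (w : φ.A → ℂ)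
    {k : Fin d} (hk : k ∈ K) : φ.lift I ν lam w k = 0 := by
  rw [lift, if_neg fun h => φ.notMem_K (hI h) hk, slack_of_mem_K hν hk]
  simp

theorem lift_ne_zero {w : φ.A → ℂ} (hw : w ∈ φ.domain I ν lam) {j : Fin d} (h1 : j ∉ I)
    (h2 : j ∉ K) : φ.lift I ν lam w j ≠ 0 := by
  rw [lift, if_neg h1]
  refine mul_ne_zero ?_ (phase_ne_zero _)
  exact_mod_cast (Real.sqrt_pos.2 (hw j h1 h2)).ne'

theorem lift_of_mem {w : φ.A → ℂ} {j : Fin d} (h : j ∈ I) :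
    φ.lift I ν lam w j = zeroExtend w j := if_pos h

/-- The defining property of the angles of the model. -/
theorem lift_eq_norm_mul_phase (w : φ.A → ℂ) {j : Fin d} (h : j ∉ I) :
    φ.lift I ν lam w j = ‖φ.lift I ν lam w j‖ * phase (φ.angle I w j) := by
  rw [lift, if_neg h, norm_mul, norm_phase, mul_one, Complex.norm_real, Real.norm_eq_abs,
    abs_of_nonneg (Real.sqrt_nonneg _)]

/-! ### Coordinates -/

theorem mu_coords (hν : ∀ k ∈ K, ν (X k) = lam k) (α : Fin d → ℝ) {z : Fin d → ℂ}
    (hK : ∀ k ∈ K, z k = 0) {μ : StrongDual ℝ V} (hμ : ∀ j, μ (X j) = ‖z j‖ ^ 2 + lam j) :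
    φ.mu I ν lam (φ.coords I α z) = μ := by
  refine mu_eq hν (fun a ha => ?_) fun k hk => ?_
  · rw [radial_coords α z ha, hμ]
    ring
  · simp [hμ, hK k hk]

theorem slack_coords (hν : ∀ k ∈ K, ν (X k) = lam k) (α : Fin d → ℝ)
    {z : Fin d → ℂ} (hz : z ∈ zeroLevel X lam) (hK : ∀ k ∈ K, z k = 0) (j : Fin d) :
    φ.slack I ν lam (φ.coords I α z) j = ‖z j‖ ^ 2 := by
  obtain ⟨μ, hμ⟩ := (mem_zeroLevel_iff z).1 hz
  rw [slack, mu_coords hν α hK hμ, hμ]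
  ring

theorem coords_mem_domain (hν : ∀ k ∈ K, ν (X k) = lam k) (α : Fin d → ℝ)
    {z : Fin d → ℂ} (hz : z ∈ zeroLevel X lam) (hK : ∀ k ∈ K, z k = 0)
    (hne : ∀ j ∉ I, j ∉ K → z j ≠ 0) : φ.coords I α z ∈ φ.domain I ν lam := by
  intro j h1 h2
  rw [slack_coords hν α hz hK]
  have := norm_pos_iff.2 (hne j h1 h2)
  positivity

theorem lift_coords (hI : I ⊆ φ.A) (hν : ∀ k ∈ K, ν (X k) = lam k) {α : Fin d → ℝ}
    {z : Fin d → ℂ} (hz : z ∈ zeroLevel X lam) (hK : ∀ k ∈ K, z k = 0)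
    (hα : ∀ j ∉ I, j ∉ K → z j = ‖z j‖ * phase (α j)) (j : Fin d) :
    φ.lift I ν lam (φ.coords I α z) j = phase (φ.κ (piMap X α) j - α j) * z j := by
  by_cases h1 : j ∈ I
  · rw [lift_of_mem h1, zeroExtend_of_mem _ (hI h1), coords, if_pos h1]
  · rw [lift, if_neg h1, slack_coords hν α hz hK, angle_coords h1, Real.sqrt_sq (norm_nonneg _)]
    by_cases h2 : j ∈ K
    · simp [hK j h2]
    · conv_rhs => rw [hα j h1 h2]
      rw [mul_left_comm, ← phase_add, sub_add_cancel]

/-! ### Equivalence of points -/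

/-- Any choice α of arguments gives a representative in the model, since the rotation by κ(πα) - α
is trivial under κ ∘ π (`κ_piMap_κ`). -/
theorem mk_lift_coords (hI : I ⊆ φ.A) (hν : ∀ k ∈ K, ν (X k) = lam k) {α : Fin d → ℝ}
    (z : zeroLevel X lam) (hK : ∀ k ∈ K, z.1 k = 0)
    (hne : ∀ j ∉ I, j ∉ K → z.1 j ≠ 0) (hα : ∀ j ∉ I, j ∉ K → z.1 j = ‖z.1 j‖ * phase (α j)) :
    Quotient.mk (orbitSetoid X lam Q) ⟨_, lift_mem_zeroLevel hI hν
      (coords_mem_domain hν α z.2 hK hne)⟩ = Quotient.mk (orbitSetoid X lam Q) z := by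
  symm
  refine mk_eq_mk_of_phase (φ := φ) (x := fun j => φ.κ (piMap X α) j - α j) hK
    (fun k hk => lift_of_mem_K hI hν _ hk) ?_ fun j _ => ?_
  · have : (fun j => φ.κ (piMap X α) j - α j) = φ.κ (piMap X α) - α := rfl
    rw [this, map_sub, map_sub, κ_piMap_κ, sub_self]
    exact zero_mem _
  · exact (lift_coords hI hν z.2 hK hα j).symm

/-! ### The action on the model -/

theorem slack_rot (x : Fin d → ℝ) (w : φ.A → ℂ) :
    φ.slack I ν lam (φ.rot I x w) = φ.slack I ν lam w := by
  funext j
  rw [slack, slack, mu, mu, radial_rot]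

theorem rot_mem_domain (x : Fin d → ℝ) {w : φ.A → ℂ} (hw : w ∈ φ.domain I ν lam) :
    φ.rot I x w ∈ φ.domain I ν lam := by
  intro j h1 h2
  rw [slack_rot]
  exact hw j h1 h2

theorem lift_rot {x : Fin d → ℝ} (hx : ∀ j ∉ φ.A, x j = 0) (w : φ.A → ℂ) (j : Fin d) :
    φ.lift I ν lam (φ.rot I x w) j = phase (x j) * φ.lift I ν lam w j := by
  by_cases hj : j ∈ I
  · rw [lift_of_mem hj, lift_of_mem hj, zeroExtend_rot hx, if_pos hj]
  · rw [lift, lift, if_neg hj, if_neg hj, slack_rot, angle_rot hx w hj, phase_add]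
    ring

variable (φ I ν lam) in
/-- The action of `ℝᵈ` on the domain of the model. -/
def rotHom : Multiplicative (Fin d → ℝ) →* Equiv.Perm (φ.domain I ν lam) where
  toFun x :=
    { toFun := fun w => ⟨φ.rot I x.toAdd w, rot_mem_domain _ w.2⟩
      invFun := fun w => ⟨φ.rot I (-x.toAdd) w, rot_mem_domain _ w.2⟩
      left_inv := fun w => Subtype.ext <| by simp [← rot_add, rot_zero]
      right_inv := fun w => Subtype.ext <| by simp [← rot_add, rot_zero] }
  map_one' := Equiv.ext fun w => Subtype.ext (rot_zero _)
  map_mul' x y := Equiv.ext fun w => Subtype.ext (rot_add _ _ _)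

variable (φ I ν lam Q) in
/-- The group of a model. -/
def modelGroup : Subgroup (Equiv.Perm (φ.domain I ν lam)) :=
  -- Taking the image among the permutations makes the action faithful, which freeness on a dense
  -- set requires.
  (AddSubgroup.toSubgroup (Q.map (φ.κ : V →+ (Fin d → ℝ)))).map (φ.rotHom I ν lam)

theorem mem_modelGroup {h : Equiv.Perm (φ.domain I ν lam)} :
    h ∈ φ.modelGroup I ν lam Q ↔
      ∃ v ∈ Q, φ.rotHom I ν lam (Multiplicative.ofAdd (φ.κ v)) = h := by
  constructor
  · rintro ⟨x, ⟨v, hv, hx⟩, rfl⟩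
    exact ⟨v, hv, congrArg (φ.rotHom I ν lam) hx⟩
  · rintro ⟨v, hv, rfl⟩
    exact ⟨Multiplicative.ofAdd (φ.κ v), ⟨v, hv, rfl⟩, rfl⟩

theorem rotHom_apply (x : Fin d → ℝ) (w : φ.domain I ν lam) :
    (φ.rotHom I ν lam (Multiplicative.ofAdd x) w : φ.A → ℂ) = φ.rot I x w := rfl

/-- Suppose x, with πx in Q, carries one lift to the other. Off I ∪ K it equals the difference of
the model angles up to integers. Subtracting integers keeps πx in Q because X j ∈ Q, and leaves a
vector y supported on A ∪ K. So κ(πy) agrees with y on A, and it is the group element sought. -/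
theorem mk_lift_eq_iff (hXQ : ∀ j, X j ∈ Q) (hI : I ⊆ φ.A) (hν : ∀ k ∈ K, ν (X k) = lam k)
    (w w' : φ.domain I ν lam) :
    Quotient.mk (orbitSetoid X lam Q) ⟨_, lift_mem_zeroLevel hI hν w.2⟩ =
      Quotient.mk (orbitSetoid X lam Q) ⟨_, lift_mem_zeroLevel hI hν w'.2⟩ ↔
      ∃ h ∈ φ.modelGroup I ν lam Q, h w = w' := by
  constructor
  · intro h
    obtain ⟨x, hxQ, hx⟩ := (mk_eq_mk_iff _ _).1 h
    simp only at hx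
    have hslack : ∀ j, φ.slack I ν lam w j = φ.slack I ν lam w' j := by
      intro j
      rw [← norm_lift_sq hI hν w.2, ← norm_lift_sq hI hν w'.2, ← hx j, norm_mul, norm_phase,
        one_mul]
    have hm : ∀ j, ∃ m : ℤ, j ∉ I → j ∉ K →
        x j + φ.angle I w j - φ.angle I w' j = m := by
      intro j
      by_cases h1 : j ∈ I
      · exact ⟨0, fun h => absurd h1 h⟩
      by_cases h2 : j ∈ K
      · exact ⟨0, fun _ h => absurd h2 h⟩
      have h3 := hx j
      have h4 := lift_ne_zero w.2 h1 h2
      rw [lift_eq_norm_mul_phase (w : φ.A → ℂ) h1, lift_eq_norm_mul_phase (w' : φ.A → ℂ) h1,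
        ← hx j, norm_mul, norm_phase, one_mul, mul_left_comm, ← phase_add] at h3
      have h5 := mul_left_cancel₀ (by simpa using h4) h3
      obtain ⟨m, hm⟩ := (phase_eq_iff _ _).1 h5
      exact ⟨m, fun _ _ => by linarith⟩
    choose m hm using hm
    let y : Fin d → ℝ := fun j => if j ∈ I then x j else x j - m j
    have hyI : ∀ j ∈ I, y j = x j := fun j hj => if_pos hj
    have hy' : ∀ j ∉ I, j ∉ K → y j = φ.angle I w' j - φ.angle I w j := by
      intro j h1 h2
      have := hm j h1 h2
      simp only [y, if_neg h1]
      linarith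
    have hyQ : piMap X y ∈ Q := by
      have h1 : piMap X y = piMap X x - ∑ j, (if j ∈ I then 0 else m j) • X j := by
        rw [piMap_apply, piMap_apply, ← Finset.sum_sub_distrib]
        refine Finset.sum_congr rfl fun j _ => ?_
        simp only [y]
        split_ifs
        · simp
        · rw [sub_smul, Int.cast_smul_eq_zsmul]
      rw [h1]
      exact Q.sub_mem hxQ (Q.sum_mem fun j _ => Q.zsmul_mem (hXQ j) _)
    have hκ : ∀ a ∈ φ.A, φ.κ (piMap X y) a = y a := fun a ha => by
      refine φ.κ_piMap_of_support (fun j h1 h2 => ?_) ha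
      rw [hy' j (fun h => h1 (hI h)) h2]
      simp [angle, zeroExtend_of_notMem _ h1]
    refine ⟨_, mem_modelGroup.2 ⟨_, hyQ, rfl⟩, Subtype.ext (funext fun a => ?_)⟩
    rw [rotHom_apply, rot, hκ a a.2]
    have ha := hslack a
    rw [slack_of_mem a.2, slack_of_mem a.2, radial, radial, zeroExtend_coe, zeroExtend_coe] at ha
    split_ifs with h1
    · have := hx a
      rw [lift_of_mem h1, lift_of_mem h1, zeroExtend_coe, zeroExtend_coe] at this
      rw [hyI a h1, this]
    · rw [if_neg h1, if_neg h1] at ha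
      rw [hy' a h1 (φ.notMem_K a.2), angle, angle, if_neg h1, if_neg h1, zeroExtend_coe,
        zeroExtend_coe]
      apply Complex.ext <;> simp [ha]
  · rintro ⟨h, hh, rfl⟩
    obtain ⟨v, hv, rfl⟩ := mem_modelGroup.1 hh
    refine mk_eq_mk_of_phase (φ := φ) (x := φ.κ v) (fun k hk => lift_of_mem_K hI hν _ hk)
      (fun k hk => lift_of_mem_K hI hν _ hk) ⟨v, hv, ?_⟩ fun j _ => ?_
    · exact (κ_piMap_κ φ φ v).symm
    · exact (lift_rot (φ.κ_of_notMem v) _ j).symm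

end Domain

end Frame

/-! ### Smoothness, contractibility and change of frame -/

namespace Frame

variable {V : Type*} [NormedAddCommGroup V] [NormedSpace ℝ V] {d : ℕ}
  {X : Fin d → V} {K : Finset (Fin d)}

section Smooth

variable {φ φ' : Frame X K} {I I' : Finset (Fin d)} {ν : StrongDual ℝ V} {lam : Fin d → ℝ}

theorem contDiff_radial (j : Fin d) : ContDiff ℝ ∞ fun w => φ.radial I w j := by
  unfold radial
  by_cases h : j ∈ I
  · simp only [if_pos h]
    exact (contDiff_zeroExtend j).norm_sq ℝ
  · simp only [if_neg h]
    exact Complex.reCLM.contDiff.comp (contDiff_zeroExtend j)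

theorem contDiff_angle (j : Fin d) : ContDiff ℝ ∞ fun w => φ.angle I w j := by
  unfold angle
  by_cases h : j ∈ I
  · simp only [if_pos h]
    exact contDiff_const
  · simp only [if_neg h]
    exact Complex.imCLM.contDiff.comp (contDiff_zeroExtend j)

theorem contDiff_rot (x : Fin d → ℝ) : ContDiff ℝ ∞ (φ.rot I x) := by
  rw [contDiff_pi]
  intro a
  unfold rot
  split_ifs <;> fun_prop

theorem contDiff_κ_piMap (j : Fin d) : ContDiff ℝ ∞ fun α => φ.κ (piMap X α) j :=
  (LinearMap.toContinuousLinearMap (LinearMap.proj j ∘ₗ φ.κ ∘ₗ piMap X)).contDiff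

variable [FiniteDimensional ℝ V]

theorem contDiff_slack (j : Fin d) : ContDiff ℝ ∞ fun w => φ.slack I ν lam w j := by
  unfold slack
  simp only [mu_apply]
  refine (contDiff_const.add (ContDiff.sum fun i _ => ?_)).sub contDiff_const
  exact (((contDiff_radial i).add contDiff_const).sub contDiff_const).mul contDiff_const

theorem isOpen_domain : IsOpen (φ.domain I ν lam) := by
  have : φ.domain I ν lam =
      ⋂ j ∈ (Finset.univ.filter fun j => j ∉ I ∧ j ∉ K), {w | 0 < φ.slack I ν lam w j} := by
    ext w
    simp [domain]
  rw [this]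
  exact isOpen_biInter_finset fun j _ => isOpen_lt continuous_const (contDiff_slack j).continuous

theorem contDiffAt_lift (hI : I ⊆ φ.A) (hν : ∀ k ∈ K, ν (X k) = lam k) {w : φ.A → ℂ}
    (hw : w ∈ φ.domain I ν lam) : ContDiffAt ℝ ∞ (φ.lift I ν lam) w := by
  rw [contDiffAt_pi]
  intro j
  by_cases h1 : j ∈ I
  · simp only [lift_of_mem h1]
    exact (contDiff_zeroExtend j).contDiffAt
  by_cases h2 : j ∈ K
  · simp only [lift_of_mem_K hI hν _ h2]
    exact contDiffAt_const
  simp only [lift, if_neg h1]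
  refine ContDiffAt.mul ?_ (contDiff_phase.comp (contDiff_angle j)).contDiffAt
  exact Complex.ofRealCLM.contDiff.contDiffAt.comp _
    ((contDiff_slack j).contDiffAt.sqrt (hw j h1 h2).ne')

theorem slack_eq_add_sum (w : φ.A → ℂ) (j : Fin d) : φ.slack I ν lam w j =
    (ν (X j) - lam j + ∑ i, (lam i - ν (X i)) * φ.κ (X j) i) +
      ∑ i, φ.radial I w i * φ.κ (X j) i := by
  rw [slack, mu_apply, add_sub_right_comm, add_assoc, ← Finset.sum_add_distrib]
  congr 1
  refine Finset.sum_congr rfl fun i _ => ?_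
  ring

/-- The slacks are affine in the squared radii, so the inequalities of the domain survive convex
combinations of squared radii. -/
theorem slack_combo {w w₁ w₂ : φ.A → ℂ} {s : ℝ}
    (h : ∀ a, φ.radial I w a = s * φ.radial I w₁ a + (1 - s) * φ.radial I w₂ a) (j : Fin d) :
    φ.slack I ν lam w j = s * φ.slack I ν lam w₁ j + (1 - s) * φ.slack I ν lam w₂ j := by
  have : ∑ i, φ.radial I w i * φ.κ (X j) i = s * ∑ i, φ.radial I w₁ i * φ.κ (X j) i +
      (1 - s) * ∑ i, φ.radial I w₂ i * φ.κ (X j) i := by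
    rw [Finset.mul_sum, Finset.mul_sum, ← Finset.sum_add_distrib]
    refine Finset.sum_congr rfl fun i _ => ?_
    rw [h i]
    ring
  rw [slack_eq_add_sum, slack_eq_add_sum, slack_eq_add_sum, this]
  ring

theorem exists_mem_domain (hI : I ⊆ φ.A) (hν : ∀ k ∈ K, ν (X k) = lam k)
    (h : (openFace X lam (I ∪ K)).Nonempty) :
    ∃ w ∈ φ.domain I ν lam, ∀ i ∈ I, zeroExtend w i = 0 := by
  -- The subgroup is arbitrary here: only the representative in the zero level is used.
  obtain ⟨m, hm⟩ := stratum_nonempty (Q := (⊥ : AddSubgroup V)) h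
  induction m using Quotient.inductionOn with | h z =>
  have hz : ∀ j, z.1 j = 0 ↔ j ∈ I ∪ K := fun j => by
    rw [← hm j, orbitNorm_mk, norm_eq_zero]
  refine ⟨φ.coords I 0 z.1, coords_mem_domain hν _ z.2 ?_ ?_, ?_⟩
  · exact fun k hk => (hz k).2 (Finset.mem_union_right _ hk)
  · exact fun j h1 h2 h3 => (Finset.mem_union.1 ((hz j).1 h3)).elim h1 h2
  · intro i hi
    rw [zeroExtend_of_mem _ (hI hi), coords, if_pos hi, (hz i).2 (Finset.mem_union_left _ hi),
      mul_zero]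

theorem contractibleSpace_domain (hI : I ⊆ φ.A) (hν : ∀ k ∈ K, ν (X k) = lam k)
    (h : (openFace X lam (I ∪ K)).Nonempty) : ContractibleSpace (φ.domain I ν lam) := by
  obtain ⟨w₀, hw₀, hw₀'⟩ := exists_mem_domain hI hν h
  -- Scaling a coordinate in I by t scales its squared radius by t². The real parts of the other
  -- coordinates are squared radii themselves, so they are interpolated with the weight t² too; the
  -- angles are unconstrained.
  let G : ℝ → (φ.A → ℂ) → φ.A → ℂ := fun t w a =>
    if (a : Fin d) ∈ I then (t : ℂ) * w a
    else ((t ^ 2 * (w a).re + (1 - t ^ 2) * (w₀ a).re : ℝ) : ℂ) +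
      ((t * (w a).im + (1 - t) * (w₀ a).im : ℝ) : ℂ) * Complex.I
  have hG : ∀ t w a, φ.radial I (G t w) a =
      t ^ 2 * φ.radial I w a + (1 - t ^ 2) * φ.radial I w₀ a := by
    intro t w a
    by_cases hA : a ∈ φ.A
    · by_cases hIa : a ∈ I
      · rw [radial, radial, radial, if_pos hIa, if_pos hIa, if_pos hIa, hw₀' a hIa,
          zeroExtend_of_mem _ hA, zeroExtend_of_mem _ hA]
        simp [G, hIa, mul_pow]
      · rw [radial, radial, radial, if_neg hIa, if_neg hIa, if_neg hIa,
          zeroExtend_of_mem _ hA, zeroExtend_of_mem _ hA, zeroExtend_of_mem _ hA]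
        simp only [G, if_neg hIa]
        rw [Complex.add_re, Complex.ofReal_re, Complex.re_ofReal_mul, Complex.I_re, mul_zero,
          add_zero]
    · simp [radial, zeroExtend_of_notMem _ hA]
  have hGd : ∀ t ∈ Set.Icc (0 : ℝ) 1, ∀ w ∈ φ.domain I ν lam, G t w ∈ φ.domain I ν lam := by
    intro t ht w hw j h1 h2
    rw [slack_combo (hG t w) j]
    have ht2 : t ^ 2 ≤ 1 := pow_le_one₀ ht.1 ht.2
    rcases (sq_nonneg t).eq_or_lt with h0 | h0
    · rw [← h0]
      simpa using hw₀ j h1 h2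
    · exact add_pos_of_pos_of_nonneg (mul_pos h0 (hw j h1 h2))
        (mul_nonneg (by linarith) (hw₀ j h1 h2).le)
  have hGc : Continuous fun p : ℝ × (φ.A → ℂ) => G p.1 p.2 := by
    refine continuous_pi fun a => ?_
    simp only [G]
    split_ifs <;> fun_prop
  rw [contractible_iff_id_nullhomotopic]
  refine ⟨⟨w₀, hw₀⟩, ⟨?_⟩⟩
  refine
    { toFun := fun p => ⟨G (1 - p.1) p.2, hGd _ ⟨by linarith [p.1.2.2], by linarith [p.1.2.1]⟩ _ p.2.2⟩
      continuous_toFun := ?_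
      map_zero_left := fun w => Subtype.ext (funext fun a => ?_)
      map_one_left := fun w => Subtype.ext (funext fun a => ?_) }
  · refine Continuous.subtype_mk ?_ _
    exact hGc.comp (f := fun p : unitInterval × φ.domain I ν lam => ((1 - p.1 : ℝ), (p.2 : φ.A → ℂ)))
      (by fun_prop)
  · simp only [G, Set.Icc.coe_zero, sub_zero]
    split_ifs
    · simp
    · apply Complex.ext <;> simp
  · simp only [G, Set.Icc.coe_one, sub_self]
    split_ifs with hIa
    · have := hw₀' a hIa
      rw [zeroExtend_coe] at this
      simp [this]
    · apply Complex.ext <;> simp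

/-- For empty I every squared radius is a real part, hence linear in `w`. -/
theorem convex_domain_empty : Convex ℝ (φ.domain ∅ ν lam) := by
  intro w hw w' hw' s t hs ht hst j h1 h2
  obtain rfl : t = 1 - s := by linarith
  have : ∀ a, φ.radial ∅ (s • w + (1 - s) • w') a =
      s * φ.radial ∅ w a + (1 - s) * φ.radial ∅ w' a := by
    intro a
    by_cases hA : a ∈ φ.A
    · simp [radial, zeroExtend_of_mem _ hA]
    · simp [radial, zeroExtend_of_notMem _ hA]
  rw [slack_combo this]
  rcases hs.eq_or_lt with h0 | h0
  · rw [← h0]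
    simpa using hw' j h1 h2
  · exact add_pos_of_pos_of_nonneg (mul_pos h0 (hw j h1 h2)) (mul_nonneg ht (hw' j h1 h2).le)

/-! ### Change of frame -/

variable (φ φ' I ν lam) in
/-- The change of coordinates from one frame to another one. -/
def changeFrame (w : φ'.A → ℂ) : φ.A → ℂ :=
  φ.coords I (φ'.angle I w) (φ'.lift I ν lam w)

theorem changeFrame_mem (hI' : I ⊆ φ'.A) (hν : ∀ k ∈ K, ν (X k) = lam k) {w : φ'.A → ℂ}
    (hw : w ∈ φ'.domain I ν lam) : changeFrame φ φ' I ν lam w ∈ φ.domain I ν lam :=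
  coords_mem_domain hν _ (lift_mem_zeroLevel hI' hν hw) (fun _ hk => lift_of_mem_K hI' hν _ hk)
    fun _ h1 h2 => lift_ne_zero hw h1 h2

theorem lift_changeFrame (hI : I ⊆ φ.A) (hI' : I ⊆ φ'.A) (hν : ∀ k ∈ K, ν (X k) = lam k)
    {w : φ'.A → ℂ} (hw : w ∈ φ'.domain I ν lam) (j : Fin d) :
    φ.lift I ν lam (changeFrame φ φ' I ν lam w) j =
      phase (φ.κ (piMap X (φ'.angle I w)) j - φ'.angle I w j) * φ'.lift I ν lam w j :=
  lift_coords hI hν (lift_mem_zeroLevel hI' hν hw) (fun _ hk => lift_of_mem_K hI' hν _ hk)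
    (fun _ h1 _ => lift_eq_norm_mul_phase w h1) j

/-- By `κ_piMap_κ` the two changes together restore the angles, except that the first one drops the
components in I from the angle and puts them into the phases of the complex coordinates. The second
change then rotates these phases back. -/
theorem changeFrame_changeFrame (hI : I ⊆ φ.A) (hI' : I ⊆ φ'.A) (hν : ∀ k ∈ K, ν (X k) = lam k)
    {w : φ'.A → ℂ} (hw : w ∈ φ'.domain I ν lam) :
    changeFrame φ' φ I ν lam (changeFrame φ φ' I ν lam w) = w := by
  set u := changeFrame φ φ' I ν lam w with hu
  set y := φ.κ (piMap X (φ'.angle I w)) with hy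
  have hang : φ.angle I u = y - fun j => if j ∈ I then y j else 0 := by
    funext j
    rw [Pi.sub_apply]
    split_ifs with hj
    · rw [angle, if_pos hj, sub_self]
    · rw [hu, changeFrame, angle_coords hj, sub_zero]
  have hκ : ∀ a ∈ φ'.A, φ'.κ (piMap X (φ.angle I u)) a =
      φ'.angle I w a - if a ∈ I then y a else 0 := by
    intro a ha
    rw [hang, map_sub, map_sub, Pi.sub_apply, hy, κ_piMap_κ, ← hy]
    congr 1
    · refine φ'.κ_piMap_of_support (fun j h1 _ => ?_) ha
      simp [angle, zeroExtend_of_notMem _ h1]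
    · refine φ'.κ_piMap_of_support (fun j h1 _ => ?_) ha
      exact if_neg fun h => h1 (hI' h)
  have hlift := lift_changeFrame hI hI' hν hw
  rw [← hu, ← hy] at hlift
  funext a
  rw [changeFrame, coords, hκ a a.2, hlift a, norm_mul, norm_phase, one_mul,
    norm_lift_sq hI' hν hw, slack_of_mem a.2, radial, zeroExtend_coe]
  split_ifs with ha
  · rw [lift_of_mem ha, zeroExtend_coe, ← mul_assoc, ← phase_add, angle, if_pos ha, angle,
      if_pos ha]
    simp
  · rw [angle, if_neg ha, zeroExtend_coe, sub_zero]
    exact Complex.re_add_im _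

theorem contDiffAt_changeFrame (hI' : I ⊆ φ'.A) (hν : ∀ k ∈ K, ν (X k) = lam k)
    {w : φ'.A → ℂ} (hw : w ∈ φ'.domain I ν lam) :
    ContDiffAt ℝ ∞ (changeFrame φ φ' I ν lam) w := by
  have h1 : ∀ j, ContDiffAt ℝ ∞ (fun w => φ.κ (piMap X (φ'.angle I w)) j) w := fun j =>
    ((contDiff_κ_piMap j).comp (contDiff_pi.2 fun i => contDiff_angle i)).contDiffAt
  have h2 : ∀ j, ContDiffAt ℝ ∞ (fun w => φ'.lift I ν lam w j) w :=
    contDiffAt_pi.1 (contDiffAt_lift hI' hν hw)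
  rw [contDiffAt_pi]
  intro a
  unfold changeFrame coords
  by_cases ha : (a : Fin d) ∈ I
  · simp only [if_pos ha]
    refine ContDiffAt.mul ?_ (h2 a)
    exact contDiff_phase.contDiffAt.comp w ((h1 a).sub (contDiff_angle (a : Fin d)).contDiffAt)
  · simp only [if_neg ha]
    refine ContDiffAt.add ?_ (ContDiffAt.mul ?_ contDiffAt_const)
    · exact Complex.ofRealCLM.contDiff.contDiffAt.comp w ((h2 a).norm_sq ℝ)
    · exact Complex.ofRealCLM.contDiff.contDiffAt.comp w (h1 a)

theorem mk_lift_changeFrame {Q : AddSubgroup V} (hI : I ⊆ φ.A) (hI' : I ⊆ φ'.A)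
    (hν : ∀ k ∈ K, ν (X k) = lam k) {w : φ'.A → ℂ} (hw : w ∈ φ'.domain I ν lam) :
    Quotient.mk (orbitSetoid X lam Q)
      ⟨_, lift_mem_zeroLevel hI hν (changeFrame_mem (φ := φ) hI' hν hw)⟩ =
    Quotient.mk (orbitSetoid X lam Q) ⟨_, lift_mem_zeroLevel hI' hν hw⟩ :=
  mk_lift_coords hI hν ⟨_, lift_mem_zeroLevel hI' hν hw⟩
    (fun _ hk => lift_of_mem_K hI' hν _ hk) (fun _ h1 h2 => lift_ne_zero hw h1 h2)
    fun _ h1 _ => lift_eq_norm_mul_phase w h1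

end Smooth

end Frame

/-! ### Polar coordinates as coverings between models -/

namespace Frame

variable {V : Type*} [NormedAddCommGroup V] [NormedSpace ℝ V] {d : ℕ}
  {X : Fin d → V} {K : Finset (Fin d)}

section Polar

variable {φ φ' : Frame X K} {I I' : Finset (Fin d)} {ν : StrongDual ℝ V} {lam : Fin d → ℝ}

/-- Polar coordinates for the coordinates with index in `J`. -/
def polar (φ : Frame X K) (J : Finset (Fin d)) (w : φ.A → ℂ) (a : φ.A) : ℂ :=
  if (a : Fin d) ∈ J then Real.sqrt (w a).re * phase (w a).im else w a

/-- The local inverse of `polar` near the point `polar φ J z`. -/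
def polarSection (φ : Frame X K) (J : Finset (Fin d)) (z w : φ.A → ℂ) (a : φ.A) : ℂ :=
  if (a : Fin d) ∈ J then (‖w a‖ ^ 2 : ℝ) + (((z a).im +
    (Complex.log (w a / polar φ J z a)).im / (2 * Real.pi) : ℝ) : ℂ) * Complex.I else w a

/-- The deck transformations of `polar`. -/
def deck (φ : Frame X K) (J : Finset (Fin d)) (n : {a : φ.A // (a : Fin d) ∈ J} → ℤ)
    (w : φ.A → ℂ) (a : φ.A) : ℂ :=
  if h : (a : Fin d) ∈ J then w a + (n ⟨a, h⟩ : ℝ) * Complex.I else w a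

theorem radial_deck {n : {a : φ.A // (a : Fin d) ∈ I \ I'} → ℤ} (w : φ.A → ℂ) :
    φ.radial I' (deck φ (I \ I') n w) = φ.radial I' w := by
  funext j
  by_cases hA : j ∈ φ.A
  · rw [radial, radial, zeroExtend_of_mem _ hA, zeroExtend_of_mem _ hA, deck]
    split_ifs with h1 h2
    · exact absurd h1 (Finset.mem_sdiff.1 h2).2
    all_goals simp
  · rw [radial, radial, zeroExtend_of_notMem _ hA, zeroExtend_of_notMem _ hA]

theorem im_log_phase {t : ℝ} (ht : |t| < 1 / 2) :
    (Complex.log (phase t)).im / (2 * Real.pi) = t := by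
  have hpi := Real.pi_pos
  rw [abs_lt] at ht
  rw [phase_def, Complex.log_exp]
  · have : (2 * Real.pi * t * Complex.I : ℂ).im = 2 * Real.pi * t := by
      rw [show (2 * Real.pi * t * Complex.I : ℂ) = ((2 * Real.pi * t : ℝ) : ℂ) * Complex.I by
        push_cast; ring, Complex.im_ofReal_mul, Complex.I_im, mul_one]
    rw [this]
    field_simp
  all_goals
    rw [show (2 * Real.pi * t * Complex.I : ℂ) = ((2 * Real.pi * t : ℝ) : ℂ) * Complex.I by
      push_cast; ring, Complex.im_ofReal_mul, Complex.I_im, mul_one]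
    nlinarith

/-- Within half a turn of the base point, the principal logarithm of the quotient returns the true
difference of angles. -/
theorem polarSection_polar {J : Finset (Fin d)} {z w : φ.A → ℂ}
    (hz : ∀ a : φ.A, (a : Fin d) ∈ J → 0 < (z a).re)
    (hw : ∀ a : φ.A, (a : Fin d) ∈ J → 0 < (w a).re)
    (h : ∀ a : φ.A, (a : Fin d) ∈ J → |(w a).im - (z a).im| < 1 / 2) :
    polarSection φ J z (polar φ J w) = w := by
  funext a
  by_cases ha : (a : Fin d) ∈ J
  · simp only [polarSection, polar, if_pos ha]
    have h1 : (Real.sqrt (w a).re * phase (w a).im / (Real.sqrt (z a).re * phase (z a).im) : ℂ) =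
        ((Real.sqrt (w a).re / Real.sqrt (z a).re : ℝ) : ℂ) * phase ((w a).im - (z a).im) := by
      have h2 := phase_ne_zero (z a).im
      have h3 : (Real.sqrt (z a).re : ℂ) ≠ 0 := by exact_mod_cast (Real.sqrt_pos.2 (hz a ha)).ne'
      have h4 : phase (w a).im = phase ((w a).im - (z a).im) * phase (z a).im := by
        rw [← phase_add, sub_add_cancel]
      rw [h4]
      push_cast
      field_simp
    have hpos : 0 < Real.sqrt (w a).re / Real.sqrt (z a).re :=
      div_pos (Real.sqrt_pos.2 (hw a ha)) (Real.sqrt_pos.2 (hz a ha))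
    rw [h1, Complex.log_im, Complex.arg_real_mul _ hpos, ← Complex.log_im,
      im_log_phase (h a ha), norm_mul, norm_phase, mul_one, Complex.norm_real,
      Real.norm_eq_abs, sq_abs, Real.sq_sqrt (hw a ha).le, add_sub_cancel]
    exact Complex.re_add_im _
  · simp only [polarSection, polar, if_neg ha]

/-- No condition on `w` is needed: the principal argument is an argument of every complex number,
and the formula also holds at 0. Continuity of the section is needed only near the base point. -/
theorem polar_polarSection {J : Finset (Fin d)} {z w : φ.A → ℂ}
    (hz : ∀ a : φ.A, (a : Fin d) ∈ J → 0 < (z a).re) :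
    polar φ J (polarSection φ J z w) = w := by
  funext a
  by_cases ha : (a : Fin d) ∈ J
  · simp only [polarSection, polar, if_pos ha]
    have h1 : (((‖w a‖ ^ 2 : ℝ) : ℂ) + (((z a).im +
        (Complex.log (w a / (Real.sqrt (z a).re * phase (z a).im))).im / (2 * Real.pi) : ℝ) : ℂ) *
          Complex.I).re = ‖w a‖ ^ 2 := by
      rw [Complex.add_re, Complex.ofReal_re, Complex.re_ofReal_mul, Complex.I_re, mul_zero,
        add_zero]
    have h2 : (((‖w a‖ ^ 2 : ℝ) : ℂ) + (((z a).im +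
        (Complex.log (w a / (Real.sqrt (z a).re * phase (z a).im))).im / (2 * Real.pi) : ℝ) : ℂ) *
          Complex.I).im = (z a).im +
        (Complex.log (w a / (Real.sqrt (z a).re * phase (z a).im))).im / (2 * Real.pi) := by
      rw [Complex.add_im, Complex.ofReal_im, Complex.im_ofReal_mul, Complex.I_im, mul_one,
        zero_add]
    rw [h1, h2, Real.sqrt_sq (norm_nonneg _), phase_add, Complex.log_im]
    have hr : 0 < Real.sqrt (z a).re := Real.sqrt_pos.2 (hz a ha)
    have h3 := norm_mul_phase_arg (w a / (Real.sqrt (z a).re * phase (z a).im))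
    rw [norm_div, norm_mul, norm_phase, mul_one, Complex.norm_real, Real.norm_eq_abs,
      abs_of_pos hr] at h3
    have h4 : (Real.sqrt (z a).re : ℂ) ≠ 0 := by exact_mod_cast hr.ne'
    have h5 := phase_ne_zero (z a).im
    push_cast at h3
    rw [div_mul_eq_mul_div, div_eq_div_iff h4 (mul_ne_zero h4 h5)] at h3
    have h6 : (Real.sqrt (z a).re : ℂ) * (‖w a‖ * (phase (z a).im *
        phase (Complex.arg (w a / (Real.sqrt (z a).re * phase (z a).im)) / (2 * Real.pi)))) =
        Real.sqrt (z a).re * w a := by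
      rw [mul_comm _ (w a), ← h3]
      ring
    exact mul_left_cancel₀ h4 h6
  · simp only [polarSection, polar, if_neg ha]

theorem polar_deck {J : Finset (Fin d)} (n : {a : φ.A // (a : Fin d) ∈ J} → ℤ) (w : φ.A → ℂ) :
    polar φ J (deck φ J n w) = polar φ J w := by
  funext a
  by_cases ha : (a : Fin d) ∈ J
  · simp only [polar, deck, if_pos ha, dif_pos ha]
    have h1 : (w a + ((n ⟨a, ha⟩ : ℝ) : ℂ) * Complex.I).re = (w a).re := by simp
    have h2 : (w a + ((n ⟨a, ha⟩ : ℝ) : ℂ) * Complex.I).im = (w a).im + (n ⟨a, ha⟩ : ℝ) := by simp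
    rw [h1, h2, phase_add, phase_intCast, mul_one]
  · simp only [polar, deck, if_neg ha, dif_neg ha]

theorem exists_deck_of_polar_eq {J : Finset (Fin d)} {z w : φ.A → ℂ}
    (hz : ∀ a : φ.A, (a : Fin d) ∈ J → 0 < (z a).re)
    (hw : ∀ a : φ.A, (a : Fin d) ∈ J → 0 < (w a).re)
    (h : polar φ J z = polar φ J w) : ∃ n, deck φ J n w = z := by
  have h1 : ∀ a : {a : φ.A // (a : Fin d) ∈ J}, (z a).re = (w a).re ∧
      ∃ n : ℤ, (z a).im - (w a).im = n := by
    rintro ⟨a, ha⟩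
    have h2 := congrFun h a
    simp only [polar, if_pos ha] at h2
    have h3 := congrArg norm h2
    simp only [norm_mul, norm_phase, mul_one, Complex.norm_real, Real.norm_eq_abs,
      abs_of_nonneg (Real.sqrt_nonneg _)] at h3
    have h4 : (z a).re = (w a).re := (Real.sqrt_inj (hz a ha).le (hw a ha).le).1 h3
    refine ⟨h4, (phase_eq_iff _ _).1 ?_⟩
    rw [h3] at h2
    refine mul_left_cancel₀ ?_ h2
    exact_mod_cast (Real.sqrt_pos.2 (hw a ha)).ne'
  choose hre n hn using h1
  refine ⟨n, funext fun a => ?_⟩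
  by_cases ha : (a : Fin d) ∈ J
  · rw [deck, dif_pos ha]
    have h2 := hn ⟨a, ha⟩
    apply Complex.ext
    · simpa using (hre ⟨a, ha⟩).symm
    · rw [Complex.add_im, Complex.im_ofReal_mul, Complex.I_im, mul_one, ← h2]
      ring
  · have := congrFun h a
    simp only [polar, if_neg ha] at this
    rw [deck, dif_neg ha, this]

theorem contDiffAt_polar {J : Finset (Fin d)} {z : φ.A → ℂ}
    (hz : ∀ a : φ.A, (a : Fin d) ∈ J → 0 < (z a).re) : ContDiffAt ℝ ∞ (polar φ J) z := by
  rw [contDiffAt_pi]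
  intro a
  unfold polar
  have h0 : ContDiff ℝ ∞ fun w : φ.A → ℂ => w a := contDiff_apply ℝ ℂ a
  by_cases ha : (a : Fin d) ∈ J
  · simp only [if_pos ha]
    refine ContDiffAt.mul ?_ ?_
    · exact Complex.ofRealCLM.contDiff.contDiffAt.comp _
        ((Complex.reCLM.contDiff.comp h0).contDiffAt.sqrt (hz a ha).ne')
    · exact (contDiff_phase.comp (Complex.imCLM.contDiff.comp h0)).contDiffAt
  · simp only [if_neg ha]
    exact h0.contDiffAt

theorem polar_ne_zero {J : Finset (Fin d)} {z : φ.A → ℂ} {a : φ.A} (ha : (a : Fin d) ∈ J)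
    (hz : 0 < (z a).re) : polar φ J z a ≠ 0 := by
  rw [polar, if_pos ha]
  refine mul_ne_zero ?_ (phase_ne_zero _)
  exact_mod_cast (Real.sqrt_pos.2 hz).ne'

theorem contDiffAt_polarSection {J : Finset (Fin d)} {z : φ.A → ℂ}
    (hz : ∀ a : φ.A, (a : Fin d) ∈ J → 0 < (z a).re) :
    ContDiffAt ℝ ∞ (polarSection φ J z) (polar φ J z) := by
  rw [contDiffAt_pi]
  intro a
  unfold polarSection
  have h0 : ContDiff ℝ ∞ fun w : φ.A → ℂ => w a := contDiff_apply ℝ ℂ a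
  by_cases ha : (a : Fin d) ∈ J
  · simp only [if_pos ha]
    have hne := polar_ne_zero ha (hz a ha)
    refine ContDiffAt.add ?_ (ContDiffAt.mul ?_ contDiffAt_const)
    · exact Complex.ofRealCLM.contDiff.contDiffAt.comp _ (h0.contDiffAt.norm_sq ℝ)
    · refine Complex.ofRealCLM.contDiff.contDiffAt.comp _ (contDiffAt_const.add ?_)
      refine ContDiffAt.div_const ?_ _
      refine ContDiffAt.comp (g := Complex.im) (polar φ J z) Complex.imCLM.contDiff.contDiffAt ?_
      have hlog : ContDiffAt ℂ ∞ Complex.log (polar φ J z a / polar φ J z a) := by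
        refine Complex.contDiffAt_log ?_
        rw [div_self hne]
        exact Complex.one_mem_slitPlane
      exact ContDiffAt.comp (g := Complex.log) (polar φ J z) (hlog.restrict_scalars ℝ)
        (h0.contDiffAt.div_const _)
  · simp only [if_neg ha]
    exact h0.contDiffAt

theorem radial_polarSection (hI' : I' ⊆ I) (z : φ.A → ℂ) {w : φ.A → ℂ} :
    φ.radial I' (polarSection φ (I \ I') z w) = φ.radial I w := by
  funext j
  by_cases hA : j ∈ φ.A
  · rw [radial, radial, zeroExtend_of_mem _ hA, zeroExtend_of_mem _ hA, polarSection]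
    by_cases h1 : j ∈ I'
    · simp [h1, hI' h1]
    · by_cases h2 : j ∈ I
      · rw [if_neg h1, if_pos h2, if_pos (Finset.mem_sdiff.2 ⟨h2, h1⟩), Complex.add_re,
          Complex.ofReal_re, Complex.re_ofReal_mul, Complex.I_re, mul_zero, add_zero]
      · simp [h1, h2]
  · rw [radial, radial, zeroExtend_of_notMem _ hA, zeroExtend_of_notMem _ hA]
    simp

variable [FiniteDimensional ℝ V]

theorem re_pos_of_mem_domain {w : φ.A → ℂ} (hw : w ∈ φ.domain I' ν lam) (a : φ.A)
    (ha : (a : Fin d) ∈ I \ I') : 0 < (w a).re := by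
  have h1 := (Finset.mem_sdiff.1 ha).2
  have := hw a h1 (φ.notMem_K a.2)
  rwa [slack_of_mem a.2, radial, if_neg h1, zeroExtend_coe] at this

theorem radial_polar (hI' : I' ⊆ I) {w : φ.A → ℂ} (hw : w ∈ φ.domain I' ν lam) :
    φ.radial I (polar φ (I \ I') w) = φ.radial I' w := by
  funext j
  by_cases hA : j ∈ φ.A
  · rw [radial, radial, zeroExtend_of_mem _ hA, zeroExtend_of_mem _ hA, polar]
    by_cases h1 : j ∈ I'
    · simp [h1, hI' h1]
    · by_cases h2 : j ∈ I
      · have hpos := re_pos_of_mem_domain hw ⟨j, hA⟩ (Finset.mem_sdiff.2 ⟨h2, h1⟩)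
        simp [h1, h2, Real.sq_sqrt hpos.le]
      · simp [h1, h2]
  · rw [radial, radial, zeroExtend_of_notMem _ hA, zeroExtend_of_notMem _ hA]
    simp

theorem slack_congr_radial {w w' : φ.A → ℂ} (h : φ.radial I w = φ.radial I' w') :
    φ.slack I ν lam w = φ.slack I' ν lam w' := by
  funext j
  rw [slack, slack, mu, mu, h]

variable (φ I I' ν lam) in
/-- The part of the domain on which the coordinates with index in `I` but not in `I'`
do not vanish. -/
def partialDomain : Set (φ.A → ℂ) :=
  {w | w ∈ φ.domain I ν lam ∧ ∀ a : φ.A, (a : Fin d) ∈ I \ I' → w a ≠ 0}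

theorem polar_mem (hI' : I' ⊆ I) {w : φ.A → ℂ} (hw : w ∈ φ.domain I' ν lam) :
    polar φ (I \ I') w ∈ partialDomain φ I I' ν lam := by
  refine ⟨fun j h1 h2 => ?_, fun a ha => polar_ne_zero ha (re_pos_of_mem_domain hw a ha)⟩
  rw [slack_congr_radial (radial_polar hI' hw)]
  exact hw j (fun h => h1 (hI' h)) h2

/-- Unrolling a coordinate changes its name in the model but not the point of ℂ^d. -/
theorem lift_polar (hI : I ⊆ φ.A) (hI' : I' ⊆ I) {w : φ.A → ℂ} (hw : w ∈ φ.domain I' ν lam) :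
    φ.lift I ν lam (polar φ (I \ I') w) = φ.lift I' ν lam w := by
  funext j
  by_cases h1 : j ∈ I'
  · rw [lift_of_mem h1, lift_of_mem (hI' h1), zeroExtend_of_mem _ (hI (hI' h1)),
      zeroExtend_of_mem _ (hI (hI' h1)), polar, if_neg]
    simp [h1]
  · by_cases h2 : j ∈ I
    · rw [lift_of_mem h2, lift, if_neg h1, slack_of_mem (hI h2), radial, if_neg h1, angle,
        if_neg h1, zeroExtend_of_mem _ (hI h2), zeroExtend_of_mem _ (hI h2), polar, if_pos]
      simp [h1, h2]
    · rw [lift, lift, if_neg h1, if_neg h2, slack_congr_radial (radial_polar hI' hw), angle, angle,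
        if_neg h1, if_neg h2]
      by_cases hA : j ∈ φ.A
      · rw [zeroExtend_of_mem _ hA, zeroExtend_of_mem _ hA, polar, if_neg]
        simp [h2]
      · rw [zeroExtend_of_notMem _ hA, zeroExtend_of_notMem _ hA]

theorem polarSection_mem (hI : I ⊆ φ.A) (hI' : I' ⊆ I) (z : φ.A → ℂ) {w : φ.A → ℂ}
    (hw : w ∈ partialDomain φ I I' ν lam) :
    polarSection φ (I \ I') z w ∈ φ.domain I' ν lam := by
  intro j h1 h2
  rw [slack_congr_radial (radial_polarSection hI' z)]
  by_cases h3 : j ∈ I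
  · rw [slack_of_mem (hI h3), radial, if_pos h3, zeroExtend_of_mem _ (hI h3)]
    have := norm_pos_iff.2 (hw.2 ⟨j, hI h3⟩ (Finset.mem_sdiff.2 ⟨h3, h1⟩))
    positivity
  · exact hw.1 j h3 h2

theorem deck_mem {w : φ.A → ℂ} (hw : w ∈ φ.domain I' ν lam)
    (n : {a : φ.A // (a : Fin d) ∈ I \ I'} → ℤ) : deck φ (I \ I') n w ∈ φ.domain I' ν lam := by
  intro j h1 h2
  rw [slack_congr_radial (radial_deck w)]
  exact hw j h1 h2

/-- `polar` is the quotient map by the integral translations of the newly unrolled angles. It is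
open because it has local sections, and the translations act properly discontinuously. -/
theorem isSmoothCovering_polar (hI : I ⊆ φ.A) (hI' : I' ⊆ I) :
    IsSmoothCovering (φ.domain I' ν lam) (partialDomain φ I I' ν lam) (polar φ (I \ I')) := by
  have hmaps : Set.MapsTo (polar φ (I \ I')) (φ.domain I' ν lam) (partialDomain φ I I' ν lam) :=
    fun w hw => polar_mem hI' hw
  have hsurj : Set.SurjOn (polar φ (I \ I')) (φ.domain I' ν lam)
      (partialDomain φ I I' ν lam) := fun w hw =>
    -- Any base point with positive real parts would do.
    ⟨polarSection φ (I \ I') (fun _ => 1) w, polarSection_mem hI hI' _ hw,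
      polar_polarSection fun a _ => by simp⟩
  have hpos : ∀ z ∈ φ.domain I' ν lam, ∀ a : φ.A, (a : Fin d) ∈ I \ I' → 0 < (z a).re :=
    fun z hz a ha => re_pos_of_mem_domain hz a ha
  have hcont : Continuous (hmaps.restrict _ _ _) := ContinuousOn.mapsToRestrict
    (fun z hz => (contDiffAt_polar (hpos z hz)).continuousAt.continuousWithinAt) hmaps
  have hself : ∀ z ∈ φ.domain I' ν lam,
      polarSection φ (I \ I') z (polar φ (I \ I') z) = z := fun z hz =>
    polarSection_polar (hpos z hz) (hpos z hz) fun a _ => by norm_num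
  refine ⟨hmaps, hsurj, ?_, fun z hz => contDiffAt_polar (hpos z hz), fun z hz => ?_⟩
  · let _ : AddAction ({a : φ.A // (a : Fin d) ∈ I \ I'} → ℤ) (φ.domain I' ν lam) :=
      { vadd := fun n w => ⟨deck φ (I \ I') n w, deck_mem w.2 n⟩
        zero_vadd := fun w => Subtype.ext (funext fun a => by
          change deck φ (I \ I') 0 w a = w.1 a
          simp [deck])
        add_vadd := fun m n w => Subtype.ext (funext fun a => by
          change deck φ (I \ I') (m + n) w a = deck φ (I \ I') m (deck φ (I \ I') n w) a
          simp only [deck]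
          split_ifs
          · simp only [Pi.add_apply]
            push_cast
            ring
          · rfl) }
    have hvadd : ∀ (n : {a : φ.A // (a : Fin d) ∈ I \ I'} → ℤ) (w : φ.domain I' ν lam),
        ((n +ᵥ w : φ.domain I' ν lam) : φ.A → ℂ) = deck φ (I \ I') n w := fun _ _ => rfl
    have hval : ∀ a, Continuous fun w : φ.domain I' ν lam => (w : φ.A → ℂ) a := fun a =>
      (continuous_apply a).comp continuous_subtype_val
    have hopen : IsOpenMap (hmaps.restrict (polar φ (I \ I')) _ _) := by
      rw [isOpenMap_iff_nhds_le]
      intro z W hW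
      let s : partialDomain φ I I' ν lam → φ.domain I' ν lam :=
        fun w => ⟨polarSection φ (I \ I') z w, polarSection_mem hI hI' _ w.2⟩
      have hs : ContinuousAt s (hmaps.restrict _ _ _ z) := by
        refine Topology.IsInducing.subtypeVal.continuousAt_iff.2 ?_
        exact ContinuousAt.comp (g := polarSection φ (I \ I') z)
          (contDiffAt_polarSection (hpos z z.2)).continuousAt continuous_subtype_val.continuousAt
      have hsz : s (hmaps.restrict _ _ _ z) = z := Subtype.ext (hself z z.2)
      rw [ContinuousAt, hsz] at hs
      have h1 := hs hW
      refine Filter.mem_of_superset h1 fun w hw => ?_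
      have h2 : hmaps.restrict _ _ _ (s w) = w :=
        Subtype.ext (polar_polarSection (hpos z z.2))
      have h3 : hmaps.restrict _ _ _ (s w) ∈ W := hw
      rwa [h2] at h3
    refine IsAddQuotientCoveringMap.isCoveringMap _ ({a : φ.A // (a : Fin d) ∈ I \ I'} → ℤ)
      { toIsQuotientMap := hopen.isQuotientMap hcont (hmaps.restrict_surjective_iff.2 hsurj)
        continuous_const_vadd := fun n => ?_
        apply_eq_iff_mem_orbit := @fun z w => ?_
        disjoint := fun z => ?_ }
    · refine Continuous.subtype_mk ?_ _
      refine continuous_pi fun a => ?_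
      simp only [deck]
      split_ifs
      · exact (hval a).add continuous_const
      · exact hval a
    · constructor
      · intro h
        obtain ⟨n, hn⟩ := exists_deck_of_polar_eq (hpos z z.2) (hpos w w.2) (congrArg Subtype.val h)
        exact ⟨n, Subtype.ext hn⟩
      · rintro ⟨n, rfl⟩
        exact Subtype.ext (polar_deck n _)
    -- Angles of two points of this neighbourhood differ by less than 1, so a nonzero integral
    -- translation moves it off itself.
    · refine ⟨{w | ∀ a : {a : φ.A // (a : Fin d) ∈ I \ I'},
        |(w.1 a).im - (z.1 a).im| < 1 / 2}, ?_, ?_⟩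
      · refine IsOpen.mem_nhds ?_ fun a => by norm_num
        simp only [Set.ofPred_forall]
        refine isOpen_iInter_of_finite fun a => ?_
        exact isOpen_lt ((Complex.continuous_im.comp (hval a.1)).sub continuous_const).abs
          continuous_const
      · rintro n ⟨_, ⟨w, hw, rfl⟩, hw'⟩
        funext a
        have h1 := hw a
        have h2 := hw' a
        simp only [hvadd, deck, dif_pos a.2] at h2
        simp only [Complex.add_im, Complex.im_ofReal_mul, Complex.I_im, mul_one] at h2
        rw [abs_lt] at h1 h2
        have h3 : (n a : ℝ) < 1 := by linarith
        have h4 : (-1 : ℝ) < n a := by linarith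
        have h5 : n a < 1 := by exact_mod_cast h3
        have h6 : -1 < n a := by exact_mod_cast h4
        simp only [Pi.zero_apply]
        omega
  · refine ⟨polarSection φ (I \ I') z, contDiffAt_polarSection (hpos z hz), hself z hz, ?_⟩
    have h1 : ∀ᶠ w : φ.A → ℂ in 𝓝 z, ∀ a : φ.A, |(w a).im - (z a).im| < 1 / 2 := by
      rw [Filter.eventually_all]
      intro a
      refine (isOpen_lt (f := fun w : φ.A → ℂ => |(w a).im - (z a).im|) ?_
        continuous_const).mem_nhds (by simp)
      fun_prop
    filter_upwards [nhdsWithin_le_nhds h1, self_mem_nhdsWithin] with w hw hwZ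
    exact polarSection_polar (hpos z hz) (hpos w hwZ) fun a _ => hw a

/-- The covering of a part of the model by the model for a smaller index set,
in any two frames. -/
theorem isSmoothCovering_polar_changeFrame (hI : I ⊆ φ.A) (hI' : I' ⊆ I) (hIφ' : I' ⊆ φ'.A)
    (hν : ∀ k ∈ K, ν (X k) = lam k) :
    IsSmoothCovering (φ'.domain I' ν lam) (partialDomain φ I I' ν lam)
      (polar φ (I \ I') ∘ changeFrame φ φ' I' ν lam) :=
  (isSmoothCovering_polar hI hI').comp_diffeo (fun _ hw => changeFrame_mem hIφ' hν hw)
    (fun _ hw => changeFrame_mem (hI'.trans hI) hν hw)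
    (fun _ hw => changeFrame_changeFrame (hI'.trans hI) hIφ' hν hw)
    (fun _ hw => changeFrame_changeFrame hIφ' (hI'.trans hI) hν hw)
    (fun _ hw => contDiffAt_changeFrame hIφ' hν hw)
    fun _ hw => contDiffAt_changeFrame (hI'.trans hI) hν hw

theorem mk_lift_polar_changeFrame {Q : AddSubgroup V} (hI : I ⊆ φ.A) (hI' : I' ⊆ I)
    (hIφ' : I' ⊆ φ'.A) (hν : ∀ k ∈ K, ν (X k) = lam k) {w : φ'.A → ℂ}
    (hw : w ∈ φ'.domain I' ν lam)
    (hp : (polar φ (I \ I') ∘ changeFrame φ φ' I' ν lam) w ∈ φ.domain I ν lam) :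
    Quotient.mk (orbitSetoid X lam Q) ⟨_, lift_mem_zeroLevel hI hν hp⟩ =
    Quotient.mk (orbitSetoid X lam Q) ⟨_, lift_mem_zeroLevel hIφ' hν hw⟩ := by
  rw [← mk_lift_changeFrame (φ := φ) (hI'.trans hI) hIφ' hν hw]
  congr 1
  exact Subtype.ext (lift_polar hI hI' (changeFrame_mem hIφ' hν hw))

end Polar

end Frame

namespace Frame

variable {V : Type*} [NormedAddCommGroup V] [NormedSpace ℝ V] {d : ℕ}
  {X : Fin d → V} {K : Finset (Fin d)} {φ : Frame X K} {I : Finset (Fin d)}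
  {ν : StrongDual ℝ V} {lam : Fin d → ℝ} {Q : AddSubgroup V}

theorem continuousAt_κ_piMap {Y : Type*} [TopologicalSpace Y] {f : Y → Fin d → ℝ} {y : Y}
    (hf : ContinuousAt f y) (j : Fin d) : ContinuousAt (fun y => φ.κ (piMap X (f y)) j) y :=
  ContinuousAt.comp (g := fun α => φ.κ (piMap X α) j)
    (contDiff_κ_piMap j).continuous.continuousAt hf

/-! ### Transversality -/

theorem hasDerivAt_angle_line (w v : φ.A → ℂ) (j : Fin d) :
    HasDerivAt (fun t : ℝ => φ.angle I (w + t • v) j) (φ.angle I v j) 0 := by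
  have h : ∀ t : ℝ, φ.angle I (w + t • v) j = φ.angle I w j + t * φ.angle I v j := by
    intro t
    unfold angle
    split_ifs
    · simp
    · by_cases hA : j ∈ φ.A
      · simp [zeroExtend_of_mem _ hA]
      · simp [zeroExtend_of_notMem _ hA]
  simp only [h]
  simpa using ((hasDerivAt_id (0 : ℝ)).mul_const (φ.angle I v j)).const_add (φ.angle I w j)

variable [FiniteDimensional ℝ V]

/-- A vector tangent to an N-orbit preserves all radii to first order, which kills the radial part
of `v`. Comparing angles gives y = 2π · (angle of v) off I ∪ K, so y is supported on A ∪ K. Since πy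
= 0, applying κ yields y = 0 on A, and then every component of `v` vanishes. -/
theorem eq_zero_of_tangent (hI : I ⊆ φ.A) (hν : ∀ k ∈ K, ν (X k) = lam k) {w : φ.A → ℂ}
    (hw : w ∈ φ.domain I ν lam) {v : φ.A → ℂ} {y : Fin d → ℝ} (hy : y ∈ lieN X)
    (h : ∀ j, fderiv ℝ (φ.lift I ν lam) w v j = Complex.I * (y j : ℂ) * φ.lift I ν lam w j) :
    v = 0 := by
  have hline : HasDerivAt (fun t : ℝ => w + t • v) v 0 := by
    simpa using ((hasDerivAt_id (0 : ℝ)).smul_const v).const_add w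
  have h0 : w + (0 : ℝ) • v = w := by simp
  have hlift : ∀ j, HasDerivAt (fun t : ℝ => φ.lift I ν lam (w + t • v) j)
      (Complex.I * (y j : ℂ) * φ.lift I ν lam w j) 0 := by
    intro j
    have h1 : HasFDerivAt (φ.lift I ν lam) (fderiv ℝ (φ.lift I ν lam) w) (w + (0 : ℝ) • v) := by
      rw [h0]
      exact ((contDiffAt_lift hI hν hw).differentiableAt (by simp)).hasFDerivAt
    have h2 := (hasDerivAt_pi.1 (h1.comp_hasDerivAt (0 : ℝ) hline)) j
    rw [h j] at h2
    exact h2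
  have hdom : ∀ᶠ t : ℝ in 𝓝 0, w + t • v ∈ φ.domain I ν lam := by
    refine hline.continuousAt.eventually_mem (isOpen_domain.mem_nhds ?_)
    simpa using hw
  have hslack : ∀ j, HasDerivAt (fun t : ℝ => φ.slack I ν lam (w + t • v) j) 0 0 := by
    intro j
    have h1 := (hlift j).norm_sq
    have h2 : 2 * inner ℝ (φ.lift I ν lam (w + (0 : ℝ) • v) j)
        (Complex.I * (y j : ℂ) * φ.lift I ν lam w j) = 0 := by
      rw [h0, Complex.inner]
      have : (starRingEnd ℂ) (φ.lift I ν lam w j) * (Complex.I * (y j : ℂ) * φ.lift I ν lam w j) =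
          ((Complex.normSq (φ.lift I ν lam w j) * y j : ℝ) : ℂ) * Complex.I := by
        push_cast
        rw [Complex.normSq_eq_conj_mul_self]
        ring
      rw [mul_comm] at this
      rw [this, Complex.re_ofReal_mul, Complex.I_re, mul_zero, mul_zero]
    rw [h2] at h1
    refine h1.congr_of_eventuallyEq ?_
    filter_upwards [hdom] with t ht
    exact (norm_lift_sq hI hν ht j).symm
  have hre : ∀ a : φ.A, (a : Fin d) ∉ I → (v a).re = 0 := by
    intro a ha
    have h1 := hslack a
    have h2 : (fun t : ℝ => φ.slack I ν lam (w + t • v) a) = fun t => (w a).re + t * (v a).re := by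
      funext t
      rw [slack_of_mem a.2, radial, if_neg ha, zeroExtend_coe]
      simp
    rw [h2] at h1
    have h3 : HasDerivAt (fun t : ℝ => (w a).re + t * (v a).re) (v a).re 0 := by
      simpa using ((hasDerivAt_id (0 : ℝ)).mul_const (v a).re).const_add (w a).re
    exact h3.unique h1
  have hang : ∀ j ∉ I, j ∉ K → y j = 2 * Real.pi * φ.angle I v j := by
    intro j h1 h2
    have h3 : HasDerivAt (fun t : ℝ => (Real.sqrt (φ.slack I ν lam (w + t • v) j) : ℂ)) 0 0 := by
      have h4 := (hslack j).sqrt (by rw [h0]; exact (hw j h1 h2).ne')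
      simpa using h4.ofReal_comp
    have h4 := h3.mul ((hasDerivAt_phase _).scomp (0 : ℝ)
      (hasDerivAt_angle_line (I := I) w v j))
    have h5 := hlift j
    simp only [lift, if_neg h1] at h5
    have h6 := h5.unique h4
    have h7 : (Complex.I * (Real.sqrt (φ.slack I ν lam w j) * phase (φ.angle I w j))) *
        ((y j : ℂ) - ((2 * Real.pi * φ.angle I v j : ℝ) : ℂ)) = 0 := by
      simp only [h0, zero_mul, zero_add, Complex.real_smul, Function.comp_apply] at h6
      push_cast
      linear_combination h6
    rcases mul_eq_zero.1 h7 with h8 | h8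
    · rcases mul_eq_zero.1 h8 with h9 | h9
      · exact absurd h9 Complex.I_ne_zero
      · have := lift_ne_zero hw h1 h2
        rw [lift, if_neg h1] at this
        exact absurd h9 this
    · exact_mod_cast sub_eq_zero.1 h8
  have hsupp : ∀ j ∉ φ.A, j ∉ K → y j = 0 := by
    intro j h1 h2
    rw [hang j (fun h => h1 (hI h)) h2, angle]
    simp [zeroExtend_of_notMem _ h1]
  have hyA : ∀ a ∈ φ.A, y a = 0 := by
    intro a ha
    have hy0 : piMap X y = 0 := hy
    rw [← φ.κ_piMap_of_support hsupp ha, hy0, map_zero, Pi.zero_apply]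
  funext a
  by_cases ha : (a : Fin d) ∈ I
  · have h1 := hlift a
    have h2 : (fun t : ℝ => φ.lift I ν lam (w + t • v) a) = fun t : ℝ => w a + t • v a := by
      funext t
      rw [lift_of_mem ha, zeroExtend_coe]
      simp
    have h3 : HasDerivAt (fun t : ℝ => w a + t • v a) (v a) 0 := by
      simpa using ((hasDerivAt_id (0 : ℝ)).smul_const (v a)).const_add (w a)
    rw [h2, hyA a a.2] at h1
    simpa using h3.unique h1
  · have h1 := hang a ha (φ.notMem_K a.2)
    rw [hyA a a.2, angle, if_neg ha, zeroExtend_coe] at h1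
    have h2 : (v a).im = 0 := by
      have := Real.pi_pos
      rcases mul_eq_zero.1 h1.symm with h3 | h3
      · linarith
      · exact h3
    exact Complex.ext (hre a ha) h2

/-! ### The orbit model -/

theorem coords_angle_lift (hI : I ⊆ φ.A) (hν : ∀ k ∈ K, ν (X k) = lam k) {w : φ.A → ℂ}
    (hw : w ∈ φ.domain I ν lam) : φ.coords I (φ.angle I w) (φ.lift I ν lam w) = w := by
  have hκ : ∀ a ∈ φ.A, φ.κ (piMap X (φ.angle I w)) a = φ.angle I w a := fun a ha =>
    φ.κ_piMap_of_support (fun j h1 _ => by simp [angle, zeroExtend_of_notMem _ h1]) ha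
  funext a
  rw [coords, hκ a a.2, norm_lift_sq hI hν hw, slack_of_mem a.2, radial, angle, zeroExtend_coe]
  split_ifs with ha
  · rw [lift_of_mem ha, zeroExtend_coe]
    simp
  · exact Complex.re_add_im _

/-- Near a lifted point there is a continuous choice of coordinates. -/
theorem exists_local_coords (hI : I ⊆ φ.A) (hν : ∀ k ∈ K, ν (X k) = lam k) {u : φ.A → ℂ}
    (hu : u ∈ φ.domain I ν lam) :
    ∃ τ : (Fin d → ℂ) → φ.A → ℂ, ContinuousAt τ (φ.lift I ν lam u) ∧
      τ (φ.lift I ν lam u) = u ∧ ∀ z : zeroLevel X lam, (∀ k ∈ K, z.1 k = 0) →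
        (∀ j ∉ I, j ∉ K → z.1 j ≠ 0) → ∃ h : τ z.1 ∈ φ.domain I ν lam,
          Quotient.mk (orbitSetoid X lam Q) ⟨_, lift_mem_zeroLevel hI hν h⟩ =
            Quotient.mk (orbitSetoid X lam Q) z := by
  set z₀ := φ.lift I ν lam u with hz₀
  -- This is the branch of the argument that takes the model angle of `u` at the lift of `u`;
  -- dividing by `z₀ j` keeps the principal argument away from its cut.
  let α : (Fin d → ℂ) → Fin d → ℝ := fun z j =>
    if j ∈ I ∨ j ∈ K then 0 else φ.angle I u j + Complex.arg (z j / z₀ j) / (2 * Real.pi)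
  have hα₀ : α z₀ = φ.angle I u := by
    funext j
    simp only [α]
    split_ifs with h
    · rcases h with h | h
      · rw [angle, if_pos h]
      · rw [angle, zeroExtend_of_notMem _ fun h' => φ.notMem_K h' h]
        simp
    · push Not at h
      rw [div_self (lift_ne_zero hu h.1 h.2)]
      simp
  have hα : ContinuousAt α z₀ := by
    refine continuousAt_pi.2 fun j => ?_
    simp only [α]
    split_ifs with h
    · exact continuousAt_const
    · push Not at h
      refine continuousAt_const.add (ContinuousAt.div_const ?_ _)
      refine ContinuousAt.comp (g := Complex.arg) ?_ ((continuous_apply j).continuousAt.div_const _)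
      rw [div_self (lift_ne_zero hu h.1 h.2)]
      exact Complex.continuousAt_arg Complex.one_mem_slitPlane
  refine ⟨fun z => φ.coords I (α z) z, ?_, ?_, fun z hK hne => ?_⟩
  · refine continuousAt_pi.2 fun a => ?_
    unfold coords
    have h1 : ContinuousAt (fun z : Fin d → ℂ => z a) z₀ := (continuous_apply _).continuousAt
    by_cases ha : (a : Fin d) ∈ I
    · simp only [if_pos ha]
      refine ContinuousAt.mul ?_ h1
      exact ContinuousAt.comp (g := phase) contDiff_phase.continuous.continuousAt
        ((continuousAt_κ_piMap hα _).sub (continuousAt_pi.1 hα _))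
    · simp only [if_neg ha]
      refine ContinuousAt.add ?_ (ContinuousAt.mul ?_ continuousAt_const)
      · exact ContinuousAt.comp (g := Complex.ofReal) Complex.continuous_ofReal.continuousAt
          (h1.norm.pow 2)
      · exact ContinuousAt.comp (g := Complex.ofReal) Complex.continuous_ofReal.continuousAt
          (continuousAt_κ_piMap hα _)
  · simp only [hα₀]
    exact coords_angle_lift hI hν hu
  · refine ⟨coords_mem_domain hν _ z.2 hK hne, mk_lift_coords hI hν z hK hne fun j h1 h2 => ?_⟩
    have h3 : α z.1 j = φ.angle I u j + Complex.arg (z.1 j / z₀ j) / (2 * Real.pi) :=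
      if_neg (by tauto)
    have h4 : z₀ j ≠ 0 := lift_ne_zero hu h1 h2
    have h5 := norm_mul_phase_arg (z.1 j / z₀ j)
    have h6 : z₀ j = ‖z₀ j‖ * phase (φ.angle I u j) := lift_eq_norm_mul_phase u h1
    have h7 : (‖z₀ j‖ : ℂ) ≠ 0 := by exact_mod_cast (norm_pos_iff.2 h4).ne'
    rw [h3, phase_add]
    calc z.1 j = z.1 j / z₀ j * z₀ j := (div_mul_cancel₀ _ h4).symm
      _ = (‖z.1 j / z₀ j‖ * phase (Complex.arg (z.1 j / z₀ j) / (2 * Real.pi))) *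
          (‖z₀ j‖ * phase (φ.angle I u j)) := by rw [h5, ← h6]
      _ = _ := by
        rw [norm_div]
        push_cast
        field_simp

theorem isConnected_domain_empty (hν : ∀ k ∈ K, ν (X k) = lam k)
    (h : (openFace X lam K).Nonempty) : IsConnected (φ.domain ∅ ν lam) := by
  obtain ⟨w, hw, -⟩ := exists_mem_domain (φ := φ) (I := ∅) (by simp) hν (by simpa using h)
  exact ⟨⟨w, hw⟩, convex_domain_empty.isPreconnected⟩

/-- The set is the image of the convex domain for the empty index set under polar coordinates. -/
theorem isConnected_freeDomain (hI : I ⊆ φ.A) (hν : ∀ k ∈ K, ν (X k) = lam k)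
    (h : (openFace X lam K).Nonempty) :
    IsConnected (Subtype.val ⁻¹' (partialDomain φ I ∅ ν lam) : Set (φ.domain I ν lam)) := by
  have hp := isSmoothCovering_polar (ν := ν) (lam := lam) hI (Finset.empty_subset I)
  have hc := (isConnected_domain_empty (φ := φ) hν h).image (polar φ (I \ ∅)) fun w hw =>
    (hp.contDiffAt w hw).continuousAt.continuousWithinAt
  rw [hp.surjOn.image_eq_of_mapsTo hp.mapsTo] at hc
  refine hc.preimage_of_isOpenMap Subtype.val_injective isOpen_domain.isOpenMap_subtype_val ?_
  rintro w hw
  exact ⟨⟨w, hw.1⟩, rfl⟩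

theorem dense_freeDomain :
    Dense (Subtype.val ⁻¹' (partialDomain φ I ∅ ν lam) : Set (φ.domain I ν lam)) := by
  have h1 : Dense (Set.univ.pi fun a : φ.A => if (a : Fin d) ∈ I then ({0}ᶜ : Set ℂ)
      else Set.univ) := by
    refine dense_pi _ fun a _ => ?_
    split_ifs
    · exact dense_compl_singleton 0
    · exact dense_univ
  refine (h1.preimage (isOpen_domain (φ := φ) (I := I) (ν := ν) (lam := lam)).isOpenMap_subtype_val).mono
    fun w hw => ⟨w.2, fun a ha => ?_⟩
  have h2 := hw a (Set.mem_univ a)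
  simp only [if_pos (Finset.mem_sdiff.1 ha).1] at h2
  exact h2

variable (φ I ν lam) in
/-- The conditions under which a frame defines an orbit model for the subset `T` of `M`. -/
structure IsAdapted (T : Set (spaceM X lam Q)) : Prop where
  subset : I ⊆ φ.A
  base : ∀ k ∈ K, ν (X k) = lam k
  nonempty : (openFace X lam (I ∪ K)).Nonempty
  -- This yields points with no vanishing coordinate outside K, so that the free part of the model
  -- is nonempty.
  nonempty_K : (openFace X lam K).Nonempty
  mem : ∀ m, (∀ j ∉ I, j ∉ K → orbitNorm X lam Q j m ≠ 0) →
    (∀ k ∈ K, orbitNorm X lam Q k m = 0) → m ∈ T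
  vanish : ∀ m ∈ T, ∀ k ∈ K, orbitNorm X lam Q k m = 0

namespace IsAdapted

variable {T : Set (spaceM X lam Q)}

theorem mk_lift_mem (h : IsAdapted φ I ν lam T) (w : φ.domain I ν lam) :
    Quotient.mk (orbitSetoid X lam Q) ⟨_, lift_mem_zeroLevel h.subset h.base w.2⟩ ∈ T := by
  refine h.mem _ (fun j h1 h2 => ?_) fun k hk => ?_
  · rw [orbitNorm_mk]
    exact norm_ne_zero_iff.2 (lift_ne_zero w.2 h1 h2)
  · exact norm_eq_zero.2 (lift_of_mem_K h.subset h.base _ hk)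

/-- The chart map of the model. -/
def chartMap (h : IsAdapted φ I ν lam T) (w : φ.domain I ν lam) : T :=
  ⟨_, h.mk_lift_mem w⟩

theorem continuous_chartMap (h : IsAdapted φ I ν lam T) : Continuous h.chartMap := by
  refine Continuous.subtype_mk (continuous_quotient_mk'.comp ?_) _
  refine Continuous.subtype_mk ?_ _
  exact continuous_iff_continuousAt.2 fun w => ContinuousAt.comp (g := φ.lift I ν lam)
    (contDiffAt_lift h.subset h.base w.2).continuousAt continuous_subtype_val.continuousAt

theorem mem_range_chartMap (h : IsAdapted φ I ν lam T) (t : T) :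
    t ∈ Set.range h.chartMap ↔ ∀ j ∉ I, j ∉ K → orbitNorm X lam Q j t ≠ 0 := by
  constructor
  · rintro ⟨w, rfl⟩ j h1 h2
    exact norm_ne_zero_iff.2 (lift_ne_zero w.2 h1 h2)
  · obtain ⟨m, hm⟩ := t
    induction m using Quotient.inductionOn with | h z =>
    intro hne
    have hK : ∀ k ∈ K, z.1 k = 0 := fun k hk => norm_eq_zero.1 (h.vanish _ hm k hk)
    have hne' : ∀ j ∉ I, j ∉ K → z.1 j ≠ 0 := fun j h1 h2 => norm_ne_zero_iff.1 (hne j h1 h2)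
    exact ⟨⟨_, coords_mem_domain h.base (fun j => Complex.arg (z.1 j) / (2 * Real.pi))
      z.2 hK hne'⟩, Subtype.ext (mk_lift_coords h.subset h.base z hK hne'
      fun j _ _ => (norm_mul_phase_arg _).symm)⟩

/-- Near the lift of `u`, points of the zero level with the prescribed vanishing have model
coordinates close to `u`. Openness of the projection onto M carries this to the quotient. -/
theorem isOpenMap_chartMap (h : IsAdapted φ I ν lam T) : IsOpenMap h.chartMap := by
  rw [isOpenMap_iff_nhds_le]
  intro u W hW
  obtain ⟨τ, hτ, hτu, hτz⟩ := exists_local_coords (Q := Q) h.subset h.base u.2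
  have hW' : h.chartMap ⁻¹' W ∈ 𝓝 u := hW
  rw [nhds_subtype, Filter.mem_comap] at hW'
  obtain ⟨O, hO, hOW⟩ := hW'
  let z₀ : zeroLevel X lam := ⟨_, lift_mem_zeroLevel h.subset h.base u.2⟩
  have hS : {z : zeroLevel X lam | (∀ j, j ∉ I → j ∉ K → z.1 j ≠ 0) ∧ τ z.1 ∈ O} ∈ 𝓝 z₀ := by
    refine Filter.inter_mem ?_ ?_
    · have : ∀ᶠ z : zeroLevel X lam in 𝓝 z₀, ∀ j, j ∉ I → j ∉ K → z.1 j ≠ 0 := by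
        refine Filter.eventually_all.2 fun j => ?_
        by_cases hj : j ∉ I ∧ j ∉ K
        · have hc : ContinuousAt (fun z : zeroLevel X lam => z.1 j) z₀ :=
            ((continuous_apply j).comp continuous_subtype_val).continuousAt
          filter_upwards [hc.eventually_ne (lift_ne_zero u.2 hj.1 hj.2)] with z hz _ _ using hz
        · exact Filter.Eventually.of_forall fun z h1 h2 => absurd ⟨h1, h2⟩ hj
      exact this
    · have hc : ContinuousAt (fun z : zeroLevel X lam => τ z.1) z₀ :=
        ContinuousAt.comp (g := τ) hτ continuous_subtype_val.continuousAt
      refine hc.preimage_mem_nhds ?_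
      rw [hτu]
      exact hO
  have hM := isOpenMap_mk (Q := Q).image_mem_nhds hS
  rw [nhds_subtype, Filter.mem_comap]
  refine ⟨_, hM, ?_⟩
  rintro ⟨m, hm⟩ ⟨z, ⟨hz1, hz2⟩, hzm⟩
  simp only at hzm
  subst hzm
  obtain ⟨hd, hmk⟩ := hτz z (fun k hk => norm_eq_zero.1 (h.vanish _ hm k hk)) hz1
  have h1 : h.chartMap ⟨τ z.1, hd⟩ ∈ W := @hOW ⟨τ z.1, hd⟩ hz2
  have h2 : h.chartMap ⟨τ z.1, hd⟩ = ⟨_, hm⟩ := Subtype.ext hmk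
  rwa [h2] at h1

/-- Nonzero coordinates in I force the rotation phases to be 1, and the translations must vanish.
The permutation is then trivial, although `x` may have nonzero integers on I. -/
theorem rotHom_eq_one {w : φ.domain I ν lam} (hw : w.1 ∈ partialDomain φ I ∅ ν lam)
    {x : Fin d → ℝ} (hx : φ.rotHom I ν lam (Multiplicative.ofAdd x) w = w) :
    φ.rotHom I ν lam (Multiplicative.ofAdd x) = 1 := by
  refine Equiv.ext fun w' => Subtype.ext (funext fun a => ?_)
  have h1 := congrFun (congrArg Subtype.val hx) a
  rw [rotHom_apply, rot] at h1
  rw [rotHom_apply, rot, Equiv.Perm.one_apply]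
  split_ifs at h1 ⊢ with ha
  · have h2 := hw.2 a (by simpa using ha)
    rw [mul_eq_right₀ h2] at h1
    rw [h1, one_mul]
  · rw [add_eq_left] at h1
    rw [h1, add_zero]

/-- The orbit model defined by an adapted frame. -/
def model [Countable Q] (hXQ : ∀ j, X j ∈ Q) (h : IsAdapted φ I ν lam T) :
    OrbitModel (φ.A → ℂ) T where
  U := φ.domain I ν lam
  isOpen := isOpen_domain
  contractible := contractibleSpace_domain h.subset h.base h.nonempty
  H := φ.modelGroup I ν lam Q
  countable := by
    refine Function.Surjective.countable (α := Q) (f := fun v =>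
      ⟨φ.rotHom I ν lam (Multiplicative.ofAdd (φ.κ v)), mem_modelGroup.2 ⟨v, v.2, rfl⟩⟩) ?_
    rintro ⟨g, hg⟩
    obtain ⟨v, hv, rfl⟩ := mem_modelGroup.1 hg
    exact ⟨⟨v, hv⟩, rfl⟩
  smooth := by
    intro g hg
    obtain ⟨v, -, rfl⟩ := mem_modelGroup.1 hg
    exact ⟨φ.rot I (φ.κ v), (contDiff_rot _).contDiffOn, fun _ => rfl⟩
  D := Subtype.val ⁻¹' (partialDomain φ I ∅ ν lam)
  isConnected := isConnected_freeDomain h.subset h.base h.nonempty_K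
  dense := dense_freeDomain
  free := by
    intro w hw g hg
    obtain ⟨v, -, rfl⟩ := mem_modelGroup.1 hg
    exact rotHom_eq_one hw
  F := h.chartMap
  continuous := h.continuous_chartMap
  isOpenMap := h.isOpenMap_chartMap
  fiber := fun w w' => by
    rw [← mk_lift_eq_iff hXQ h.subset h.base w w', Subtype.ext_iff]
    rfl

variable [Countable Q] {hXQ : ∀ j, X j ∈ Q}

/-- The other chart covers the points whose coordinates outside I' ∪ K do not vanish. In the present
model this is a condition only on the coordinates in I \ I'. -/
theorem partOver_eq {φ' : Frame X K} {I' : Finset (Fin d)} (h : IsAdapted φ I ν lam T)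
    (h' : IsAdapted φ' I' ν lam T) : (h.model hXQ).partOver (Set.range (h'.model hXQ).F) =
      partialDomain φ I (I ∩ I') ν lam := by
  ext w
  constructor
  · rintro ⟨hw, hw'⟩
    refine ⟨hw, fun a ha => ?_⟩
    have h1 := (h'.mem_range_chartMap _).1 hw' a (fun h2 => ?_) (φ.notMem_K a.2)
    · have h3 : ‖φ.lift I ν lam w a‖ ≠ 0 := h1
      rwa [lift_of_mem (Finset.mem_sdiff.1 ha).1, zeroExtend_coe, norm_ne_zero_iff] at h3
    · have := Finset.mem_sdiff.1 ha
      exact this.2 (Finset.mem_inter.2 ⟨this.1, h2⟩)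
  · rintro ⟨hw, hw'⟩
    refine ⟨hw, (h'.mem_range_chartMap _).2 fun j h1 h2 => ?_⟩
    change ‖φ.lift I ν lam w j‖ ≠ 0
    rw [norm_ne_zero_iff]
    by_cases hj : j ∈ I
    · rw [lift_of_mem hj, zeroExtend_of_mem _ (h.subset hj)]
      exact hw' _ (by simp [hj, h1])
    · exact lift_ne_zero hw hj h2

theorem polar_changeFrame_mem_free {φ' : Frame X K} {I' : Finset (Fin d)} (hI : I ⊆ φ.A)
    (hI' : I' ⊆ I) (hIφ' : I' ⊆ φ'.A) (hν : ∀ k ∈ K, ν (X k) = lam k) {w : φ'.A → ℂ}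
    (hw : w ∈ partialDomain φ' I' ∅ ν lam) :
    (polar φ (I \ I') ∘ changeFrame φ φ' I' ν lam) w ∈ partialDomain φ I ∅ ν lam := by
  have h1 := (isSmoothCovering_polar_changeFrame (φ := φ) hI hI' hIφ' hν).mapsTo hw.1
  refine ⟨h1.1, fun a ha => ?_⟩
  by_cases ha' : (a : Fin d) ∈ I'
  · have h2 := lift_polar hI hI' (changeFrame_mem (φ := φ) hIφ' hν hw.1)
    have h3 := congrFun h2 a
    rw [lift_changeFrame (hI'.trans hI) hIφ' hν hw.1, lift_of_mem (hI' ha'), lift_of_mem ha',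
      zeroExtend_coe, zeroExtend_of_mem _ (hIφ' ha')] at h3
    rw [Function.comp_apply, h3]
    exact mul_ne_zero (phase_ne_zero _) (hw.2 ⟨a, hIφ' ha'⟩ (by simpa using ha'))
  · exact h1.2 a (by simp [ha', (Finset.mem_sdiff.1 ha).1])

/-- The charts of two adapted frames are compatible. -/
theorem compatible {k : ℕ} {φ' φ₀ : Frame X K} {I' : Finset (Fin d)}
    (h : IsAdapted φ I ν lam T) (h' : IsAdapted φ' I' ν lam T)
    (h₀ : IsAdapted φ₀ (I ∩ I') ν lam T)
    (e : (φ.A → ℂ) ≃L[ℝ] EuclideanSpace ℝ (Fin k))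
    (e' : (φ'.A → ℂ) ≃L[ℝ] EuclideanSpace ℝ (Fin k)) :
    ((h.model hXQ).toChart e).Compatible ((h'.model hXQ).toChart e') := by
  have := contractibleSpace_domain h₀.subset h₀.base h₀.nonempty
  have hi : I ∩ I' ⊆ I := Finset.inter_subset_left
  have hi' : I ∩ I' ⊆ I' := Finset.inter_subset_right
  -- The model for I ∩ I' unrolls exactly the coordinates that cannot vanish on the overlap, and its
  -- domain is contractible.
  refine OrbitModel.compatible_of_coverings _ _ e e' (Z := φ₀.domain (I ∩ I') ν lam)
    (SimplyConnectedSpace.ofContractible _)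
    (a := polar φ (I \ (I ∩ I')) ∘ changeFrame φ φ₀ (I ∩ I') ν lam)
    (b := polar φ' (I' \ (I ∩ I')) ∘ changeFrame φ' φ₀ (I ∩ I') ν lam) ?_ ?_
    (isConnected_freeDomain h₀.subset h₀.base h₀.nonempty_K) dense_freeDomain ?_ ?_ ?_
  · rw [partOver_eq]
    exact isSmoothCovering_polar_changeFrame h.subset hi h₀.subset h.base
  · rw [partOver_eq, Finset.inter_comm I' I]
    exact isSmoothCovering_polar_changeFrame h'.subset hi' h₀.subset h.base
  · intro w hw
    have := polar_changeFrame_mem_free h.subset hi h₀.subset h.base hw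
    exact ⟨this.1, this⟩
  · intro w hw
    have := polar_changeFrame_mem_free h'.subset hi' h₀.subset h.base hw
    exact ⟨this.1, this⟩
  · intro w hw hd hd'
    refine Subtype.ext ?_
    exact (mk_lift_polar_changeFrame h.subset hi h₀.subset h.base hw hd).trans
      (mk_lift_polar_changeFrame h'.subset hi' h₀.subset h.base hw hd').symm

/-- The lift of the chart map is an immersion transverse to the orbits. -/
theorem exists_lift {k : ℕ} (h : IsAdapted φ I ν lam T)
    (e : (φ.A → ℂ) ≃L[ℝ] EuclideanSpace ℝ (Fin k)) :
    ∃ σ : EuclideanSpace ℝ (Fin k) → (Fin d → ℂ),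
      ContDiffOn ℝ ∞ σ ((h.model hXQ).toChart e).U ∧
      ∀ x : ((h.model hXQ).toChart e).U,
        (∃ h' : σ x ∈ zeroLevel X lam, (Quotient.mk (orbitSetoid X lam Q) ⟨σ x, h'⟩) =
          (((h.model hXQ).toChart e).toSpace x : spaceM X lam Q)) ∧
        ∀ v : EuclideanSpace ℝ (Fin k),
          (∃ y ∈ lieN X, ∀ j, fderiv ℝ σ x v j = Complex.I * (y j : ℂ) * σ x j) → v = 0 := by
  have hdiff : ∀ x ∈ e.symm ⁻¹' (φ.domain I ν lam),
      ContDiffAt ℝ ∞ (φ.lift I ν lam) (e.symm x) := fun x hx =>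
    contDiffAt_lift h.subset h.base hx
  refine ⟨φ.lift I ν lam ∘ e.symm, fun x hx => ?_, fun x => ⟨⟨?_, rfl⟩, ?_⟩⟩
  · exact ((hdiff x hx).comp x e.symm.contDiff.contDiffAt).contDiffWithinAt
  · exact lift_mem_zeroLevel h.subset h.base x.2
  · rintro v ⟨y, hy, hv⟩
    have h1 : fderiv ℝ (φ.lift I ν lam ∘ e.symm) x v =
        fderiv ℝ (φ.lift I ν lam) (e.symm x) (e.symm v) := by
      rw [fderiv_comp _ ((hdiff x x.2).differentiableAt (by simp))
        e.symm.differentiableAt, e.symm.fderiv]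
      rfl
    rw [h1] at hv
    have := eq_zero_of_tangent h.subset h.base x.2 hy hv
    simpa using this

end IsAdapted

end Frame

/-! ### Existence of frames -/

section LinearAlgebra

variable {V : Type*} [NormedAddCommGroup V] [NormedSpace ℝ V] [FiniteDimensional ℝ V] {d : ℕ}
  {X : Fin d → V}

/-- Vectors that are independent modulo the span of the `X k`, `k ∈ K`, extend to a frame. -/
theorem exists_frame (hX : Submodule.span ℝ (Set.range X) = ⊤) (K I : Finset (Fin d))
    (hI : LinearIndepOn ℝ (fun j => (Submodule.span ℝ (X '' (K : Set (Fin d)))).mkQ (X j))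
      (I : Set (Fin d))) :
    ∃ φ : Frame X K, I ⊆ φ.A ∧ φ.A.card +
      Module.finrank ℝ (Submodule.span ℝ (X '' (K : Set (Fin d)))) = Module.finrank ℝ V := by
  classical
  set S := Submodule.span ℝ (X '' (K : Set (Fin d))) with hS
  set v : Fin d → V ⧸ S := fun j => S.mkQ (X j) with hv
  -- The images of all X j span the quotient, so I extends to a basis chosen among them.
  obtain ⟨B, -, hIB, hspan, hB⟩ := exists_linearIndepOn_extension hI (Set.subset_univ _)
  have htop : ⊤ ≤ Submodule.span ℝ (Set.range fun j : B => v j) := by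
    have h1 : Submodule.span ℝ (v '' Set.univ) = ⊤ := by
      rw [Set.image_univ, show v = S.mkQ ∘ X from rfl, Set.range_comp, Submodule.span_image, hX,
        Submodule.map_top, Submodule.range_mkQ]
    rw [← h1, Submodule.span_le, ← Set.image_eq_range]
    exact hspan
  let b := Module.Basis.mk hB htop
  have hb : ∀ j : B, b j = v j := fun j => Module.Basis.mk_apply hB htop j
  let κ : V →ₗ[ℝ] (Fin d → ℝ) :=
    LinearMap.pi fun j => if h : j ∈ B then (b.coord ⟨j, h⟩) ∘ₗ S.mkQ else 0
  have hκ : ∀ w (j : B), κ w j = b.repr (S.mkQ w) j := fun w j => by simp [κ]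
  have hκ' : ∀ w, ∀ j ∉ B, κ w j = 0 := fun w j hj => by simp [κ, hj]
  refine ⟨⟨B.toFinset, κ, ?_, ?_, ?_, ?_⟩, ?_, ?_⟩
  · intro a ha
    have ha' : a ∈ B := by simpa using ha
    funext j
    by_cases hj : j ∈ B
    · have h1 := hκ (X a) ⟨j, hj⟩
      have h2 : S.mkQ (X a) = b ⟨a, ha'⟩ := (hb ⟨a, ha'⟩).symm
      rw [h2, b.repr_self, Finsupp.single_apply] at h1
      rw [h1, Pi.single_apply]
      simp [eq_comm]
    · rw [hκ' _ j hj, Pi.single_eq_of_ne]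
      rintro rfl
      exact hj ha'
  · intro k hk
    have h1 : S.mkQ (X k) = 0 := by
      rw [Submodule.mkQ_apply, Submodule.Quotient.mk_eq_zero]
      exact Submodule.subset_span ⟨k, hk, rfl⟩
    funext j
    by_cases hj : j ∈ B
    · rw [hκ (X k) ⟨j, hj⟩, h1]
      simp
    · rw [hκ' _ j hj, Pi.zero_apply]
  · intro w j hj
    exact hκ' w j (by simpa using hj)
  · intro w
    rw [← hS, ← Submodule.Quotient.mk_eq_zero, ← Submodule.mkQ_apply, map_sub, sub_eq_zero,
      piMap_apply, map_sum]
    have h1 : ∑ j, S.mkQ (κ w j • X j) = ∑ j : B, S.mkQ (κ w j • X j) := by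
      rw [← Finset.sum_subset (Finset.subset_univ B.toFinset)]
      · exact Finset.sum_subtype B.toFinset (fun j => by simp) fun j => S.mkQ (κ w j • X j)
      · intro j _ hj
        rw [hκ' w j (by simpa using hj), zero_smul, map_zero]
    rw [h1]
    conv_lhs => rw [← b.sum_repr (S.mkQ w)]
    refine Finset.sum_congr rfl fun j _ => ?_
    rw [map_smul, hκ, hb]
  · intro i hi
    simpa using hIB hi
  · rw [← Submodule.finrank_quotient_add_finrank S, Module.finrank_eq_card_basis b,
      Set.toFinset_card]

end LinearAlgebra

/-! ### Faces of the polytope -/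

section Polytope

variable {V : Type*} [NormedAddCommGroup V] [NormedSpace ℝ V] {d : ℕ}
  {X : Fin d → V} {lam : Fin d → ℝ}

/-- Strict inequalities persist for small t, and the equalities in I are kept or released according
to the values of δ. -/
theorem eventually_add_smul_mem_openFace {I I' : Finset (Fin d)} {μ δ : StrongDual ℝ V}
    (hμ : μ ∈ openFace X lam I) (hI' : I' ⊆ I) (h0 : ∀ i ∈ I', δ (X i) = 0)
    (hpos : ∀ i ∈ I, i ∉ I' → 0 < δ (X i)) :
    ∀ᶠ t : ℝ in 𝓝[>] 0, μ + t • δ ∈ openFace X lam I' := by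
  have h1 : ∀ᶠ t : ℝ in 𝓝[>] 0, ∀ j, j ∉ I → lam j < (μ + t • δ) (X j) := by
    refine nhdsWithin_le_nhds (Filter.eventually_all.2 fun j => ?_)
    by_cases hj : j ∈ I
    · exact Filter.Eventually.of_forall fun t h => absurd hj h
    · have hlt : lam j < μ (X j) :=
        lt_of_le_of_ne (Set.mem_iInter.1 hμ.1 j) fun h => hj ((hμ.2 j).1 h.symm)
      have hc : ContinuousAt (fun t : ℝ => μ (X j) + t * δ (X j)) 0 := by fun_prop
      have := hc.eventually_const_lt (u := lam j) (by simpa using hlt)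
      filter_upwards [this] with t ht _ using by simpa using ht
  filter_upwards [h1, self_mem_nhdsWithin] with t ht ht0
  have ht0' : 0 < t := ht0
  have hval : ∀ j, lam j ≤ (μ + t • δ) (X j) ∧ ((μ + t • δ) (X j) = lam j ↔ j ∈ I') := by
    intro j
    by_cases hj : j ∈ I
    · have h2 : (μ + t • δ) (X j) = lam j + t * δ (X j) := by
        simp [(hμ.2 j).2 hj]
      by_cases hj' : j ∈ I'
      · simp [h2, h0 j hj', hj']
      · have := mul_pos ht0' (hpos j hj hj')
        exact ⟨by linarith, iff_of_false (by linarith) hj'⟩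
    · exact ⟨(ht j hj).le, iff_of_false (ht j hj).ne' fun h => hj (hI' h)⟩
  exact ⟨Set.mem_iInter.2 fun j => (hval j).1, fun j => (hval j).2⟩

/-- A face is contained in the closure of another one if its index set contains
the index set of the other one. -/
theorem Face.le_iff {F G : Face X lam} : F ≤ G ↔ G.I ⊆ F.I := by
  refine ⟨Face.index_subset, fun h μ hμ => ?_⟩
  obtain ⟨ρ, hρ⟩ := G.nonempty
  have h1 := eventually_add_smul_mem_openFace (δ := ρ - μ) hμ h (fun i hi => by
      rw [sub_apply, (hρ.2 i).2 hi, (hμ.2 i).2 (h hi), sub_self]) (fun i hi hi' => by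
      rw [sub_apply, (hμ.2 i).2 hi, sub_pos]
      exact lt_of_le_of_ne (Set.mem_iInter.1 hρ.1 i) fun h => hi' ((hρ.2 i).1 h.symm))
  have h2 : Filter.Tendsto (fun t : ℝ => μ + t • (ρ - μ)) (𝓝[>] 0) (𝓝 μ) := by
    have : ContinuousAt (fun t : ℝ => μ + t • (ρ - μ)) 0 := by fun_prop
    have := this.tendsto
    simp only [zero_smul, add_zero] at this
    exact this.mono_left nhdsWithin_le_nhds
  exact mem_closure_of_tendsto h2 h1

/-- Independence provides a functional that is 0 on the X i, i ∈ I', and 1 on those with i ∈ I \ I'.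
Moving along it releases exactly the latter equalities. -/
theorem openFace_nonempty_of_subset [FiniteDimensional ℝ V] {I I' : Finset (Fin d)}
    (hI : LinearIndepOn ℝ X (I : Set (Fin d))) (hI' : I' ⊆ I)
    (h : (openFace X lam I).Nonempty) : (openFace X lam I').Nonempty := by
  obtain ⟨μ, hμ⟩ := h
  let c : Fin d → ℝ := fun i => if i ∈ I' then 0 else 1
  obtain ⟨δ, hδ⟩ : ∃ δ : V →ₗ[ℝ] ℝ, ∀ i ∈ I, δ (X i) = c i := by
    let b := Module.Basis.span hI
    obtain ⟨δ, hδ⟩ := LinearMap.exists_extend (b.constr ℝ fun i => c i)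
    refine ⟨δ, fun i hi => ?_⟩
    have h1 := b.constr_basis ℝ (fun i : (I : Set (Fin d)) => c i) ⟨i, hi⟩
    rw [← h1, ← hδ, LinearMap.comp_apply]
    congr 1
    exact congrArg Subtype.val (Module.Basis.span_apply hI ⟨i, hi⟩).symm
  obtain ⟨t, ht⟩ := (eventually_add_smul_mem_openFace
    (δ := LinearMap.toContinuousLinearMap δ) hμ hI'
    (fun i hi => by simp [hδ i (hI' hi), c, hi])
    (fun i hi hi' => by simp [hδ i hi, c, hi'])).exists
  exact ⟨_, ht⟩

/-- The directions of the face are the functionals that annihilate the X i, i ∈ I_F, because a short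
step along such a functional stays in the open face. -/
theorem Face.finrank_span_add_dim [FiniteDimensional ℝ V] (F : Face X lam) :
    Module.finrank ℝ (Submodule.span ℝ (X '' (F.I : Set (Fin d)))) + F.dim =
      Module.finrank ℝ V := by
  set S := Submodule.span ℝ (X '' (F.I : Set (Fin d)))
  have h1 : vectorSpan ℝ F.carrier = S.dualAnnihilator.map
      (LinearMap.toContinuousLinearMap : (V →ₗ[ℝ] ℝ) ≃ₗ[ℝ] (V →L[ℝ] ℝ)).toLinearMap := by
    apply le_antisymm
    · rw [vectorSpan, Submodule.span_le]
      rintro _ ⟨μ, hμ, ρ, hρ, rfl⟩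
      refine ⟨((μ - ρ : StrongDual ℝ V) : V →ₗ[ℝ] ℝ), ?_, by ext; rfl⟩
      rw [SetLike.mem_coe, Submodule.mem_dualAnnihilator]
      intro v hv
      have : S ≤ LinearMap.ker ((μ - ρ : StrongDual ℝ V) : V →ₗ[ℝ] ℝ) := by
        rw [Submodule.span_le]
        rintro _ ⟨i, hi, rfl⟩
        simp [(hμ.2 i).2 hi, (hρ.2 i).2 hi]
      exact this hv
    · rintro _ ⟨δ, hδ, rfl⟩
      rw [SetLike.mem_coe, Submodule.mem_dualAnnihilator] at hδ
      obtain ⟨μ, hμ⟩ := F.nonempty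
      obtain ⟨t, ht, ht0⟩ := ((eventually_add_smul_mem_openFace
        (δ := LinearMap.toContinuousLinearMap δ) hμ subset_rfl
        (fun i hi => hδ _ (Submodule.subset_span ⟨i, hi, rfl⟩))
        (fun i hi hi' => absurd hi hi')).and self_mem_nhdsWithin).exists
      have h2 : t • (LinearMap.toContinuousLinearMap δ) ∈ vectorSpan ℝ F.carrier := by
        have := vsub_mem_vectorSpan ℝ (s := F.carrier) ht hμ
        simpa using this
      have ht0' : t ≠ 0 := ne_of_gt ht0
      exact (Submodule.smul_mem_iff _ ht0').1 h2
  have h2 := Subspace.finrank_add_finrank_dualAnnihilator_eq S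
  rw [← h2, Face.dim, affineDim, h1, LinearEquiv.finrank_map_eq]

/-- By the dimension formula, singular means that I_F has more elements than the rank of its
vectors. The gain is a condition inherited by subsets. -/
theorem Face.not_isSingular_iff [FiniteDimensional ℝ V] (F : Face X lam) :
    ¬ F.IsSingular ↔ LinearIndepOn ℝ X (F.I : Set (Fin d)) := by
  have h1 := F.finrank_span_add_dim
  have h2 : Module.finrank ℝ (Submodule.span ℝ (X '' (F.I : Set (Fin d)))) ≤ F.I.card := by
    classical
    have := finrank_span_finset_le_card (R := ℝ) (F.I.image X)
    rw [Finset.coe_image] at this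
    exact this.trans Finset.card_image_le
  rw [Face.IsSingular, LinearIndepOn, linearIndependent_iff_card_eq_finrank_span,
    Set.finrank, ← Set.image_eq_range]
  simp only [Finset.coe_sort_coe, Fintype.card_coe]
  omega

theorem linearIndepOn_mkQ_span_empty {I : Set (Fin d)} (h : LinearIndepOn ℝ X I) :
    LinearIndepOn ℝ (fun j => (Submodule.span ℝ
      (X '' ((∅ : Finset (Fin d)) : Set (Fin d)))).mkQ (X j)) I := by
  refine LinearIndependent.map' h _ ?_
  rw [Submodule.ker_mkQ]
  simp

theorem isBounded_of_isConvexPolytope {Δ : Set (StrongDual ℝ V)} (h : IsConvexPolytope Δ) :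
    Bornology.IsBounded Δ := by
  obtain ⟨s, hs, -, rfl⟩ := h
  exact isBounded_convexHull.2 hs.isBounded

/-- A nonzero functional that kills all X j would be the direction of a line contained in the
polytope. -/
theorem span_range_eq_top [FiniteDimensional ℝ V] (hne : (halfSpaceInter X lam).Nonempty)
    (hb : Bornology.IsBounded (halfSpaceInter X lam)) :
    Submodule.span ℝ (Set.range X) = ⊤ := by
  by_contra hlt
  obtain ⟨f, hf0, hf⟩ := Submodule.exists_le_ker_of_lt_top _ (lt_top_iff_ne_top.2 hlt)
  obtain ⟨μ, hμ⟩ := hne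
  obtain ⟨v, hv⟩ : ∃ v, f v ≠ 0 := by
    by_contra! h
    exact hf0 (LinearMap.ext h)
  obtain ⟨C, hC⟩ := hb.exists_norm_le
  let g : StrongDual ℝ V := LinearMap.toContinuousLinearMap f
  have h1 : ∀ t : ℝ, μ + t • g ∈ halfSpaceInter X lam := by
    refine fun t => Set.mem_iInter.2 fun j => ?_
    have h2 : f (X j) = 0 := hf (Submodule.subset_span ⟨j, rfl⟩)
    have h3 : lam j ≤ μ (X j) := Set.mem_iInter.1 hμ j
    simpa [g, h2] using h3
  have h2 : ∀ t : ℝ, μ v + t * f v ≤ C * ‖v‖ := fun t => by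
    have h3 := ((μ + t • g).le_opNorm v).trans
      (mul_le_mul_of_nonneg_right (hC _ (h1 t)) (norm_nonneg v))
    have h4 := (le_abs_self _).trans h3
    simpa [g] using h4
  have h3 := h2 ((C * ‖v‖ - μ v + 1) / f v)
  rw [div_mul_cancel₀ _ hv] at h3
  linarith

/-- Evaluation at a nonzero vector is open and surjective, so the interior of each half-space is
given by the strict inequality. -/
theorem openFace_empty_eq_interior (hX : ∀ j, X j ≠ 0) :
    openFace X lam ∅ = interior (halfSpaceInter X lam) := by
  have h1 : ∀ j, interior {μ : StrongDual ℝ V | lam j ≤ μ (X j)} = {μ | lam j < μ (X j)} := by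
    intro j
    let ev := ContinuousLinearMap.apply ℝ ℝ (X j)
    have hs : Function.Surjective ev := by
      obtain ⟨f, hf⟩ := SeparatingDual.exists_eq_one (R := ℝ) (hX j)
      exact fun r => ⟨r • f, by simp [ev, hf]⟩
    have h2 := (ev.isOpenMap hs).preimage_interior_eq_interior_preimage ev.continuous
      (Set.Ici (lam j))
    rw [interior_Ici] at h2
    exact h2.symm
  rw [halfSpaceInter, interior_iInter_of_finite]
  simp only [h1]
  ext μ
  simp only [openFace, halfSpaceInter, Set.mem_ofPred_eq, Set.mem_iInter, Finset.notMem_empty,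
    iff_false]
  exact ⟨fun h j => lt_of_le_of_ne (h.1 j) (Ne.symm (h.2 j)),
    fun h => ⟨fun j => (h j).le, fun j => (h j).ne'⟩⟩

theorem interior_nonempty_of_affineDim [FiniteDimensional ℝ V] {Δ : Set (StrongDual ℝ V)}
    (hΔ : IsConvexPolytope Δ) (hdim : affineDim Δ = Module.finrank ℝ V) :
    (interior Δ).Nonempty := by
  obtain ⟨s, -, hne, rfl⟩ := hΔ
  rw [interior_convexHull_nonempty_iff_affineSpan_eq_top,
    ← affineSpan_convexHull (𝕜 := ℝ), AffineSubspace.affineSpan_eq_top_iff_vectorSpan_eq_top_of_nonempty ℝ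
      (StrongDual ℝ V) (StrongDual ℝ V) hne.convexHull]
  refine Submodule.eq_top_of_finrank_eq ?_
  rw [affineDim] at hdim
  rw [hdim, ← (LinearMap.toContinuousLinearMap : (V →ₗ[ℝ] ℝ) ≃ₗ[ℝ] (V →L[ℝ] ℝ)).finrank_eq]
  exact Subspace.dual_finrank_eq.symm

end Polytope

/-! ### Atlases and topology of the pieces -/

section Pieces

variable {V : Type*} [NormedAddCommGroup V] [NormedSpace ℝ V] {d : ℕ}
  {X : Fin d → V} {lam : Fin d → ℝ} {Q : AddSubgroup V}

theorem countable_of_isQuasilattice (hQ : IsQuasilattice Q) : Countable Q := by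
  have : AddGroup.FG Q := (AddGroup.fg_iff_addSubgroup_fg Q).2 hQ.1
  have : Module.Finite ℤ Q := Module.Finite.iff_addGroup_fg.2 this
  obtain ⟨n, f, hf⟩ := Module.Finite.exists_fin' ℤ Q
  exact hf.countable

/-- A real linear identification of `ℂᵃ` with `ℝ²ᵃ`. -/
theorem exists_continuousLinearEquiv (A : Finset (Fin d)) {k : ℕ} (h : k = 2 * A.card) :
    Nonempty ((A → ℂ) ≃L[ℝ] EuclideanSpace ℝ (Fin k)) := by
  refine ⟨ContinuousLinearEquiv.ofFinrankEq ?_⟩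
  rw [Module.finrank_pi_fintype]
  simp [Complex.finrank_real_complex, h, mul_comm]

theorem stratum_disjoint {I I' : Finset (Fin d)} (h : I ≠ I') :
    Disjoint (stratum X lam Q I) (stratum X lam Q I') :=
  Set.disjoint_left.2 fun _ hm hm' => h (Finset.ext fun j => (hm j).symm.trans (hm' j))

variable [FiniteDimensional ℝ V]

/-- The piece of a singular face is covered by one chart. -/
theorem exists_atlas_facePiece (hX : Submodule.span ℝ (Set.range X) = ⊤)
    (hXQ : ∀ j, X j ∈ Q) (hQ : Countable Q) (F : Face X lam) :
    ∃ A : QuasifoldAtlas (2 * F.dim) (facePiece X lam Q F), A.IsInduced := by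
  -- With K = I_F no coordinate outside K vanishes on the piece, so all coordinates over A are
  -- unrolled. The set A has dim F elements.
  obtain ⟨φ, -, hφ⟩ := exists_frame hX F.I ∅ (by simp)
  obtain ⟨ν, hν⟩ := F.nonempty
  have hT : facePiece X lam Q F = stratum X lam Q F.I := facePiece_eq_stratum hX F
  have had : Frame.IsAdapted φ ∅ ν lam (facePiece X lam Q F) :=
    { subset := by simp
      base := fun k hk => (hν.2 k).2 hk
      nonempty := by simpa using F.nonempty
      nonempty_K := F.nonempty
      mem := fun m h1 h2 => by
        rw [hT]
        exact fun j => ⟨fun h => by_contra fun hj => h1 j (by simp) hj h, h2 j⟩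
      vanish := fun m hm k hk => by
        rw [hT] at hm
        exact (hm k).2 hk }
  obtain ⟨e⟩ := exists_continuousLinearEquiv φ.A (k := 2 * F.dim) (by
    have := F.finrank_span_add_dim
    omega)
  refine ⟨⟨{(had.model hXQ).toChart e}, ?_, fun t => ⟨_, rfl, ?_⟩⟩, ?_⟩
  · rintro _ rfl _ rfl
    exact had.compatible had (by simpa using had) e e
  · rw [OrbitModel.toChart_source]
    refine (had.mem_range_chartMap t).2 fun j _ hj h => hj ?_
    exact (hT.le t.2 j).1 h
  · rintro _ rfl
    exact had.exists_lift e

theorem mem_regularPiece_iff (hX : Submodule.span ℝ (Set.range X) = ⊤) (m : spaceM X lam Q) :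
    m ∈ regularPiece X lam Q ↔
      ∃ I : Finset (Fin d), LinearIndepOn ℝ X (I : Set (Fin d)) ∧ m ∈ stratum X lam Q I := by
  simp only [regularPiece, Set.mem_iUnion, facePiece_eq_stratum hX, Face.not_isSingular_iff,
    exists_prop]
  exact ⟨fun ⟨F, h⟩ => ⟨F.I, h⟩, fun ⟨I, h1, h2⟩ =>
    ⟨⟨I, openFace_nonempty_of_mem_stratum h2⟩, h1, h2⟩⟩

/-- The vanishing coordinates form a subset of I, and subsets of an independent family are
independent. -/
theorem mem_regularPiece_of_ne_zero (hX : Submodule.span ℝ (Set.range X) = ⊤)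
    {I : Finset (Fin d)} (hI : LinearIndepOn ℝ X (I : Set (Fin d))) {m : spaceM X lam Q}
    (h : ∀ j ∉ I, orbitNorm X lam Q j m ≠ 0) : m ∈ regularPiece X lam Q := by
  obtain ⟨I', hI'⟩ := exists_mem_stratum m
  refine (mem_regularPiece_iff hX m).2 ⟨I', hI.mono fun j hj => ?_, hI'⟩
  by_contra hj'
  exact h j hj' ((hI' j).2 hj)

/-- With K empty the radii over A alone determine the functional, so the base ν is immaterial. The
common choice 0 lets all charts be compared by `IsAdapted.compatible`. -/
theorem isAdapted_regularPiece (hX : Submodule.span ℝ (Set.range X) = ⊤) {I : Finset (Fin d)}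
    (hI : LinearIndepOn ℝ X (I : Set (Fin d))) (hne : (openFace X lam I).Nonempty)
    {φ : Frame X ∅} (hφ : I ⊆ φ.A) : Frame.IsAdapted φ I 0 lam (regularPiece X lam Q) where
  subset := hφ
  base := by simp
  nonempty := by simpa using hne
  nonempty_K := openFace_nonempty_of_subset hI (Finset.empty_subset I) hne
  mem := fun _ h _ => mem_regularPiece_of_ne_zero hX hI fun j hj => h j hj (by simp)
  vanish := by simp

/-- The regular piece is covered by charts that belong to the nonsingular faces. -/
theorem exists_atlas_regularPiece (hX : Submodule.span ℝ (Set.range X) = ⊤)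
    (hXQ : ∀ j, X j ∈ Q) (hQ : Countable Q) :
    ∃ A : QuasifoldAtlas (2 * Module.finrank ℝ V) (regularPiece X lam Q), A.IsInduced := by
  let charts : Set (QuasifoldChart (2 * Module.finrank ℝ V) (regularPiece X lam Q)) :=
    {c | ∃ (I : Finset (Fin d)) (_ : LinearIndepOn ℝ X (I : Set (Fin d)))
      (_ : (openFace X lam I).Nonempty) (φ : Frame X ∅)
      (h : Frame.IsAdapted φ I 0 lam (regularPiece X lam Q))
      (e : (φ.A → ℂ) ≃L[ℝ] EuclideanSpace ℝ (Fin (2 * Module.finrank ℝ V))),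
      c = (h.model hXQ).toChart e}
  refine ⟨⟨charts, ?_, fun t => ?_⟩, ?_⟩
  · rintro _ ⟨I, hI, hne, φ, h, e, rfl⟩ _ ⟨I', hI', hne', φ', h', e', rfl⟩
    -- The universal cover of the overlap is the model of I ∩ I' in a third frame, since neither of
    -- the given frames is preferred.
    have hI₀ : LinearIndepOn ℝ X ((I ∩ I' : Finset (Fin d)) : Set (Fin d)) :=
      hI.mono (by simp)
    obtain ⟨φ₀, hφ₀, -⟩ := exists_frame hX ∅ (I ∩ I') (linearIndepOn_mkQ_span_empty hI₀)
    exact h.compatible h' (isAdapted_regularPiece hX hI₀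
      (openFace_nonempty_of_subset hI Finset.inter_subset_left hne) hφ₀) e e'
  · obtain ⟨I, hI, ht⟩ := (mem_regularPiece_iff hX t.1).1 t.2
    have hne := openFace_nonempty_of_mem_stratum ht
    obtain ⟨φ, hφ, hcard⟩ := exists_frame hX ∅ I (linearIndepOn_mkQ_span_empty hI)
    have had := isAdapted_regularPiece (Q := Q) hX hI hne hφ
    obtain ⟨e⟩ := exists_continuousLinearEquiv φ.A (k := 2 * Module.finrank ℝ V) (by
      rw [← hcard]
      simp)
    refine ⟨_, ⟨I, hI, hne, φ, had, e, rfl⟩, ?_⟩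
    rw [OrbitModel.toChart_source]
    exact (had.mem_range_chartMap t).2 fun j hj _ h => hj ((ht j).1 h)
  · rintro _ ⟨I, hI, hne, φ, h, e, rfl⟩
    exact h.exists_lift e

/-- The stratum is the image of a convex model domain. The face may be nonsingular; the interior is
needed for the regular piece. -/
theorem isConnected_stratum (hX : Submodule.span ℝ (Set.range X) = ⊤) (F : Face X lam) :
    IsConnected (stratum X lam Q F.I) := by
  obtain ⟨φ, -, -⟩ := exists_frame hX F.I ∅ (by simp)
  obtain ⟨ν, hν⟩ := F.nonempty
  have had : Frame.IsAdapted φ ∅ ν lam (stratum X lam Q F.I) :=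
    { subset := by simp
      base := fun k hk => (hν.2 k).2 hk
      nonempty := by simpa using F.nonempty
      nonempty_K := F.nonempty
      mem := fun m h1 h2 j =>
        ⟨fun h => by_contra fun hj => h1 j (by simp) hj h, h2 j⟩
      vanish := fun m hm k hk => (hm k).2 hk }
  have h1 := Frame.isConnected_domain_empty (φ := φ) had.base F.nonempty
  have : ConnectedSpace (φ.domain ∅ ν lam) := isConnected_iff_connectedSpace.1 h1
  have h2 := isConnected_range (continuous_subtype_val.comp had.continuous_chartMap)
  convert h2 using 1
  ext m
  constructor
  · intro hm
    obtain ⟨w, hw⟩ := (had.mem_range_chartMap ⟨m, hm⟩).2 fun j _ hj h => hj ((hm j).1 h)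
    exact ⟨w, congrArg Subtype.val hw⟩
  · rintro ⟨w, rfl⟩
    exact (had.chartMap w).2

theorem isOpen_regularPiece (hX : Submodule.span ℝ (Set.range X) = ⊤) :
    IsOpen (regularPiece X lam Q) := by
  rw [isOpen_iff_mem_nhds]
  intro m hm
  obtain ⟨I, hI, hmI⟩ := (mem_regularPiece_iff hX m).1 hm
  have h1 : ∀ᶠ m' in 𝓝 m, ∀ j ∉ I, orbitNorm X lam Q j m' ≠ 0 := by
    refine Filter.eventually_all.2 fun j => ?_
    by_cases hj : j ∈ I
    · exact Filter.Eventually.of_forall fun _ h => absurd hj h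
    · have h2 : orbitNorm X lam Q j m ≠ 0 := fun h => hj ((hmI j).1 h)
      filter_upwards [(continuous_orbitNorm j).continuousAt.eventually_ne h2] with m' h _ using h
  filter_upwards [h1] with m' h using mem_regularPiece_of_ne_zero hX hI h

theorem dense_stratum_empty (hne : (openFace X lam ∅).Nonempty) :
    Dense (stratum X lam Q ∅) := fun _ => mem_closure_stratum hne (by simp)

end Pieces

end

/-! ### Assembling the decomposition -/

theorem theorem3p1 {V : Type*} [NormedAddCommGroup V] [NormedSpace ℝ V] [FiniteDimensional ℝ V]
    (n : ℕ) (hn : Module.finrank ℝ V = n)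
    (Δ : Set (StrongDual ℝ V)) (hΔ : IsConvexPolytope Δ) (hdim : affineDim Δ = n)
    {d : ℕ} (X : Fin d → V) (hX : ∀ j, X j ≠ 0) (lam : Fin d → ℝ)
    (hrep : Δ = halfSpaceInter X lam)
    (Q : AddSubgroup V) (hQ : IsQuasilattice Q) (hXQ : ∀ j, X j ∈ Q) :
    (∀ (p : ℕ) (F : Face X lam), F.dim = p → F.IsSingular →
      ∃ A : QuasifoldAtlas (2 * p) (facePiece X lam Q F), A.IsInduced) ∧
    (∃ A : QuasifoldAtlas (2 * n) (regularPiece X lam Q), A.IsInduced) ∧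
    IsDecompositionByQuasifolds (spaceM X lam Q) (piece X lam Q) (fun F => 2 * F.1.dim) (2 * n) := by
  subst hn hrep
  have hb := isBounded_of_isConvexPolytope hΔ
  have hint : (openFace X lam ∅).Nonempty := by
    rw [openFace_empty_eq_interior hX]
    exact interior_nonempty_of_affineDim hΔ hdim
  have hspan : Submodule.span ℝ (Set.range X) = ⊤ :=
    span_range_eq_top (hint.mono fun _ h => h.1) hb
  have hcount := countable_of_isQuasilattice hQ
  have hface := fun F : Face X lam => exists_atlas_facePiece (Q := Q) hspan hXQ hcount F
  have hreg := exists_atlas_regularPiece (lam := lam) hspan hXQ hcount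
  refine ⟨fun p F hF _ => hF ▸ hface F, hreg, ?_⟩
  have hI : ∀ F : Face X lam, F.carrier = interior (halfSpaceInter X lam) ↔ F.I = ∅ := by
    intro F
    rw [← openFace_empty_eq_interior hX]
    constructor
    · intro h
      obtain ⟨μ, hμ⟩ := F.nonempty
      have hμ' : μ ∈ openFace X lam ∅ := h ▸ hμ
      exact Finset.ext fun j => (hμ.2 j).symm.trans (hμ'.2 j)
    · intro h
      rw [Face.carrier, h]
  have hdim_empty : ∀ F : Face X lam, F.I = ∅ → F.dim = Module.finrank ℝ V := by
    intro F hF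
    have h := F.finrank_span_add_dim
    rwa [hF, Finset.coe_empty, Set.image_empty, Submodule.span_empty, finrank_bot,
      zero_add] at h
  have hns : ∀ F : Face X lam, F.I = ∅ → ¬ F.IsSingular := by
    intro F hF
    rw [Face.not_isSingular_iff, hF]
    simp
  have hsing : ∀ F : PieceIndex X lam, F.1.IsSingular →
      piece X lam Q F = stratum X lam Q F.1.I := fun F hF => by
    rw [piece, if_pos hF, facePiece_eq_stratum hspan]
  have hnsing : ∀ F : PieceIndex X lam, ¬ F.1.IsSingular →
      piece X lam Q F = regularPiece X lam Q := fun F hF => by rw [piece, if_neg hF]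
  -- The only nonsingular label is the interior, although nonsingular proper faces contribute to its
  -- piece.
  have hempty : ∀ F : PieceIndex X lam, ¬ F.1.IsSingular → F.1.I = ∅ := fun F hF =>
    (hI F.1).1 (F.2.resolve_left hF)
  have hsub : ∀ {m : spaceM X lam Q}, m ∈ stratum X lam Q ∅ → m ∈ regularPiece X lam Q :=
    fun hm => (mem_regularPiece_iff hspan _).2 ⟨∅, by simp, hm⟩
  have hdense : Dense (regularPiece X lam Q) :=
    (dense_stratum_empty hint).mono fun _ hm => hsub hm
  -- On the closure of a singular stratum all coordinates in I_F vanish, so a regular point there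
  -- would make the X i, i ∈ I_F, independent.
  have hrs : ∀ F : Face X lam, F.IsSingular →
      ∀ m ∈ regularPiece X lam Q, m ∉ closure (stratum X lam Q F.I) := by
    intro F hF m hm hmF
    obtain ⟨I, hI', hmI⟩ := (mem_regularPiece_iff hspan m).1 hm
    refine (Face.not_isSingular_iff F).2 (hI'.mono fun j hj => ?_) hF
    exact (hmI j).1 (orbitNorm_eq_zero_of_mem_closure hmF hj)
  have hnonempty : ∀ F, (piece X lam Q F).Nonempty := by
    intro F
    by_cases hF : F.1.IsSingular
    · rw [hsing F hF]
      exact stratum_nonempty F.1.nonempty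
    · rw [hnsing F hF]
      obtain ⟨m, hm⟩ := stratum_nonempty (Q := Q) hint
      exact ⟨m, hsub hm⟩
  have hmeets : ∀ F F', (piece X lam Q F ∩ closure (piece X lam Q F')).Nonempty → F ≤ F' := by
    intro F F' h
    change F.1 ≤ F'.1
    rw [Face.le_iff]
    by_cases hF' : F'.1.IsSingular
    · obtain ⟨m, hm, hm'⟩ := h
      rw [hsing F' hF'] at hm'
      by_cases hF : F.1.IsSingular
      · rw [hsing F hF] at hm
        exact fun j hj => (hm j).1 (orbitNorm_eq_zero_of_mem_closure hm' hj)
      · rw [hnsing F hF] at hm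
        exact absurd hm' (hrs F'.1 hF' m hm)
    · simp [hempty F' hF']
  have hle : ∀ F F', F ≤ F' → piece X lam Q F ⊆ closure (piece X lam Q F') := by
    intro F F' h
    have h1 : F'.1.I ⊆ F.1.I := Face.le_iff.1 h
    by_cases hF' : F'.1.IsSingular
    · by_cases hF : F.1.IsSingular
      · rw [hsing F hF, hsing F' hF']
        exact fun m hm => mem_closure_stratum F'.1.nonempty fun j hj => (hm j).2 (h1 hj)
      · rw [hempty F hF, Finset.subset_empty] at h1
        exact absurd hF' (hns _ h1)
    · rw [hnsing F' hF', hdense.closure_eq]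
      exact Set.subset_univ _
  have hself : ∀ F F', piece X lam Q F ⊆ closure (piece X lam Q F') →
      (piece X lam Q F ∩ closure (piece X lam Q F')).Nonempty := fun F F' h => by
    rw [Set.inter_eq_left.2 h]
    exact hnonempty F
  exact
    { compact := compactSpace_spaceM hb
      finite := by
        refine Finite.of_injective (fun F : PieceIndex X lam => F.1.I) fun F G h => ?_
        exact Subtype.ext (Face.ext h)
      quasifold := by
        intro F
        by_cases hF : F.1.IsSingular
        · obtain ⟨A, -⟩ := hface F.1
          rw [piece, if_pos hF]
          exact ⟨A⟩
        · obtain ⟨A, -⟩ := hreg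
          rw [hnsing F hF, hdim_empty _ (hempty F hF)]
          exact ⟨A⟩
      disjoint := by
        have key : ∀ F F' : PieceIndex X lam, F.1.IsSingular → ¬ F'.1.IsSingular →
            Disjoint (piece X lam Q F) (piece X lam Q F') := by
          intro F F' hF hF'
          rw [hsing F hF, hnsing F' hF']
          exact Set.disjoint_left.2 fun m hm hm' => hrs F.1 hF m hm' (subset_closure hm)
        intro F F' hFF'
        by_cases hF : F.1.IsSingular <;> by_cases hF' : F'.1.IsSingular
        · rw [hsing F hF, hsing F' hF']
          exact stratum_disjoint fun h => hFF' (Subtype.ext (Face.ext h))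
        · exact key F F' hF hF'
        · exact (key F' F hF' hF).symm
        · exact absurd (Subtype.ext (Face.ext ((hempty F hF).trans (hempty F' hF').symm))) hFF'
      locallyClosed := by
        intro F
        by_cases hF : F.1.IsSingular
        · rw [hsing F hF]
          exact isLocallyClosed_stratum _
        · rw [hnsing F hF]
          exact (isOpen_regularPiece hspan).isLocallyClosed
      connected := by
        intro F
        by_cases hF : F.1.IsSingular
        · rw [hsing F hF]
          exact isConnected_stratum hspan F.1
        · rw [hnsing F hF]
          -- The regular piece lies between the stratum over the interior, which is connected, and
          -- its closure, which is M.
          have h1 := isConnected_stratum (Q := Q) hspan (⟨∅, hint⟩ : Face X lam)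
          refine h1.subset_closure (fun m hm => hsub hm) ?_
          rw [(dense_stratum_empty hint).closure_eq]
          exact Set.subset_univ _
      cover := by
        refine Set.eq_univ_of_forall fun m => Set.mem_iUnion.2 ?_
        obtain ⟨I, hm⟩ := exists_mem_stratum m
        let F : Face X lam := ⟨I, openFace_nonempty_of_mem_stratum hm⟩
        by_cases hF : F.IsSingular
        · refine ⟨⟨F, Or.inl hF⟩, ?_⟩
          rw [hsing _ hF]
          exact hm
        · let F₀ : Face X lam := ⟨∅, hint⟩
          refine ⟨⟨F₀, Or.inr ((hI F₀).2 rfl)⟩, ?_⟩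
          rw [hnsing _ (hns F₀ rfl)]
          exact (mem_regularPiece_iff hspan m).2 ⟨I, F.not_isSingular_iff.1 hF, hm⟩
      meets_iff_subset := fun F F' => ⟨fun h => hle F F' (hmeets F F' h), hself F F'⟩
      subset_iff_le := fun F F' => ⟨fun h => hmeets F F' (hself F F' h), hle F F'⟩
      regular := by
        let F₀ : Face X lam := ⟨∅, hint⟩
        have hF₀ := hns F₀ rfl
        refine ⟨⟨F₀, Or.inr ((hI F₀).2 rfl)⟩, fun F' => Face.le_iff.2 (Finset.empty_subset _),
          ?_, ?_, ?_⟩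
        · rw [hnsing _ hF₀]
          exact isOpen_regularPiece hspan
        · rw [hnsing _ hF₀]
          exact hdense
        · exact congrArg (2 * ·) (hdim_empty F₀ rfl) }
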